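/- **Definitions.** Let $$F(x,y,z)=(\zeta+2)xyz-\zeta(xy+yz+xz+x+y+z)+\zeta(2\zeta+1),$$ $$G(x,y)=(\zeta+2)xy(x+y)-\zeta(x^2+y^2)-2(\zeta^2+3\zeta+1)xy+\zeta(2\zeta+1)(x+y),$$ and for $n\ge 0$ let $$S_n(x_1,\dots,x_n,y_1,\dots,y_n,z)=\frac{\prod_{i,j=1}^nG(x_i,y_j)}{\prod_{1\le i<j\le n}(x_j-x_i)(y_j-y_i)}\det_{1\le i,j\le n}\left(\frac{F(x_i,y_j,z)}{G(x_i,y_j)}\right),$$ which is a polynomial in $x_1,\dots,x_n,y_1,\dots,y_n,z$ (and $\zeta$). For $n\ge 0$ the polynomial $p_n$ is defined by $$\left(1+\tfrac\zeta2\right)^{n^2}S_n\Big|_{x_1=\dots=x_n=z=2\zeta+1,\ y_1=\dots=y_n=\zeta/(\zeta+2)}=(-1)^{\binom{n+1}2}\zeta^{n^2}(1+\zeta)^{n^2}(1+2\zeta)^{\lfloor n^2/4\rfloor}\left(1+\tfrac\zeta2\right)^{\lfloor (n-1)^2/4\rfloor}p_n(\zeta),$$ and $p_{-1}=1$. For a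 polynomial $p$ put $\tilde p(\zeta)=\zeta^{\deg p}p(1/\zeta)$, and let $\chi(\text{true})=1$, $\chi(\text{false})=0$. **Theorem 3.7.** The rational functions $p_n$ so defined ($n\ge0$) are polynomials, with rational coefficients. For every $n\ge 0$ set $$A=(\zeta+1)^2p_{n-1}(\zeta),\qquad B=\zeta^{n+1}\tilde p_n(\zeta),$$ $$C=(1+2\zeta)^{1+\chi(n\text{ even})}\left(1+\tfrac\zeta2\right)^{1+\chi(n\text{ odd})}p_n(\zeta)^2 .$$ Then the equation $AX-BY=C$ has a solution $(X,Y)$ in polynomials with rational coefficients such that $X=p_{n+1}$ and $\deg Y=\deg A$. This gives a recursive construction of the $p_n$ from $p_{-1}=p_0=1$ in the following sense: whenever $A$ and $B$ are relatively prime, $p_{n+1}$ is the unique $X\in\mathbb Q[\zeta]$ for which there is $Y\in\mathbb Q[\zeta]$ with $AX-BY=C$ and $\deg Y\le\deg A$, and whose coefficient of $\zeta^{(n+1)(n+2)/2}$ is $2^{-\lfloor (n+3)/2\rfloor}\binom{2n+4}{n+2}$. -/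

import Mathlib

open Polynomial

namespace ThreeColour

noncomputable section

/-- The symmetric polynomial `F(x, y, z)`, with parameter `ζ`. -/
def F {R : Type*} [CommRing R] (ζ x y z : R) : R :=
  (ζ + 2) * x * y * z - ζ * (x * y + y * z + x * z + x + y + z) + ζ * (2 * ζ + 1)

/-- The symmetric polynomial `G(x, y)`, with parameter `ζ`. -/
def G {R : Type*} [CommRing R] (ζ x y : R) : R :=
  (ζ + 2) * x * y * (x + y) - ζ * (x ^ 2 + y ^ 2) - 2 * (ζ ^ 2 + 3 * ζ + 1) * x * y
    + ζ * (2 * ζ + 1) * (x + y)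

/-- Index set of the `2n+1` variables `x₁, …, xₙ, y₁, …, yₙ, z`. -/
abbrev Vars (n : ℕ) : Type := Fin n ⊕ Fin n ⊕ Unit

/-- Polynomials in `x₁, …, xₙ, y₁, …, yₙ, z` with coefficients in `ℚ[ζ]`. -/
abbrev SRing (n : ℕ) : Type := MvPolynomial (Vars n) ℚ[X]

/-- The parameter `ζ`. -/
def zeta (n : ℕ) : SRing n := MvPolynomial.C X

/-- The variable `xᵢ`. -/
def vx {n : ℕ} (i : Fin n) : SRing n := MvPolynomial.X (Sum.inl i)

/-- The variable `yⱼ`. -/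
def vy {n : ℕ} (j : Fin n) : SRing n := MvPolynomial.X (Sum.inr (Sum.inl j))

/-- The variable `z`. -/
def vz (n : ℕ) : SRing n := MvPolynomial.X (Sum.inr (Sum.inr ()))

/-- The rational function
`∏ᵢⱼ G(xᵢ,yⱼ) / ∏_{i<j} (xⱼ-xᵢ)(yⱼ-yᵢ) * det (F(xᵢ,yⱼ,z) / G(xᵢ,yⱼ))`. -/
def sFrac (n : ℕ) : FractionRing (SRing n) :=
  let ι : SRing n → FractionRing (SRing n) := algebraMap _ _
  (∏ i : Fin n, ∏ j : Fin n, ι (G (zeta n) (vx i) (vy j))) /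
      (∏ i : Fin n, ∏ j ∈ Finset.Ioi i, ι ((vx j - vx i) * (vy j - vy i))) *
    Matrix.det (Matrix.of fun i j : Fin n =>
      ι (F (zeta n) (vx i) (vy j) (vz n)) / ι (G (zeta n) (vx i) (vy j)))

/-! ### `sFrac n` is a polynomial -/

theorem G_ne_zero {n : ℕ} (i j : Fin n) : G (zeta n) (vx i) (vy j) ≠ 0 := by
  intro h
  have := congrArg (MvPolynomial.eval₂Hom (Polynomial.evalRingHom (0 : ℚ))
    (Sum.elim (fun _ => (1 : ℚ)) (fun _ => 2))) h
  simp [G, zeta, vx, vy] at this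
  norm_num at this

theorem irreducible_X_sub_X {σ : Type*} {a b : σ} (hab : a ≠ b) :
    Irreducible (MvPolynomial.X a - MvPolynomial.X b : MvPolynomial σ ℚ[X]) := by
  classical
  have h := MvPolynomial.irreducible_sumSMulX
    (Finsupp.single a (1 : ℚ[X]) - Finsupp.single b 1) ⟨a, by simp [hab]⟩
    (fun r hr => isUnit_of_dvd_one (by simpa [hab] using hr a))
  simpa [MvPolynomial.sumSMulX, map_sub] using h

theorem isRelPrime_X_sub_X {σ : Type*} {a b c d : σ} (hab : a ≠ b) (hcd : c ≠ d)
    (h : ¬ (a = c ∧ b = d)) (h' : ¬ (a = d ∧ b = c)) :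
    IsRelPrime (MvPolynomial.X a - MvPolynomial.X b : MvPolynomial σ ℚ[X])
      (MvPolynomial.X c - MvPolynomial.X d) := by
  classical
  rw [(irreducible_X_sub_X hab).isRelPrime_iff_not_dvd]
  rintro ⟨q, hq⟩
  have := congrArg (MvPolynomial.rename (Function.update id a b)) hq
  simp only [map_sub, map_mul, MvPolynomial.rename_X, Function.update_self,
    Function.update_of_ne hab.symm, id, sub_self, zero_mul, sub_eq_zero] at this
  have h2 := MvPolynomial.X_injective this
  by_cases hc : c = a <;> by_cases hd : d = a <;>
    simp_all [Function.update]

theorem X_sub_X_dvd {σ : Type} {a b : σ} {P : MvPolynomial σ ℚ[X]}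
    (h : ∀ (T : Type) [CommRing T] (φ : MvPolynomial σ ℚ[X] →+* T),
      φ (MvPolynomial.X a) = φ (MvPolynomial.X b) → φ P = 0) :
    (MvPolynomial.X a - MvPolynomial.X b : MvPolynomial σ ℚ[X]) ∣ P := by
  let I : Ideal (MvPolynomial σ ℚ[X]) := Ideal.span {MvPolynomial.X a - MvPolynomial.X b}
  have := h (MvPolynomial σ ℚ[X] ⧸ I) (Ideal.Quotient.mk I) (by
    rw [← sub_eq_zero, ← map_sub]
    exact Ideal.Quotient.eq_zero_iff_mem.2 (Ideal.subset_span rfl))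
  exact Ideal.mem_span_singleton.1 (Ideal.Quotient.eq_zero_iff_mem.1 this)

theorem map_F {R S : Type*} [CommRing R] [CommRing S] (φ : R →+* S) (ζ x y z : R) :
    φ (F ζ x y z) = F (φ ζ) (φ x) (φ y) (φ z) := by
  simp [F, map_ofNat φ]

theorem map_G {R S : Type*} [CommRing R] [CommRing S] (φ : R →+* S) (ζ x y : R) :
    φ (G ζ x y) = G (φ ζ) (φ x) (φ y) := by
  simp [G, map_ofNat φ]

/-- The product of all `G(xᵢ,yⱼ)` times the determinant, with denominators cleared by rows. -/
def numRow (n : ℕ) : SRing n := Matrix.det (Matrix.of fun i j : Fin n =>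
  F (zeta n) (vx i) (vy j) (vz n) * ∏ k ∈ Finset.univ.erase j, G (zeta n) (vx i) (vy k))

/-- The same, with denominators cleared by columns. -/
def numCol (n : ℕ) : SRing n := Matrix.det (Matrix.of fun i j : Fin n =>
  F (zeta n) (vx i) (vy j) (vz n) * ∏ k ∈ Finset.univ.erase i, G (zeta n) (vx k) (vy j))

theorem algebraMap_numRow (n : ℕ) :
    algebraMap (SRing n) (FractionRing (SRing n)) (numRow n) =
    (∏ i : Fin n, ∏ j : Fin n, algebraMap _ _ (G (zeta n) (vx i) (vy j))) *
    Matrix.det (Matrix.of fun i j : Fin n =>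
      algebraMap _ (FractionRing (SRing n)) (F (zeta n) (vx i) (vy j) (vz n)) /
        algebraMap _ _ (G (zeta n) (vx i) (vy j))) := by
  rw [← Matrix.det_mul_column, numRow, RingHom.map_det]
  congr 1
  ext i j
  have h0 : algebraMap (SRing n) (FractionRing (SRing n)) (G (zeta n) (vx i) (vy j)) ≠ 0 := by
    simpa using G_ne_zero i j
  simp only [RingHom.mapMatrix_apply, Matrix.map_apply, Matrix.of_apply, map_mul, map_prod]
  rw [← Finset.mul_prod_erase Finset.univ _ (Finset.mem_univ j)]
  field_simp

theorem algebraMap_numCol (n : ℕ) :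
    algebraMap (SRing n) (FractionRing (SRing n)) (numCol n) =
    (∏ i : Fin n, ∏ j : Fin n, algebraMap _ _ (G (zeta n) (vx i) (vy j))) *
    Matrix.det (Matrix.of fun i j : Fin n =>
      algebraMap _ (FractionRing (SRing n)) (F (zeta n) (vx i) (vy j) (vz n)) /
        algebraMap _ _ (G (zeta n) (vx i) (vy j))) := by
  rw [Finset.prod_comm, ← Matrix.det_mul_row, numCol, RingHom.map_det]
  congr 1
  ext i j
  have h0 : algebraMap (SRing n) (FractionRing (SRing n)) (G (zeta n) (vx i) (vy j)) ≠ 0 := by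
    simpa using G_ne_zero i j
  simp only [RingHom.mapMatrix_apply, Matrix.map_apply, Matrix.of_apply, map_mul, map_prod]
  rw [← Finset.mul_prod_erase Finset.univ _ (Finset.mem_univ i)]
  field_simp

theorem numRow_eq_numCol (n : ℕ) : numRow n = numCol n :=
  IsFractionRing.injective (SRing n) (FractionRing (SRing n))
    ((algebraMap_numRow n).trans (algebraMap_numCol n).symm)

theorem vandermonde_dvd (n : ℕ) :
    (∏ i : Fin n, ∏ j ∈ Finset.Ioi i, ((vx j - vx i) * (vy j - vy i))) ∣ numRow n := by
  classical
  have hx : ∀ i j : Fin n, i < j → (vx j - vx i) ∣ numRow n := by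
    intro i j hij
    refine X_sub_X_dvd fun T _ φ hφ => ?_
    rw [numRow, RingHom.map_det]
    refine Matrix.det_zero_of_row_eq hij.ne' (funext fun k => ?_)
    have hφ' : φ (vx j) = φ (vx i) := hφ
    simp only [RingHom.mapMatrix_apply, Matrix.map_apply, Matrix.of_apply, map_mul, map_prod,
      map_F, map_G, hφ']
  have hy : ∀ i j : Fin n, i < j → (vy j - vy i) ∣ numRow n := by
    intro i j hij
    rw [numRow_eq_numCol]
    refine X_sub_X_dvd fun T _ φ hφ => ?_
    rw [numCol, RingHom.map_det]
    refine Matrix.det_zero_of_column_eq hij.ne' (fun k => ?_)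
    have hφ' : φ (vy j) = φ (vy i) := hφ
    simp only [RingHom.mapMatrix_apply, Matrix.map_apply, Matrix.of_apply, map_mul, map_prod,
      map_F, map_G, hφ']
  simp only [Finset.prod_mul_distrib]
  rw [Finset.prod_sigma', Finset.prod_sigma']
  refine IsRelPrime.mul_dvd ?_ ?_ ?_
  · refine IsRelPrime.prod_left fun a ha => IsRelPrime.prod_right fun b hb => ?_
    simp only [Finset.mem_sigma, Finset.mem_univ, Finset.mem_Ioi, true_and] at ha hb
    apply isRelPrime_X_sub_X <;> simp [ha.ne', hb.ne']
  · refine Finset.prod_dvd_of_isRelPrime (fun a ha b hb hab => ?_) fun a ha => hx _ _ ?_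
    · simp only [Finset.coe_sigma, Set.mem_sigma_iff, Finset.coe_univ, Set.mem_univ, true_and,
        Finset.coe_Ioi, Set.mem_Ioi] at ha hb
      obtain ⟨a1, a2⟩ := a
      obtain ⟨b1, b2⟩ := b
      apply isRelPrime_X_sub_X <;> simp_all [ha.ne', hb.ne'] <;> grind
    · simpa using ha
  · refine Finset.prod_dvd_of_isRelPrime (fun a ha b hb hab => ?_) fun a ha => hy _ _ ?_
    · simp only [Finset.coe_sigma, Set.mem_sigma_iff, Finset.coe_univ, Set.mem_univ, true_and,
        Finset.coe_Ioi, Set.mem_Ioi] at ha hb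
      obtain ⟨a1, a2⟩ := a
      obtain ⟨b1, b2⟩ := b
      apply isRelPrime_X_sub_X <;> simp_all [ha.ne', hb.ne'] <;> grind
    · simpa using ha

theorem exists_S (n : ℕ) : ∃ S : SRing n, algebraMap _ (FractionRing (SRing n)) S = sFrac n := by
  obtain ⟨S, hS⟩ := vandermonde_dvd n
  refine ⟨S, ?_⟩
  have hV : algebraMap (SRing n) (FractionRing (SRing n))
      (∏ i : Fin n, ∏ j ∈ Finset.Ioi i, ((vx j - vx i) * (vy j - vy i))) ≠ 0 := by
    rw [Ne, FaithfulSMul.algebraMap_eq_zero_iff]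
    simp only [Finset.prod_eq_zero_iff, not_exists, not_and, Finset.mem_Ioi]
    intro i _ j hij h
    rcases mul_eq_zero.1 h with h | h <;>
    · have := MvPolynomial.X_injective (sub_eq_zero.1 h)
      simp [hij.ne'] at this
  have h1 := algebraMap_numRow n
  rw [hS, map_mul, mul_comm] at h1
  rw [sFrac]
  simp only [← map_prod] at h1 ⊢
  rw [div_mul_eq_mul_div, eq_div_iff hV, h1]

/-- The polynomial `Sₙ(x₁, …, xₙ, y₁, …, yₙ, z)`. -/
def S (n : ℕ) : SRing n := (exists_S n).choose

theorem S_spec (n : ℕ) : algebraMap _ (FractionRing (SRing n)) (S n) = sFrac n :=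
  (exists_S n).choose_spec

/-! ### The polynomials `pₙ` -/

/-- The specialization of `Sₙ` to `xᵢ = z = 2ζ+1`, `yⱼ = ζ/(ζ+2)`, a rational function of `ζ`. -/
def specS (n : ℕ) : RatFunc ℚ :=
  MvPolynomial.aeval
    (Sum.elim (fun _ => 2 * RatFunc.X + 1)
      (Sum.elim (fun _ => RatFunc.X / (RatFunc.X + 2)) (fun _ => 2 * RatFunc.X + 1))) (S n)

/-- The rational function `pₙ` determined by
`(1+ζ/2)^(n²) Sₙ(2ζ+1, …, ζ/(ζ+2), …)
  = (-1)^(n(n+1)/2) ζ^(n²) (1+ζ)^(n²) (1+2ζ)^⌊n²/4⌋ (1+ζ/2)^⌊(n-1)²/4⌋ pₙ(ζ)`.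
(For `n = 0` the truncated subtraction is harmless, as `⌊(-1)²/4⌋ = 0`.) -/
def pFrac (n : ℕ) : RatFunc ℚ :=
  (1 + RatFunc.X / 2) ^ (n ^ 2) * specS n /
    ((-1) ^ (n + 1).choose 2 * RatFunc.X ^ (n ^ 2) * (1 + RatFunc.X) ^ (n ^ 2) *
      (1 + 2 * RatFunc.X) ^ (n ^ 2 / 4) * (1 + RatFunc.X / 2) ^ ((n - 1) ^ 2 / 4))

/-- The polynomial `pₙ`: the numerator of `pFrac n` in lowest terms with monic denominator, which
is `pFrac n` itself when that rational function is a polynomial. -/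
def p (n : ℕ) : ℚ[X] := (pFrac n).num

/-- `pPrev n = pₙ₋₁`, where `p₋₁ = 1`. -/
def pPrev : ℕ → ℚ[X]
  | 0 => 1
  | n + 1 => p n

/-- `A = (ζ+1)² pₙ₋₁`. -/
def coefA (n : ℕ) : ℚ[X] := (X + 1) ^ 2 * pPrev n

/-- `B = ζ^(n+1) p̃ₙ`, where `p̃ₙ = ζ^(deg pₙ) pₙ(1/ζ)`. -/
def coefB (n : ℕ) : ℚ[X] := X ^ (n + 1) * (p n).reverse

/-- `C = (1+2ζ)^(1+χ(n even)) (1+ζ/2)^(1+χ(n odd)) pₙ²`. -/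
def coefC (n : ℕ) : ℚ[X] :=
  (1 + 2 * X) ^ (1 + if Even n then 1 else 0) *
    (1 + C (1 / 2) * X) ^ (1 + if Odd n then 1 else 0) * p n ^ 2

end

end ThreeColour

/-!
Put `P(t) = t²(t - (2ζ+1))`, `Q(t) = (ζ+2)t - ζ` and `H(t) = t - ζ`. The polynomial `G` is
`(Q(x) P(y) - P(x) Q(y)) / (y - x)`, so it vanishes on pairs of points in one fibre of the degree
three map `P / Q`. This leads to a closed formula (`aeval_S`): `Sₙ` is an explicit constant times
the `n × n` determinant `Wdet` of the residues of `tⁱ Π(t) H(t) / (P ^ (j+1) Q ^ (n-j))` along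
`P = 0`, where `Π` is the monic polynomial with roots `xᵢ`, `yⱼ`, `z`. To prove it, both sides are
regarded as polynomials in one `y`; they satisfy the same recursion when this `y` lies in the fibre
of some `xᵢ` (`num_cons`, `Wdet_succ`), and there are enough such points.

The formula shows that `Sₙ` is symmetric in all its variables. The Desnanot–Jacobi identity for the
determinant defining `Sₙ` therefore gives a relation (`Wdet_jacobi`) between `Sₙ₊₁ Sₙ₋₁` and
products of two `Sₙ`. At nodes in `{2ζ+1, ζ/(ζ+2)}` the residues reduce to coefficients of
polynomials, and the relation becomes (`det_toda`)
`2(ζ+1)² Mₙ₊₁ Mₙ₋₁ = ζ Uₙ Lₙ - (2ζ+1)²(ζ+2)² Mₙ²`,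
where `M`, `L`, `U` are the determinants `detMid`, `detLow`, `detHigh` of polynomials in `ζ`.

The theorem is read off from this relation as follows.
* `Mₙ` is divisible by the powers of `2ζ+1` and `1+ζ/2` in the definition of `pₙ`, because its
  entries are divisible by suitable powers (`pow_dvd_det_of_dvd`). Hence `pₙ` is a polynomial
  (`detMid_eq`, `algebraMap_p`). The same argument for `Uₙ` leaves a cofactor, which is `Y` up to a
  constant (`exists_bezout_succ`).
* The substitution `ζ ↦ 1/ζ` turns `Mₙ` into `Lₙ` (`detMid_inv`), which explains the term
  `ζ^(n+1) p̃ₙ` (`X_mul_detLow`).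
* The leading coefficient of `Mₙ` is, up to sign and powers of `2`, a minor of the unitriangular
  matrix of coefficients of `ψ^j (1 - X/2)(1 - X)`, where `ψ = X - X²/2`. Cramer's rule and the
  central binomial series give its value (`det_minor_eq`). From it follow `deg pₙ` and `deg Y`, and
  uniqueness is then the usual comparison of two solutions of `A X - B Y = C` (`degree_of_bezout`,
  `eq_of_bezout`).
-/

namespace ThreeColour

noncomputable section

/-! ### Residues along the cubic `P` -/

section Residue
variable {R : Type*} [CommRing R]

/-- The cubic `P(t) = t ^ 2 * (t - (2ζ + 1))`. With `Q = linQ ζ` it satisfies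
`(y - x) G(x, y) = Q(x) P(y) - P(x) Q(y)`, so the roots of `G(x, y)` in `y` are the
other two points of the fibre of `P / Q` through `x`. -/
def cubP (ζ : R) : R[X] := X ^ 3 - C (2 * ζ + 1) * X ^ 2

/-- The linear polynomial `Q(t) = (ζ + 2) t - ζ`, with root `ζ / (ζ + 2)`. -/
def linQ (ζ : R) : R[X] := C (ζ + 2) * X - C ζ

/-- The linear polynomial `H(t) = t - ζ`. -/
def linH (ζ : R) : R[X] := X - C ζ

theorem cubP_eq (ζ : R) : cubP ζ = X ^ 2 * (X - C (2 * ζ + 1)) := by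
  rw [cubP]; ring

theorem monic_cubP (ζ : R) : (cubP ζ).Monic := by
  rw [cubP_eq]; exact (monic_X_pow 2).mul (monic_X_sub_C _)

theorem natDegree_cubP [Nontrivial R] (ζ : R) : (cubP ζ).natDegree = 3 := by
  rw [cubP_eq, (monic_X_pow 2).natDegree_mul (monic_X_sub_C _),
    natDegree_X_sub_C, natDegree_X_pow]

theorem natDegree_cubP_pow [Nontrivial R] (ζ : R) (m : ℕ) :
    (cubP ζ ^ m).natDegree = 3 * m := by
  rw [(monic_cubP ζ).natDegree_pow, natDegree_cubP, mul_comm]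

/-- The coefficient of `t ^ (3m - 1)` in the remainder of `v` modulo `P ^ m`, which is the sum of
the residues of `v / P ^ m` at the roots of `P`. For `m = 0` the index is truncated to `0`, and the
value is `0` because the remainder modulo `1` vanishes. -/
def resid (ζ : R) (m : ℕ) : R[X] →ₗ[R] R :=
  (lcoeff R (3 * m - 1)).comp (modByMonicHom (cubP ζ ^ m))

theorem resid_apply (ζ : R) (m : ℕ) (v : R[X]) :
    resid ζ m v = (v %ₘ cubP ζ ^ m).coeff (3 * m - 1) := rfl

theorem resid_C_mul (ζ : R) (m : ℕ) (r : R) (v : R[X]) :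
    resid ζ m (C r * v) = r * resid ζ m v := by
  rw [← smul_eq_C_mul, map_smul, smul_eq_mul]

theorem resid_congr (ζ : R) (m : ℕ) {v w : R[X]} (h : cubP ζ ^ m ∣ v - w) :
    resid ζ m v = resid ζ m w := by
  rw [← sub_eq_zero, ← map_sub, resid_apply,
    (modByMonic_eq_zero_iff_dvd ((monic_cubP ζ).pow m)).2 h, coeff_zero]

theorem resid_of_degree_lt (ζ : R) {m : ℕ} {v : R[X]} (h : v.degree < (3 * m : ℕ)) :
    resid ζ m v = v.coeff (3 * m - 1) := by
  nontriviality R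
  rw [resid_apply, (modByMonic_eq_self_iff ((monic_cubP ζ).pow m)).2]
  rwa [degree_eq_natDegree ((monic_cubP ζ).pow m).ne_zero, natDegree_cubP_pow]

theorem resid_eq_zero_of_natDegree_lt (ζ : R) {m : ℕ} {v : R[X]}
    (h : v.natDegree < 3 * m - 1) : resid ζ m v = 0 := by
  rw [resid_of_degree_lt ζ, coeff_eq_zero_of_natDegree_lt h]
  exact degree_le_natDegree.trans_lt (by exact_mod_cast (by omega))

theorem resid_zero (ζ : R) (v : R[X]) : resid ζ 0 v = 0 := by
  simp [resid_apply]

theorem resid_succ_cubP_pow_mul (ζ : R) (m k : ℕ) (hm : 0 < m) (v : R[X]) :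
    resid ζ (m + k) (cubP ζ ^ k * v) = resid ζ m v := by
  nontriviality R
  have hP := monic_cubP ζ
  have hdeg : (v %ₘ cubP ζ ^ m).degree < (3 * m : ℕ) := by
    have := degree_modByMonic_lt v (hP.pow m)
    rwa [degree_eq_natDegree (hP.pow m).ne_zero, natDegree_cubP_pow] at this
  have h1 : resid ζ (m + k) (cubP ζ ^ k * v)
      = resid ζ (m + k) (cubP ζ ^ k * (v %ₘ cubP ζ ^ m)) := by
    apply resid_congr
    rw [← mul_sub, add_comm, pow_add]
    refine mul_dvd_mul_left _ ⟨v /ₘ cubP ζ ^ m, ?_⟩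
    linear_combination (modByMonic_add_div v (cubP ζ ^ m)).symm
  rw [h1, resid_of_degree_lt, resid_apply]
  · have e : 3 * (m + k) - 1 = (3 * m - 1) + (cubP ζ ^ k).natDegree := by
      rw [natDegree_cubP_pow]; omega
    by_cases h0 : v %ₘ cubP ζ ^ m = 0
    · simp [h0]
    have hle : (v %ₘ cubP ζ ^ m).natDegree ≤ 3 * m - 1 := by
      have := (natDegree_lt_iff_degree_lt h0).2 hdeg
      omega
    rw [e, mul_comm, coeff_mul_add_eq_of_natDegree_le hle le_rfl]
    have := (hP.pow k).coeff_natDegree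
    rw [this, mul_one]
  · rw [mul_comm, (hP.pow k).degree_mul, degree_eq_natDegree (hP.pow k).ne_zero,
      natDegree_cubP_pow]
    calc _ < ((3 * m : ℕ) : WithBot ℕ) + ((3 * k : ℕ) : WithBot ℕ) :=
          WithBot.add_lt_add_right (WithBot.natCast_ne_bot _) hdeg
      _ = _ := by rw [← Nat.cast_add, mul_add]

theorem resid_cubP_mul (ζ : R) (m : ℕ) (v : R[X]) :
    resid ζ (m + 1) (cubP ζ * v) = resid ζ m v := by
  rcases Nat.eq_zero_or_pos m with rfl | hm
  · rw [resid_zero, ← map_zero (resid ζ (0 + 1))]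
    apply resid_congr
    simp
  · simpa using resid_succ_cubP_pow_mul ζ m 1 hm v

/-- If `v` is divisible by `(t - (2ζ + 1)) ^ m`, only the residue at `0` remains. -/
theorem resid_X_sub_C_pow_mul (ζ : R) {m : ℕ} (hm : 0 < m) (w : R[X]) :
    resid ζ m ((X - C (2 * ζ + 1)) ^ m * w) = w.coeff (2 * m - 1) := by
  nontriviality R
  have hX : ((X : R[X]) ^ (2 * m)).Monic := monic_X_pow _
  have hA : ((X - C (2 * ζ + 1)) ^ m).Monic := (monic_X_sub_C _).pow m
  have hAd : ((X - C (2 * ζ + 1)) ^ m).natDegree = m := by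
    rw [(monic_X_sub_C _).natDegree_pow, natDegree_X_sub_C, mul_one]
  have hw : (w %ₘ X ^ (2 * m)).coeff (2 * m - 1) = w.coeff (2 * m - 1) := by
    conv_rhs => rw [← modByMonic_add_div w (X ^ (2 * m)), coeff_add, coeff_X_pow_mul']
    rw [if_neg (by omega), add_zero]
  have hd : (w %ₘ X ^ (2 * m)).degree < (2 * m : ℕ) := by
    simpa [degree_X_pow] using degree_modByMonic_lt w hX
  have h1 : resid ζ m ((X - C (2 * ζ + 1)) ^ m * w)
      = resid ζ m ((X - C (2 * ζ + 1)) ^ m * (w %ₘ X ^ (2 * m))) := by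
    apply resid_congr
    rw [← mul_sub, cubP_eq, mul_pow, ← pow_mul, mul_comm]
    refine mul_dvd_mul_left _ ⟨w /ₘ X ^ (2 * m), ?_⟩
    linear_combination (modByMonic_add_div w (X ^ (2 * m))).symm
  rw [h1, resid_of_degree_lt, ← hw]
  · by_cases h0 : w %ₘ X ^ (2 * m) = 0
    · simp [h0]
    have hle : (w %ₘ X ^ (2 * m)).natDegree ≤ 2 * m - 1 := by
      have := (natDegree_lt_iff_degree_lt h0).2 hd
      omega
    rw [show 3 * m - 1 = (2 * m - 1) + m by omega, mul_comm,
      coeff_mul_add_eq_of_natDegree_le hle hAd.le]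
    have := hA.coeff_natDegree
    rw [hAd] at this
    rw [this, mul_one]
  · rw [mul_comm, hA.degree_mul, degree_eq_natDegree hA.ne_zero, hAd]
    calc _ < ((2 * m : ℕ) : WithBot ℕ) + (m : WithBot ℕ) :=
          WithBot.add_lt_add_right (WithBot.natCast_ne_bot _) hd
      _ = _ := by rw [← Nat.cast_add]; congr 1; omega

theorem map_cubP {S : Type*} [CommRing S] (φ : R →+* S) (ζ : R) :
    (cubP ζ).map φ = cubP (φ ζ) := by
  simp [cubP, map_ofNat φ]

theorem map_linQ {S : Type*} [CommRing S] (φ : R →+* S) (ζ : R) :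
    (linQ ζ).map φ = linQ (φ ζ) := by
  simp [linQ, map_ofNat φ]

theorem map_linH {S : Type*} [CommRing S] (φ : R →+* S) (ζ : R) :
    (linH ζ).map φ = linH (φ ζ) := by
  simp [linH]

theorem resid_map {S : Type*} [CommRing S] (φ : R →+* S) (ζ : R) (m : ℕ) (v : R[X]) :
    resid (φ ζ) m (v.map φ) = φ (resid ζ m v) := by
  rw [resid_apply, resid_apply, ← coeff_map, map_modByMonic _ ((monic_cubP ζ).pow m),
    Polynomial.map_pow, map_cubP]

/-- The matrix of the residues of `t ^ i Φ H / (P ^ (j + 1) Q ^ (n - j))` at the roots of `P`. The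
inverse of `Q` modulo a power of `P` is represented by a polynomial `Qi`. -/
def Wmat (ζ : R) (Qi : R[X]) (n : ℕ) (Φ : R[X]) : Matrix (Fin n) (Fin n) R :=
  Matrix.of fun i j => resid ζ (j + 1) (X ^ (i : ℕ) * (Φ * linH ζ) * Qi ^ (n - j))

/-- The determinant of the residue matrix `Wmat`. -/
def Wdet (ζ : R) (Qi : R[X]) (n : ℕ) (Φ : R[X]) : R := (Wmat ζ Qi n Φ).det

theorem Wdet_map {S : Type*} [CommRing S] (φ : R →+* S) (ζ : R) (Qi : R[X]) (n : ℕ) (Φ : R[X]) :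
    Wdet (φ ζ) (Qi.map φ) n (Φ.map φ) = φ (Wdet ζ Qi n Φ) := by
  rw [Wdet, Wdet, RingHom.map_det]
  congr 1
  ext i j
  simp [Wmat, ← resid_map, map_linH]

end Residue

/-! ### The residue determinant when two nodes lie in one fibre -/

section Fibre
variable {K : Type*} [Field K]

/-- A sum of residues over the roots of `P`, evaluated at the third point `r` of the fibre of
`P / Q = f` through `x` and `s`: the geometric sum in `f Q / P` telescopes. -/
theorem resid_corner (ζ : K) {N : ℕ} (hN : 0 < N) {Qi Y : K[X]} {f x s r : K}
    (hfib : (X - C x) * (X - C s) * (X - C r) = cubP ζ - C f * linQ ζ)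
    (hr : (linQ ζ).eval r ≠ 0) (hQi : cubP ζ ^ N ∣ linQ ζ * Qi - 1) (hY : Y.natDegree ≤ 2 * N) :
    ∑ k ∈ Finset.range N, f ^ k * resid ζ (k + 1) (Y * ((X - C x) * (X - C s)) * Qi ^ (N - k))
      = Y.eval r / (linQ ζ).eval r ^ N := by
  set P := cubP ζ with hP
  set Q := linQ ζ with hQ
  set v := (X - C x) * (X - C s) with hv
  set Ω : K[X] := ∑ k ∈ Finset.range N, (C f * Q) ^ k * P ^ (N - 1 - k) with hΩ
  have hpow : ∀ k, P ^ N ∣ (Q * Qi) ^ k - 1 := fun k =>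
    hQi.trans (by simpa using sub_dvd_pow_sub_pow (Q * Qi) 1 k)
  have hsum : ∑ k ∈ Finset.range N, f ^ k * resid ζ (k + 1) (Y * v * Qi ^ (N - k))
      = resid ζ N (Ω * v * Y * Qi ^ N) := by
    rw [hΩ, Finset.sum_mul, Finset.sum_mul, Finset.sum_mul, map_sum]
    refine Finset.sum_congr rfl fun k hk => ?_
    have hk' : k < N := Finset.mem_range.1 hk
    have h1 := resid_succ_cubP_pow_mul ζ (k + 1) (N - 1 - k) k.succ_pos (Y * v * Qi ^ (N - k))
    rw [show k + 1 + (N - 1 - k) = N by omega] at h1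
    rw [← h1, ← resid_C_mul]
    apply resid_congr
    obtain ⟨w, hw⟩ := hpow k
    have h2 : Qi ^ N = Qi ^ (N - k) * Qi ^ k := by rw [← pow_add]; congr 1; omega
    refine ⟨- (C (f ^ k) * P ^ (N - 1 - k) * Y * v * Qi ^ (N - k) * w), ?_⟩
    rw [h2]
    simp only [← hP]
    rw [mul_pow, C_pow] at *
    linear_combination (-(C f ^ k * P ^ (N - 1 - k) * Y * v * Qi ^ (N - k))) * hw
  rw [hsum]
  set Y1 := Y /ₘ (X - C r)
  set P1 := P ^ N /ₘ (X - C r) with hP1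
  set Q1 := Q ^ N /ₘ (X - C r)
  have div_eq (W : K[X]) : W = C (W.eval r) + (X - C r) * (W /ₘ (X - C r)) := by
    conv_lhs => rw [← modByMonic_add_div W (X - C r), modByMonic_X_sub_C_eq_C_eval]
  have eY : Y = C (Y.eval r) + (X - C r) * Y1 := div_eq Y
  have eP : P ^ N = C ((P ^ N).eval r) + (X - C r) * P1 := div_eq _
  have eQ : Q ^ N = C ((Q ^ N).eval r) + (X - C r) * Q1 := div_eq _
  have hpq : P.eval r = f * Q.eval r := by
    have := congrArg (eval r) hfib
    simp at this
    linear_combination -this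
  set θ := Ω * v with hθ
  have hθ1 : θ * (X - C r) = P ^ N - C (f ^ N) * Q ^ N := by
    have h1 : Ω * (C f * Q - P) = (C f * Q) ^ N - P ^ N := geom_sum₂_mul _ _ _
    rw [mul_pow, ← C_pow] at h1
    rw [hθ]
    linear_combination Ω * hfib - h1
  have hθ2 : θ = P1 - C (f ^ N) * Q1 := by
    apply mul_right_cancel₀ (X_sub_C_ne_zero r)
    rw [hθ1]
    have : C ((P ^ N).eval r) = C (f ^ N) * C ((Q ^ N).eval r) := by
      rw [eval_pow, eval_pow, hpq, mul_pow, C_mul]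
    linear_combination eP - C (f ^ N) * eQ + this
  obtain ⟨w, hw⟩ := hpow N
  rw [mul_pow] at hw
  have hA : resid ζ N ((P ^ N - C (f ^ N) * Q ^ N) * Y1 * Qi ^ N) = 0 := by
    have h1 : resid ζ N ((P ^ N - C (f ^ N) * Q ^ N) * Y1 * Qi ^ N)
        = resid ζ N (-(C (f ^ N) * Y1)) := by
      apply resid_congr
      refine ⟨Y1 * Qi ^ N - C (f ^ N) * Y1 * w, ?_⟩
      linear_combination (-(C (f ^ N) * Y1)) * hw
    rw [h1]
    apply resid_eq_zero_of_natDegree_lt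
    rw [natDegree_neg]
    have h2 : Y1.natDegree = Y.natDegree - 1 := by
      simp [Y1, natDegree_divByMonic _ (monic_X_sub_C r)]
    have h3 := natDegree_C_mul_le (f ^ N) Y1
    omega
  have hB : Q.eval r ^ N * resid ζ N (θ * Qi ^ N) = 1 := by
    have h1 : Q.eval r ^ N * resid ζ N (θ * Qi ^ N) = resid ζ N P1 := by
      rw [← resid_C_mul]
      apply resid_congr
      refine ⟨θ * w - Q1 * Qi ^ N + C (f ^ N) * Q1 * w, ?_⟩
      rw [eval_pow] at eQ
      linear_combination (θ + C (f ^ N) * Q1) * hw - θ * Qi ^ N * eQ - Q1 * Qi ^ N * hθ1 + hθ2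
    have hd : (P ^ N).natDegree = 3 * N := natDegree_cubP_pow ζ N
    have hd1 : P1.natDegree = 3 * N - 1 := by
      rw [hP1, natDegree_divByMonic _ (monic_X_sub_C r), hd, natDegree_X_sub_C]
    have hm : P1.leadingCoeff = 1 := by
      rw [hP1, leadingCoeff_divByMonic_X_sub_C _ ?_, (monic_cubP ζ).pow N]
      intro h
      rw [degree_eq_natDegree ((monic_cubP ζ).pow N).ne_zero, hd] at h
      have : 3 * N = 0 := by exact_mod_cast h
      omega
    rw [h1, resid_of_degree_lt, ← hd1]
    · exact hm
    · exact degree_le_natDegree.trans_lt (by rw [hd1]; exact_mod_cast (by omega))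
  have hfin : θ * Y * Qi ^ N = C (Y.eval r) * (θ * Qi ^ N)
      + (P ^ N - C (f ^ N) * Q ^ N) * Y1 * Qi ^ N := by
    linear_combination θ * Qi ^ N * eY + Y1 * Qi ^ N * hθ1
  rw [hfin, map_add, hA, resid_C_mul, add_zero,
    eq_div_iff (pow_ne_zero _ hr)]
  linear_combination (Y.eval r) * hB

/-- If two of the nodes lie in one fibre of `P / Q`, the residue determinant of size `n + 1`
factors through the one of size `n` with these two nodes removed. -/
theorem Wdet_succ (ζ : K) {n : ℕ} {Qi Φ : K[X]} {f x s r : K}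
    (hfib : (X - C x) * (X - C s) * (X - C r) = cubP ζ - C f * linQ ζ) (hf : f ≠ 0)
    (hr : (linQ ζ).eval r ≠ 0) (hQi : cubP ζ ^ (n + 1) ∣ linQ ζ * Qi - 1)
    (hΦ : Φ.natDegree ≤ 2 * n + 1) :
    Wdet ζ Qi (n + 1) (Φ * ((X - C x) * (X - C s)))
      = Φ.eval r * (r - ζ) / (linQ ζ).eval r ^ (n + 1) * Wdet ζ Qi n Φ := by
  set v := (X - C x) * (X - C s) with hv
  have hHd : (Φ * linH ζ).natDegree ≤ 2 * (n + 1) := by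
    refine natDegree_mul_le.trans ?_
    rw [linH, natDegree_X_sub_C]; omega
  have hcorner := resid_corner ζ n.succ_pos hfib hr hQi hHd
  rw [Wdet]
  -- `m i j` are the entries for `Φ` in size `n`, with one more column, which vanishes
  let m : ℕ → ℕ → K := fun i j => resid ζ (j + 1) (X ^ i * (Φ * linH ζ) * Qi ^ (n - j))
  let top : ℕ → K := fun j => ∑ k ∈ Finset.range (j + 1), f⁻¹ ^ (j - k) *
    resid ζ (k + 1) (Φ * linH ζ * v * Qi ^ (n + 1 - k))
  let B : Matrix (Fin (n + 1)) (Fin (n + 1)) K := Matrix.of fun i j =>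
    if (i : ℕ) = 0 then Wmat ζ Qi (n + 1) (Φ * v) i j
    else resid ζ (j + 1) ((X - C r) * X ^ ((i : ℕ) - 1) * (Φ * v * linH ζ) * Qi ^ (n + 1 - j))
  let D : Matrix (Fin (n + 1)) (Fin (n + 1)) K := Matrix.of fun i j =>
    if (i : ℕ) = 0 then top j else - f * m (i - 1) j
  have h1 : (Wmat ζ Qi (n + 1) (Φ * v)).det = B.det := by
    refine Matrix.det_eq_of_forall_row_eq_smul_add_pred (fun _ => r) (fun j => by simp [B]) ?_
    intro i j
    simp only [B, Matrix.of_apply, Wmat, Fin.val_succ, Nat.succ_ne_zero, if_false,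
      Nat.add_sub_cancel, Fin.val_castSucc]
    rw [← resid_C_mul ζ _ r, ← map_add]
    refine congrArg (resid ζ _) ?_
    ring
  -- multiplying by `(X - x)(X - s)(X - r) = P - f Q` shifts the residues
  have hB : ∀ i j : ℕ, j ≤ n →
      resid ζ (j + 1) ((X - C r) * X ^ i * (Φ * v * linH ζ) * Qi ^ (n + 1 - j))
        = resid ζ j (X ^ i * (Φ * linH ζ) * Qi ^ (n + 1 - j)) - f * m i j := by
    intro i j hj
    rw [← resid_cubP_mul ζ j]
    simp only [m]
    rw [← resid_C_mul ζ _ f, ← map_sub]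
    apply resid_congr
    obtain ⟨w, hw⟩ := (pow_dvd_pow (cubP ζ) (by omega : j + 1 ≤ n + 1)).trans hQi
    have e : Qi ^ (n + 1 - j) = Qi * Qi ^ (n - j) := by
      rw [← pow_succ']; congr 1; omega
    refine ⟨-(C f * X ^ i * Φ * linH ζ * Qi ^ (n - j) * w), ?_⟩
    rw [e]
    linear_combination X ^ i * (Φ * linH ζ) * Qi * Qi ^ (n - j) * hfib
      - C f * X ^ i * Φ * linH ζ * Qi ^ (n - j) * hw
  have h2 : D.det = B.det := by
    refine Matrix.det_eq_of_forall_col_eq_smul_add_pred (fun _ => f⁻¹) ?_ ?_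
    · intro i
      by_cases hi : (i : ℕ) = 0
      · simp only [D, B, Matrix.of_apply, top, Wmat, hi, if_true]
        simp only [Fin.val_zero, zero_add, Finset.sum_range_one, Nat.sub_zero, pow_zero, one_mul]
        refine congrArg (resid ζ _) ?_
        ring
      · simp only [D, B, Matrix.of_apply, if_neg hi]
        have := hB (i - 1) 0 (Nat.zero_le _)
        rw [resid_zero] at this
        simp only [Fin.val_zero, this]
        ring
    · intro i j
      by_cases hi : (i : ℕ) = 0
      · simp only [D, B, Matrix.of_apply, top, Wmat, hi, if_true, Fin.val_succ,
          Fin.val_castSucc]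
        rw [Finset.sum_range_succ, add_comm]
        refine congrArg₂ (· + ·) ?_ ?_
        · simp only [Nat.sub_self, pow_zero, one_mul]
          refine congrArg (resid ζ _) ?_
          ring
        · rw [Finset.mul_sum]
          refine Finset.sum_congr rfl fun k hk => ?_
          rw [show (j : ℕ) + 1 - k = (j - k) + 1 by have := Finset.mem_range.1 hk; omega,
            pow_succ]
          ring
      · simp only [D, B, Matrix.of_apply, if_neg hi, Fin.val_succ, Fin.val_castSucc]
        rw [hB (i - 1) (j + 1) (by omega)]
        have : resid ζ (j + 1) (X ^ ((i : ℕ) - 1) * (Φ * linH ζ) * Qi ^ (n + 1 - (j + 1)))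
            = m (i - 1) j := by
          simp only [m, show n + 1 - ((j : ℕ) + 1) = n - j by omega]
        rw [this]
        field_simp
        ring
  rw [h1, ← h2, Matrix.det_succ_column D (Fin.last n), Fin.sum_univ_succ,
    Finset.sum_eq_zero, add_zero]
  · have hsub : D.submatrix (Fin.succAbove 0) (Fin.succAbove (Fin.last n))
        = (-f) • Wmat ζ Qi n Φ := by
      ext i j
      simp [D, m, Wmat]
    rw [hsub, Matrix.det_smul, Fintype.card_fin]
    have htop : D 0 (Fin.last n) * f ^ n = Φ.eval r * (r - ζ) / (linQ ζ).eval r ^ (n + 1) := by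
      have : Φ.eval r * (r - ζ) = (Φ * linH ζ).eval r := by simp [linH]
      rw [this, ← hcorner]
      simp only [D, Matrix.of_apply, Fin.val_zero, if_true, top, Fin.val_last]
      rw [Finset.sum_mul]
      refine Finset.sum_congr rfl fun k hk => ?_
      have hk' : k ≤ n := Nat.lt_succ_iff.1 (Finset.mem_range.1 hk)
      have : f ^ n = f ^ (n - k) * f ^ k := by rw [← pow_add]; congr 1; omega
      rw [this, inv_pow]
      field_simp
      rfl
    rw [← htop, Wdet]
    simp only [Fin.val_zero, Fin.val_last, zero_add]
    rw [neg_pow f n]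
    have : ((-1 : K) ^ n) * (-1) ^ n = 1 := by rw [← mul_pow]; simp
    linear_combination (D 0 (Fin.last n) * f ^ n * (Wmat ζ Qi n Φ).det) * this
  · intro i _
    have : m i n = 0 := by
      simp only [m, Nat.sub_self, pow_zero, mul_one]
      apply resid_eq_zero_of_natDegree_lt
      refine natDegree_mul_le.trans_lt ?_
      rw [natDegree_X_pow]
      have := i.isLt
      omega
    simp [D, this]

end Fibre

/-! ### Numerators and the fibres of `P / Q` -/

section Numerator
variable {R : Type*} [CommRing R] {n : ℕ}

/-- `∏ᵢⱼ G(xᵢ, yⱼ) * det (F(xᵢ, yⱼ, z) / G(xᵢ, yⱼ))` with denominators cleared by rows. Unlike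
`numRow` it is defined for arguments in any commutative ring. -/
def num (ζ : R) (x y : Fin n → R) (z : R) : R :=
  Matrix.det (Matrix.of fun i j => ∏ k, if k = j then F ζ (x i) (y k) z else G ζ (x i) (y k))

/-- The Vandermonde product `∏_{i < j} (xⱼ - xᵢ)`. -/
def vd (x : Fin n → R) : R := ∏ i, ∏ j ∈ Finset.Ioi i, (x j - x i)

/-- The monic polynomial with roots `x₁, …, xₙ, y₁, …, yₙ, z`. -/
def nodePoly (x y : Fin n → R) (z : R) : R[X] :=
  (∏ i, (X - C (x i))) * (∏ j, (X - C (y j))) * (X - C z)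

theorem num_perm (ζ : R) (x y : Fin n → R) (z : R) (σ : Equiv.Perm (Fin n)) :
    num ζ (x ∘ σ) y z = (Equiv.Perm.sign σ : ℤ) * num ζ x y z := by
  rw [num, num, ← Matrix.det_permute]
  rfl

theorem vd_perm (x : Fin n → R) (σ : Equiv.Perm (Fin n)) :
    vd (x ∘ σ) = (Equiv.Perm.sign σ : ℤ) * vd x := by
  rw [vd, vd, ← Matrix.det_vandermonde, ← Matrix.det_vandermonde, ← Matrix.det_permute]
  rfl

theorem nodePoly_perm (x y : Fin n → R) (z : R) (σ : Equiv.Perm (Fin n)) :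
    nodePoly (x ∘ σ) y z = nodePoly x y z := by
  rw [nodePoly, nodePoly]
  congr 2
  exact Equiv.prod_comp σ fun i => X - C (x i)

theorem vd_cons (a : R) (x : Fin n → R) :
    vd (Fin.cons a x : Fin (n + 1) → R) = (∏ i, (x i - a)) * vd x := by
  rw [vd, Fin.prod_univ_succ, vd]
  simp [Fin.prod_Ioi_succ]

theorem nodePoly_cons (a b : R) (x y : Fin n → R) (z : R) :
    nodePoly (Fin.cons a x : Fin (n + 1) → R) (Fin.cons b y) z
      = nodePoly x y z * ((X - C a) * (X - C b)) := by
  simp only [nodePoly, Fin.prod_univ_succ, Fin.cons_zero, Fin.cons_succ]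
  ring

/-- When `G(a, b) = 0` the first row of the determinant has a single nonzero entry. -/
theorem num_cons (ζ : R) (a b : R) (x y : Fin n → R) (z : R) (h : G ζ a b = 0) :
    num ζ (Fin.cons a x : Fin (n + 1) → R) (Fin.cons b y) z
      = F ζ a b z * (∏ j, G ζ a (y j)) * (∏ i, G ζ (x i) b) * num ζ x y z := by
  rw [num, Matrix.det_succ_row_zero, Fin.sum_univ_succ, Finset.sum_eq_zero, add_zero]
  · have : (Matrix.of fun i j : Fin (n + 1) => ∏ k,
        if k = j then F ζ ((Fin.cons a x : Fin (n + 1) → R) i)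
          ((Fin.cons b y : Fin (n + 1) → R) k) z
        else G ζ ((Fin.cons a x : Fin (n + 1) → R) i)
          ((Fin.cons b y : Fin (n + 1) → R) k)).submatrix Fin.succ (Fin.succAbove 0)
      = Matrix.of fun i j => G ζ (x i) b * (Matrix.of fun i j : Fin n => ∏ k,
          if k = j then F ζ (x i) (y k) z else G ζ (x i) (y k)) i j := by
      ext i j
      simp [Fin.prod_univ_succ, (Fin.succ_ne_zero _).symm]
    rw [this, Matrix.det_mul_column, num]
    simp [Fin.prod_univ_succ, Fin.succ_ne_zero]
    ring
  · intro j _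
    simp [Fin.prod_univ_succ, (Fin.succ_ne_zero _).symm, h]

theorem num_map {S : Type*} [CommRing S] (φ : R →+* S) (ζ : R) (x y : Fin n → R) (z : R) :
    num (φ ζ) (φ ∘ x) (φ ∘ y) (φ z) = φ (num ζ x y z) := by
  rw [num, num, RingHom.map_det]
  congr 1
  ext i j
  simp only [Matrix.of_apply, RingHom.mapMatrix_apply, Matrix.map_apply, map_prod, apply_ite φ,
    map_F, map_G, Function.comp_apply]

theorem vd_map {S : Type*} [CommRing S] (φ : R →+* S) (x : Fin n → R) :
    vd (φ ∘ x) = φ (vd x) := by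
  simp [vd, map_prod]

theorem nodePoly_map {S : Type*} [CommRing S] (φ : R →+* S) (x y : Fin n → R) (z : R) :
    nodePoly (φ ∘ x) (φ ∘ y) (φ z) = (nodePoly x y z).map φ := by
  simp [nodePoly, Polynomial.map_prod]

theorem natDegree_nodePoly_le (x y : Fin n → R) (z : R) :
    (nodePoly x y z).natDegree ≤ 2 * n + 1 := by
  nontriviality R
  have h (w : Fin n → R) : (∏ i, (X - C (w i))).natDegree ≤ n :=
    (natDegree_prod_le _ _).trans (by simp)
  refine natDegree_mul_le.trans (add_le_add (natDegree_mul_le.trans ?_) (natDegree_X_sub_C_le _))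
  have h1 := h x
  have h2 := h y
  omega

end Numerator

theorem natDegree_det_le {R : Type*} [CommRing R] {n : ℕ} (M : Matrix (Fin n) (Fin n) R[X])
    (d : Fin n → ℕ) (h : ∀ i j, (M i j).natDegree ≤ d j) : M.det.natDegree ≤ ∑ j, d j := by
  rw [Matrix.det_apply]
  refine natDegree_sum_le_of_forall_le _ _ fun σ _ => ?_
  refine (natDegree_smul_le _ _).trans ((natDegree_prod_le _ _).trans ?_)
  exact Finset.sum_le_sum fun j _ => h _ _

section Fibre
variable {K : Type*} [Field K]

theorem vieta {ζ f x s r : K}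
    (hfib : (X - C x) * (X - C s) * (X - C r) = cubP ζ - C f * linQ ζ) :
    x + s + r = 2 * ζ + 1 ∧ x * s + r * (x + s) = -f * (ζ + 2) ∧ x * s * r = -f * ζ := by
  have h : C (2 * ζ + 1 - (x + s + r)) * X ^ 2 + C (x * s + r * (x + s) + f * (ζ + 2)) * X
      + C (-(x * s * r) - f * ζ) = 0 := by
    simp only [cubP, linQ] at hfib
    simp only [C_add, C_sub, C_mul, C_neg] at hfib ⊢
    linear_combination hfib
  have h2 := congrArg (coeff · 2) h
  have h1 := congrArg (coeff · 1) h
  have h0 := congrArg (coeff · 0) h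
  simp only [coeff_add, coeff_C_mul_X_pow, coeff_C_mul_X, coeff_C, coeff_zero] at h0 h1 h2
  norm_num at h0 h1 h2
  refine ⟨by linear_combination -h2, by linear_combination h1, by linear_combination -h0⟩

theorem fibre_eval {ζ f x s r : K}
    (hfib : (X - C x) * (X - C s) * (X - C r) = cubP ζ - C f * linQ ζ) (t : K) :
    (t - x) * (t - s) * (t - r) = t ^ 2 * (t - (2 * ζ + 1)) - f * ((ζ + 2) * t - ζ) := by
  have := congrArg (eval t) hfib
  simp [cubP, linQ] at this
  linear_combination this

theorem F_fibre {ζ f x s r : K}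
    (hfib : (X - C x) * (X - C s) * (X - C r) = cubP ζ - C f * linQ ζ) (z : K) :
    F ζ x s z * ((ζ + 2) * r - ζ) = -(2 * ζ * (ζ + 1)) * (r - ζ) * (z - r) := by
  obtain ⟨h1, h2, -⟩ := vieta hfib
  have h3 := fibre_eval hfib r
  rw [F]
  linear_combination ((ζ + 2) * r - ζ) * ((ζ + 2) * z - ζ) * h2
    + ((ζ + 2) * r - ζ) * (-ζ * (z + 1) - r * ((ζ + 2) * z - ζ)) * h1
    - (ζ + 2) * ((ζ + 2) * z - ζ) * h3

theorem Q_fibre {ζ f x s r : K}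
    (hfib : (X - C x) * (X - C s) * (X - C r) = cubP ζ - C f * linQ ζ) :
    ((ζ + 2) * x - ζ) * ((ζ + 2) * s - ζ) * ((ζ + 2) * r - ζ) = 2 * ζ ^ 2 * (ζ + 1) ^ 2 := by
  obtain ⟨h1, h2, h3⟩ := vieta hfib
  linear_combination (ζ + 2) ^ 3 * h3 - (ζ + 2) ^ 2 * ζ * h2 + (ζ + 2) * ζ ^ 2 * h1

theorem G_fibre {ζ f x s r : K}
    (hfib : (X - C x) * (X - C s) * (X - C r) = cubP ζ - C f * linQ ζ) (y : K) :
    G ζ x y = ((ζ + 2) * x - ζ) * ((y - s) * (y - r)) := by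
  obtain ⟨h1, h2, -⟩ := vieta hfib
  have h3 := fibre_eval hfib x
  rw [G]
  linear_combination ((ζ + 2) * x - ζ) * (y * h1 + x * h1 - h2) + (ζ + 2) * h3

theorem G_comm {R : Type*} [CommRing R] (ζ x y : R) : G ζ x y = G ζ y x := by
  simp only [G]; ring

/-- The point `x` is neither a zero nor a pole of `P / Q`, and the other two points of its fibre are
distinct. -/
structure FibreGeneric (ζ x : K) : Prop where
  P_ne : x ^ 2 * (x - (2 * ζ + 1)) ≠ 0
  Q_ne : (ζ + 2) * x - ζ ≠ 0
  unram : (3 * x + (2 * ζ + 1)) * ζ ≠ x * ((2 * ζ + 1) - x) * (ζ + 2)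

theorem exists_fibre [IsAlgClosed K] {ζ x : K} (h2 : (2 : K) ≠ 0) (hx : FibreGeneric ζ x) :
    ∃ s r, (X - C x) * (X - C s) * (X - C r) =
      cubP ζ - C (x ^ 2 * (x - (2 * ζ + 1)) / ((ζ + 2) * x - ζ)) * linQ ζ ∧ s ≠ r := by
  set f := x ^ 2 * (x - (2 * ζ + 1)) / ((ζ + 2) * x - ζ) with hf
  have hfx : f * ((ζ + 2) * x - ζ) = x ^ 2 * (x - (2 * ζ + 1)) := div_mul_cancel₀ _ hx.Q_ne
  let q : K[X] := X ^ 2 + C (x - (2 * ζ + 1)) * X + C (x * (x - (2 * ζ + 1)) - f * (ζ + 2))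
  have hq : q.degree = 2 := by
    have : q = C 1 * X ^ 2 + C (x - (2 * ζ + 1)) * X
        + C (x * (x - (2 * ζ + 1)) - f * (ζ + 2)) := by simp [q]
    rw [this, degree_quadratic one_ne_zero]
  obtain ⟨s, hs⟩ := IsAlgClosed.exists_root q (by rw [hq]; norm_num)
  have hs' : s ^ 2 + (x - (2 * ζ + 1)) * s + (x * (x - (2 * ζ + 1)) - f * (ζ + 2)) = 0 := by
    simpa [q] using hs
  have hfib : (X - C x) * (X - C s) * (X - C (2 * ζ + 1 - x - s)) = cubP ζ - C f * linQ ζ := by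
    have e1 := congrArg C hs'
    have e2 := congrArg C hfx
    simp only [cubP, linQ, C_add, C_sub, C_mul, C_pow, C_0] at e1 e2 ⊢
    linear_combination (C x - X) * e1 + e2
  refine ⟨s, _, hfib, fun hsr => ?_⟩
  obtain ⟨v1, v2, v3⟩ := vieta hfib
  rw [← hsr] at v1 v2 v3
  have hs0 : s ≠ 0 := by
    rintro rfl
    apply hx.P_ne
    rw [show x = 2 * ζ + 1 by linear_combination v1]
    ring
  apply hx.unram
  have e : s * (2 * ((3 * x + (2 * ζ + 1)) * ζ - x * ((2 * ζ + 1) - x) * (ζ + 2))) = 0 := by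
    rw [← v1]
    linear_combination 4 * ζ * v2 - 4 * (ζ + 2) * v3
  rcases mul_eq_zero.1 e with h | h
  · exact absurd h hs0
  · rcases mul_eq_zero.1 h with h | h
    · exact absurd h h2
    · linear_combination h

end Fibre

/-! ### The residue formula at generic nodes -/

section Main
variable {K : Type*} [Field K]

/-- The constant `∏_{k < n} 2ζ(ζ + 1) (2ζ²(ζ + 1)²) ^ k` relating `Sₙ` to the residue
determinant. -/
def gam {R : Type*} [CommRing R] (ζ : R) (n : ℕ) : R :=
  ∏ k ∈ Finset.range n, 2 * ζ * (ζ + 1) * (2 * ζ ^ 2 * (ζ + 1) ^ 2) ^ k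

theorem gam_succ {R : Type*} [CommRing R] (ζ : R) (n : ℕ) :
    gam ζ (n + 1) = gam ζ n * (2 * ζ * (ζ + 1) * (2 * ζ ^ 2 * (ζ + 1) ^ 2) ^ n) := by
  rw [gam, Finset.prod_range_succ, gam]

theorem gam_map {R S : Type*} [CommRing R] [CommRing S] (φ : R →+* S) (ζ : R) (n : ℕ) :
    gam (φ ζ) n = φ (gam ζ n) := by
  simp [gam, map_prod, map_ofNat φ]

/-- The parameters for which none of `2`, `ζ`, `ζ + 1`, `ζ + 2`, `2ζ + 1` vanishes. -/
structure Nondeg (ζ : K) : Prop where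
  two_ne : (2 : K) ≠ 0
  ne_zero : ζ ≠ 0
  add_one : ζ + 1 ≠ 0
  add_two : ζ + 2 ≠ 0
  two_mul : 2 * ζ + 1 ≠ 0

theorem Nondeg.map {L : Type*} [Field L] {ζ : K} (hζ : Nondeg ζ) (ψ : K →+* L) :
    Nondeg (ψ ζ) where
  two_ne := by simpa only [map_ofNat] using (map_ne_zero ψ).2 hζ.two_ne
  ne_zero := (map_ne_zero ψ).2 hζ.ne_zero
  add_one := by simpa only [map_add, map_one] using (map_ne_zero ψ).2 hζ.add_one
  add_two := by simpa only [map_add, map_ofNat] using (map_ne_zero ψ).2 hζ.add_two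
  two_mul := by simpa only [map_add, map_mul, map_one, map_ofNat] using (map_ne_zero ψ).2 hζ.two_mul

theorem cubP_pow_dvd_map {L : Type*} [Field L] {ζ : K} {n : ℕ} {Qi : K[X]}
    (hQi : cubP ζ ^ n ∣ linQ ζ * Qi - 1) (ψ : K →+* L) :
    cubP (ψ ζ) ^ n ∣ linQ (ψ ζ) * Qi.map ψ - 1 := by
  have := Polynomial.map_dvd ψ hQi
  rwa [Polynomial.map_pow, Polynomial.map_sub, Polynomial.map_mul, map_cubP, map_linQ,
      Polynomial.map_one] at this

theorem eval_linQ (ζ t : K) : (linQ ζ).eval t = (ζ + 2) * t - ζ := by simp [linQ]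

/-- The scalar identity behind `num_eq_cons`. -/
theorem fibre_algebra {u w e t q qa qs A1 A2 B1 B2 g vx vy W : K} (hq : q ≠ 0) :
    -u * w * e / t * (qa * (B1 * B2)) * (qs * (A1 * A2)) * (g * vx * vy * W)
      = g * (u * (qa * qs * q)) * (A1 * vx) * (B1 * vy) * (-(A2 * B2 * e) * w / (q * t) * W) := by
  rw [div_eq_mul_inv, div_eq_mul_inv, mul_inv]
  linear_combination (u * w * e * t⁻¹ * qa * B1 * B2 * qs * A1 * A2 * g * vx * vy * W) *
    mul_inv_cancel₀ hq

/-- The residue formula for `num` passes from size `n` to size `n + 1` when `a` and `s` lie in one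
fibre: both sides satisfy the same recursion. -/
theorem num_eq_cons {ζ : K} (hζ : Nondeg ζ) {n : ℕ} {Qi : K[X]} {f a s r : K}
    (hfib : (X - C a) * (X - C s) * (X - C r) = cubP ζ - C f * linQ ζ) (hf : f ≠ 0)
    (hQi : cubP ζ ^ (n + 1) ∣ linQ ζ * Qi - 1) {x y : Fin n → K} {z : K}
    (ih : num ζ x y z = gam ζ n * vd x * vd y * Wdet ζ Qi n (nodePoly x y z)) :
    num ζ (Fin.cons a x : Fin (n + 1) → K) (Fin.cons s y) z
      = gam ζ (n + 1) * vd (Fin.cons a x : Fin (n + 1) → K) *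
        vd (Fin.cons s y : Fin (n + 1) → K) *
        Wdet ζ Qi (n + 1) (nodePoly (Fin.cons a x : Fin (n + 1) → K) (Fin.cons s y) z) := by
  have hQ := Q_fibre hfib
  have hQ0 : 2 * ζ ^ 2 * (ζ + 1) ^ 2 ≠ 0 := by
    simp [hζ.two_ne, hζ.ne_zero, hζ.add_one]
  have hr : (ζ + 2) * r - ζ ≠ 0 := by
    intro h; rw [h, mul_zero] at hQ; exact hQ0 hQ.symm
  have hGa : ∀ t, G ζ a t = ((ζ + 2) * a - ζ) * ((t - s) * (t - r)) := G_fibre hfib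
  have hGs : ∀ t, G ζ t s = ((ζ + 2) * s - ζ) * ((t - a) * (t - r)) := fun t => by
    rw [G_comm]; exact G_fibre (f := f) (by rw [← hfib]; ring) t
  rw [num_cons ζ a s x y z (by rw [hGa]; ring), nodePoly_cons, vd_cons, vd_cons,
    Wdet_succ ζ hfib hf (by rwa [eval_linQ]) hQi (natDegree_nodePoly_le x y z), ih, eval_linQ,
    gam_succ]
  simp only [hGa, hGs, Finset.prod_mul_distrib, Finset.prod_const, Finset.card_univ,
    Fintype.card_fin]
  have hnode : (nodePoly x y z).eval r = - ((∏ i, (x i - r)) * (∏ j, (y j - r)) * (z - r)) := by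
    have h (w : Fin n → K) : ∏ i, (r - w i) = (-1) ^ n * ∏ i, (w i - r) := by
      rw [← Fin.prod_const n (-1 : K), ← Finset.prod_mul_distrib]
      exact Finset.prod_congr rfl fun i _ => by ring
    simp only [nodePoly, eval_mul, eval_prod, eval_sub, eval_X, eval_C, h]
    have : ((-1 : K) ^ n) * (-1) ^ n = 1 := by rw [← mul_pow]; simp
    linear_combination (∏ i, (x i - r)) * (∏ j, (y j - r)) * (r - z) * this
  rw [hnode]
  have hF := F_fibre hfib z
  have hQn : ((ζ + 2) * a - ζ) ^ n * ((ζ + 2) * s - ζ) ^ n * ((ζ + 2) * r - ζ) ^ n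
      = (2 * ζ ^ 2 * (ζ + 1) ^ 2) ^ n := by rw [← hQ, mul_pow, mul_pow]
  rw [← hQn, eq_div_of_mul_eq hr hF, pow_succ ((ζ + 2) * r - ζ) n]
  exact fibre_algebra (pow_ne_zero n hr)

theorem natDegree_num_le (ζ : K) {n : ℕ} (x : Fin (n + 1) → K) (y : Fin n → K) (z : K) :
    (num (C ζ) (C ∘ x) (Fin.cons X (C ∘ y) : Fin (n + 1) → K[X]) (C z)).natDegree
      ≤ 2 * n + 1 := by
  have hF (t : K) : (F (C ζ) (C t) X (C z)).natDegree ≤ 1 := by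
    have : F (C ζ) (C t) X (C z) = C ((ζ + 2) * t * z - ζ * (t + z + 1)) * X
        + C (ζ * (2 * ζ + 1) - ζ * (t * z + t + z)) := by
      simp only [F, C_add, C_sub, C_mul, map_ofNat, C_1]; ring
    rw [this]; exact natDegree_linear_le
  have hG (t : K) : (G (C ζ) (C t) X).natDegree ≤ 2 := by
    have : G (C ζ) (C t) X = C ((ζ + 2) * t - ζ) * X ^ 2
        + C ((ζ + 2) * t ^ 2 - 2 * (ζ ^ 2 + 3 * ζ + 1) * t + ζ * (2 * ζ + 1)) * X
        + C (ζ * (2 * ζ + 1) * t - ζ * t ^ 2) := by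
      simp only [G, C_add, C_sub, C_mul, C_pow, map_ofNat, C_1]; ring
    rw [this]; exact natDegree_quadratic_le
  refine (natDegree_det_le _ (fun j => if j = 0 then 1 else 2) fun i j => ?_).trans ?_
  · rw [Matrix.of_apply, Fin.prod_univ_succ]
    have hrest : (∏ k : Fin n, if k.succ = j then
        F (C ζ) ((C ∘ x) i) ((Fin.cons X (C ∘ y) : Fin (n + 1) → K[X]) k.succ) (C z)
        else G (C ζ) ((C ∘ x) i) ((Fin.cons X (C ∘ y) : Fin (n + 1) → K[X]) k.succ)).natDegree
        = 0 := by
      rw [← Nat.le_zero]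
      refine (natDegree_prod_le _ _).trans (le_of_eq (Finset.sum_eq_zero fun k _ => ?_))
      simp only [Function.comp_apply, Fin.cons_succ]
      rw [← map_F C, ← map_G C, ← apply_ite C, natDegree_C]
    refine natDegree_mul_le.trans ?_
    rw [hrest]
    by_cases hj : j = 0
    · simpa [hj] using hF (x i)
    · simpa [hj, Ne.symm hj] using hG (x i)
  · simp [Fin.sum_univ_succ, Fin.succ_ne_zero]
    omega

theorem natDegree_vd_le {n : ℕ} (y : Fin n → K) :
    (vd (Fin.cons X (C ∘ y) : Fin (n + 1) → K[X])).natDegree ≤ n := by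
  rw [vd_cons, vd_map]
  refine natDegree_mul_le.trans ?_
  rw [natDegree_C, add_zero]
  have h : ∀ i ∈ Finset.univ, ((C ∘ y) i - X).natDegree ≤ 1 := fun i _ => by
    rw [Function.comp_apply, natDegree_sub]; exact natDegree_X_sub_C_le _
  exact (natDegree_prod_le _ _).trans ((Finset.sum_le_sum h).trans (by simp))

theorem natDegree_Wdet_le (ζ : K) (Qi : K[X]) {n : ℕ} (x : Fin (n + 1) → K) (y : Fin n → K)
    (z : K) :
    (Wdet (C ζ) (Qi.map C) (n + 1)
      (nodePoly (C ∘ x) (Fin.cons X (C ∘ y) : Fin (n + 1) → K[X]) (C z))).natDegree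
      ≤ n + 1 := by
  refine (natDegree_det_le _ (fun _ => 1) fun i j => ?_).trans (by simp)
  let Φ : K[X] := (∏ i, (X - C (x i))) * (∏ j, (X - C (y j))) * (X - C z)
  have hnode : nodePoly (C ∘ x) (Fin.cons X (C ∘ y) : Fin (n + 1) → K[X]) (C z)
      = (X - C X) * Φ.map C := by
    simp only [nodePoly, Fin.prod_univ_succ, Φ, Polynomial.map_mul, Polynomial.map_prod,
      Polynomial.map_sub, map_X, map_C, Fin.cons_zero, Fin.cons_succ, Function.comp_apply]
    ring
  have e : X ^ (i : ℕ) * (nodePoly (C ∘ x) (Fin.cons X (C ∘ y) : Fin (n + 1) → K[X]) (C z) *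
        linH (C ζ)) * Qi.map C ^ (n + 1 - (j : ℕ))
      = (X ^ ((i : ℕ) + 1) * (Φ * linH ζ) * Qi ^ (n + 1 - (j : ℕ))).map C
        - C X * (X ^ (i : ℕ) * (Φ * linH ζ) * Qi ^ (n + 1 - (j : ℕ))).map C := by
    rw [hnode]
    simp only [Polynomial.map_mul, Polynomial.map_pow, map_X, map_linH]
    ring
  rw [Wmat, Matrix.of_apply, e, map_sub, resid_C_mul, resid_map, resid_map]
  refine (natDegree_sub_le _ _).trans (max_le (by simp) ?_)
  refine natDegree_mul_le.trans (by simp)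

/-- Both sides are polynomials of degree at most `2n + 1` in `y₀` (for size `n + 1`), and they agree
at the `2n + 2` points which share a fibre with some `xᵢ`. -/
theorem num_eq_of_generic [IsAlgClosed K] {ζ : K} (hζ : Nondeg ζ) {n : ℕ} {Qi : K[X]}
    (hQi : cubP ζ ^ n ∣ linQ ζ * Qi - 1) (x y : Fin n → K) (z : K)
    (hx : ∀ i, FibreGeneric ζ (x i))
    (hxx : ∀ i j, i ≠ j → x i ^ 2 * (x i - (2 * ζ + 1)) * ((ζ + 2) * x j - ζ) ≠
      x j ^ 2 * (x j - (2 * ζ + 1)) * ((ζ + 2) * x i - ζ)) :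
    num ζ x y z = gam ζ n * vd x * vd y * Wdet ζ Qi n (nodePoly x y z) := by
  induction n with
  | zero => simp [num, gam, vd, Wdet]
  | succ n ih =>
    have ih' : ∀ (y' : Fin n → K) (σ : Equiv.Perm (Fin (n + 1))),
        num ζ (Fin.tail (x ∘ σ)) y' z = gam ζ n * vd (Fin.tail (x ∘ σ)) * vd y' *
          Wdet ζ Qi n (nodePoly (Fin.tail (x ∘ σ)) y' z) := fun y' σ =>
      ih ((pow_dvd_pow _ n.le_succ).trans hQi) _ y' (fun i => hx _) fun i j hij =>
        hxx _ _ fun h => hij (Fin.succ_injective _ (σ.injective h))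
    choose s r hfib hsr using fun i => exists_fibre hζ.two_ne (hx i)
    set f : Fin (n + 1) → K := fun i => x i ^ 2 * (x i - (2 * ζ + 1)) / ((ζ + 2) * x i - ζ)
    have hf : ∀ i, f i ≠ 0 := fun i => div_ne_zero (hx i).P_ne (hx i).Q_ne
    have hf' : ∀ i, f i = x i ^ 2 * (x i - (2 * ζ + 1)) / ((ζ + 2) * x i - ζ) := fun i => rfl
    simp only [← hf'] at hfib
    clear_value f
    -- the identity holds whenever `y 0` lies in the fibre of one of the `x i`
    have key : ∀ i s r, (X - C (x i)) * (X - C s) * (X - C r) = cubP ζ - C (f i) * linQ ζ →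
        num ζ x (Fin.cons s (Fin.tail y)) z = gam ζ (n + 1) * vd x *
          vd (Fin.cons s (Fin.tail y) : Fin (n + 1) → K) *
          Wdet ζ Qi (n + 1) (nodePoly x (Fin.cons s (Fin.tail y)) z) := by
      intro i s r h
      let σ : Equiv.Perm (Fin (n + 1)) := Equiv.swap 0 i
      have hσ : x ∘ σ = Fin.cons (x i) (Fin.tail (x ∘ σ)) := by
        conv_lhs => rw [← Fin.cons_self_tail (x ∘ σ)]
        simp [σ]
      have h1 := num_eq_cons hζ h (hf i) hQi (ih' (Fin.tail y) σ)
      rw [← hσ, num_perm, vd_perm, nodePoly_perm] at h1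
      have h2 : ((Equiv.Perm.sign σ : ℤ) : K) * ((Equiv.Perm.sign σ : ℤ) : K) = 1 := by
        rw [← Int.cast_mul, ← Units.val_mul, Int.units_mul_self]; simp
      linear_combination ((Equiv.Perm.sign σ : ℤ) : K) * h1 - (num ζ x (Fin.cons s (Fin.tail y)) z
        - gam ζ (n + 1) * vd x * vd (Fin.cons s (Fin.tail y) : Fin (n + 1) → K) *
          Wdet ζ Qi (n + 1) (nodePoly x (Fin.cons s (Fin.tail y)) z)) * h2
    let L : K[X] := num (C ζ) (C ∘ x) (Fin.cons X (C ∘ Fin.tail y) : Fin (n + 1) → K[X]) (C z)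
    let M : K[X] := C (gam ζ (n + 1) * vd x) *
      vd (Fin.cons X (C ∘ Fin.tail y) : Fin (n + 1) → K[X]) *
      Wdet (C ζ) (Qi.map C) (n + 1)
        (nodePoly (C ∘ x) (Fin.cons X (C ∘ Fin.tail y) : Fin (n + 1) → K[X]) (C z))
    have hcomp (t : K) : evalRingHom t ∘ (Fin.cons X (C ∘ Fin.tail y) : Fin (n + 1) → K[X])
        = Fin.cons t (Fin.tail y) := by
      funext k; refine Fin.cases ?_ (fun k => ?_) k <;> simp
    have hcompx (t : K) : evalRingHom t ∘ (C ∘ x) = x := by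
      funext k; simp
    have hL (t : K) : L.eval t = num ζ x (Fin.cons t (Fin.tail y)) z := by
      rw [← coe_evalRingHom, ← num_map, hcomp, hcompx]; simp
    have hM (t : K) : M.eval t = gam ζ (n + 1) * vd x *
          vd (Fin.cons t (Fin.tail y) : Fin (n + 1) → K) *
          Wdet ζ Qi (n + 1) (nodePoly x (Fin.cons t (Fin.tail y)) z) := by
      simp only [M]
      rw [← coe_evalRingHom, map_mul, map_mul, ← vd_map, ← Wdet_map, ← nodePoly_map, hcomp, hcompx]
      have hQ' : (Qi.map C).map (evalRingHom t) = Qi := by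
        rw [Polynomial.map_map, show (evalRingHom t).comp C = RingHom.id K from
          RingHom.ext fun _ => by simp, Polynomial.map_id]
      rw [hQ']
      simp
    have hLM : L - M = 0 := by
      let nd : Fin (n + 1) × Bool → K := fun p => if p.2 then s p.1 else r p.1
      have hroot : ∀ p, (X - C (x p.1)) * (X - C (nd p)) * (X - C (if p.2 then r p.1 else s p.1))
          = cubP ζ - C (f p.1) * linQ ζ := by
        rintro ⟨i, b⟩
        cases b
        · simp only [nd]; rw [← hfib i]; simp; ring
        · simpa [nd] using hfib i
      refine eq_zero_of_natDegree_lt_card_of_eval_eq_zero _ (f := nd) ?_ ?_ ?_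
      · rintro ⟨i, b⟩ ⟨j, c⟩ h
        have hi := fibre_eval (hroot (i, b)) (nd (i, b))
        have hj := fibre_eval (hroot (j, c)) (nd (j, c))
        rw [sub_self, mul_zero, zero_mul] at hi hj
        rw [← h] at hj
        have hij : i = j := by
          by_contra hne
          have hfij : f i ≠ f j := by
            intro e
            rw [hf', hf', div_eq_div_iff (hx i).Q_ne (hx j).Q_ne] at e
            exact hxx i j hne e
          have h1 : (f i - f j) * ((ζ + 2) * nd (i, b) - ζ) = 0 := by
            linear_combination hi - hj
          have h2 := (mul_eq_zero.1 h1).resolve_left (sub_ne_zero.2 hfij)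
          rw [h2] at hi
          have h3 : nd (i, b) ^ 2 * (nd (i, b) - (2 * ζ + 1)) = 0 := by linear_combination -hi
          have h4 : 2 * ζ ^ 2 * (ζ + 1) ^ 2 = 0 := by
            generalize nd (i, b) = w at h2 h3
            linear_combination -(ζ + 2) ^ 3 * h3 + (((ζ + 2) * w) ^ 2 + ζ * ((ζ + 2) * w) + ζ ^ 2
              - (ζ + 2) * (2 * ζ + 1) * ((ζ + 2) * w + ζ)) * h2
          simp [hζ.two_ne, hζ.ne_zero, hζ.add_one] at h4
        subst hij
        have := hsr i
        cases b <;> cases c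
        · rfl
        · exact absurd (Eq.symm h) this
        · exact absurd h this
        · rfl
      · rintro p
        rw [eval_sub, hL, hM, key p.1 _ _ (hroot p), sub_self]
      · have h1 := natDegree_num_le ζ x (Fin.tail y) z
        have h2 := natDegree_vd_le (Fin.tail y)
        have h3 := natDegree_Wdet_le ζ Qi x (Fin.tail y) z
        have h4 : M.natDegree ≤ 2 * n + 1 := by
          refine natDegree_mul_le.trans ((add_le_add (natDegree_C_mul_le _ _) h3).trans ?_)
          omega
        have h5 := natDegree_sub_le L M
        simp only [Fintype.card_prod, Fintype.card_fin, Fintype.card_bool]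
        have h6 : L.natDegree ≤ 2 * n + 1 := h1
        have : max L.natDegree M.natDegree ≤ 2 * n + 1 := max_le h6 h4
        omega
    have := hL (y 0)
    rw [sub_eq_zero.1 hLM, hM] at this
    rw [Fin.cons_self_tail] at this
    exact this.symm

end Main

/-! ### The residue formula for `Sₙ` -/

section Specialization
variable {K : Type*} [Field K]

theorem num_eq_generic {ζ : K} (hζ : Nondeg ζ) {n : ℕ} {Qi : K[X]}
    (hQi : cubP ζ ^ n ∣ linQ ζ * Qi - 1) :
    let x : Fin n → MvPolynomial (Vars n) K := fun i => MvPolynomial.X (Sum.inl i)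
    let y : Fin n → MvPolynomial (Vars n) K := fun i => MvPolynomial.X (Sum.inr (Sum.inl i))
    let z : MvPolynomial (Vars n) K := MvPolynomial.X (Sum.inr (Sum.inr ()))
    num (MvPolynomial.C ζ) x y z = gam (MvPolynomial.C ζ) n * vd x * vd y *
      Wdet (MvPolynomial.C ζ) (Qi.map MvPolynomial.C) n (nodePoly x y z) := by
  intro x y z
  let L := AlgebraicClosure (FractionRing (MvPolynomial (Vars n) K))
  let φ : MvPolynomial (Vars n) K →+* L :=
    (algebraMap (FractionRing (MvPolynomial (Vars n) K)) L).comp (algebraMap _ _)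
  have hφ : Function.Injective φ :=
    (algebraMap (FractionRing (MvPolynomial (Vars n) K)) L).injective.comp
      (IsFractionRing.injective _ _)
  have hne (q : MvPolynomial (Vars n) K) (v : Fin n → K)
      (h : MvPolynomial.eval (Sum.elim v fun _ => 0) q ≠ 0) : φ q ≠ 0 := by
    intro h0
    rw [map_eq_zero_iff φ hφ] at h0
    exact h (by rw [h0, map_zero])
  set ψ : K →+* L := φ.comp MvPolynomial.C with hψ
  have hψ' : φ (MvPolynomial.C ζ) = ψ ζ := rfl
  apply hφ
  have hmain := num_eq_of_generic (hζ.map ψ) (Qi := Qi.map ψ) (x := φ ∘ x) (y := φ ∘ y) (z := φ z)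
    (n := n) ?_ ?_ ?_
  · rw [← hψ', num_map, gam_map, vd_map, vd_map, nodePoly_map, hψ, ← Polynomial.map_map,
      Wdet_map] at hmain
    rw [hmain]; simp only [map_mul]
  · exact cubP_pow_dvd_map hQi ψ
  · intro i
    constructor
    · have := hne (x i ^ 2 * (x i - (2 * MvPolynomial.C ζ + 1))) (fun _ => 1) (by
        simp only [map_sub, map_mul, map_pow, map_add, map_one, map_ofNat, MvPolynomial.eval_X,
          MvPolynomial.eval_C, Sum.elim_inl, x]
        rw [show (1 : K) ^ 2 * (1 - (2 * ζ + 1)) = -(2 * ζ) by ring]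
        exact neg_ne_zero.2 (mul_ne_zero hζ.two_ne hζ.ne_zero))
      simpa only [map_sub, map_mul, map_pow, map_add, map_ofNat, map_one, hψ', Function.comp_apply]
        using this
    · have := hne ((MvPolynomial.C ζ + 2) * x i - MvPolynomial.C ζ) (fun _ => 0) (by
        simp only [map_sub, map_mul, map_add, map_ofNat, MvPolynomial.eval_X,
          MvPolynomial.eval_C, Sum.elim_inl, x]
        rw [mul_zero, zero_sub]
        exact neg_ne_zero.2 hζ.ne_zero)
      simpa only [map_sub, map_mul, map_pow, map_add, map_ofNat, map_one, hψ', Function.comp_apply]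
        using this
    · have := hne ((3 * x i + (2 * MvPolynomial.C ζ + 1)) * MvPolynomial.C ζ -
        x i * ((2 * MvPolynomial.C ζ + 1) - x i) * (MvPolynomial.C ζ + 2)) (fun _ => 0) (by
        simp only [map_sub, map_mul, map_add, map_one, map_ofNat, MvPolynomial.eval_X,
          MvPolynomial.eval_C, Sum.elim_inl, x]
        rw [mul_zero, zero_mul, zero_mul, zero_add, sub_zero]
        exact mul_ne_zero hζ.two_mul hζ.ne_zero)
      simpa only [map_sub, map_mul, map_pow, map_add, map_one, map_ofNat, hψ', sub_ne_zero,
        Function.comp_apply]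
        using this
  · intro i j hij
    have := hne (x i ^ 2 * (x i - (2 * MvPolynomial.C ζ + 1)) *
        ((MvPolynomial.C ζ + 2) * x j - MvPolynomial.C ζ) -
        x j ^ 2 * (x j - (2 * MvPolynomial.C ζ + 1)) *
        ((MvPolynomial.C ζ + 2) * x i - MvPolynomial.C ζ))
        (Function.update (fun _ => 1) i (2 * ζ + 1)) (by
        simp only [map_sub, map_mul, map_pow, map_add, map_one, map_ofNat, MvPolynomial.eval_X,
          MvPolynomial.eval_C, Sum.elim_inl, x, Function.update_self,
          Function.update_of_ne hij.symm]
        rw [show (2 * ζ + 1) ^ 2 * (2 * ζ + 1 - (2 * ζ + 1)) * ((ζ + 2) * 1 - ζ) -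
          1 ^ 2 * (1 - (2 * ζ + 1)) * ((ζ + 2) * (2 * ζ + 1) - ζ)
            = 2 * ζ * (2 * (ζ + 1) ^ 2) by ring]
        exact mul_ne_zero (mul_ne_zero hζ.two_ne hζ.ne_zero)
          (mul_ne_zero hζ.two_ne (pow_ne_zero _ hζ.add_one)))
    simpa only [map_sub, map_mul, map_pow, map_add, map_one, map_ofNat, hψ', sub_ne_zero,
        Function.comp_apply]
      using this

theorem num_eq {ζ : K} (hζ : Nondeg ζ) {n : ℕ} {Qi : K[X]}
    (hQi : cubP ζ ^ n ∣ linQ ζ * Qi - 1) (x y : Fin n → K) (z : K) :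
    num ζ x y z = gam ζ n * vd x * vd y * Wdet ζ Qi n (nodePoly x y z) := by
  have h := num_eq_generic hζ hQi
  let e := MvPolynomial.eval (Sum.elim x (Sum.elim y fun _ => z) : Vars n → K)
  have h' := congrArg e h
  have hx : e ∘ (fun i => MvPolynomial.X (Sum.inl i)) = x := by funext i; simp [e]
  have hy : e ∘ (fun i => MvPolynomial.X (Sum.inr (Sum.inl i))) = y := by funext i; simp [e]
  have hz : e (MvPolynomial.X (Sum.inr (Sum.inr ()))) = z := by simp [e]
  have hζ' : e (MvPolynomial.C ζ) = ζ := by simp [e]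
  have hQ' : (Qi.map MvPolynomial.C).map e = Qi := by
    rw [Polynomial.map_map, show e.comp MvPolynomial.C = RingHom.id K from
      RingHom.ext fun _ => by simp [e], Polynomial.map_id]
  simp only [map_mul] at h'
  rwa [← num_map, ← gam_map, ← vd_map, ← vd_map, ← Wdet_map, ← nodePoly_map, hx, hy, hz, hζ',
    hQ'] at h'

theorem vd_X_ne_zero {R : Type*} [CommRing R] [IsDomain R] {σ : Type*} {n : ℕ} (v : Fin n → σ)
    (hv : Function.Injective v) :
    vd (fun i => (MvPolynomial.X (v i) : MvPolynomial σ R)) ≠ 0 := by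
  rw [vd, Finset.prod_ne_zero_iff]
  intro i _
  rw [Finset.prod_ne_zero_iff]
  intro j hj
  rw [sub_ne_zero]
  exact fun h => (Finset.mem_Ioi.1 hj).ne' (hv (MvPolynomial.X_injective h))

theorem prod_ite_eq_mul_prod_erase {ι M : Type*} [Fintype ι] [DecidableEq ι] [CommMonoid M]
    (j : ι) (f g : ι → M) :
    (∏ k, if k = j then f k else g k) = f j * ∏ k ∈ Finset.univ.erase j, g k := by
  rw [← Finset.mul_prod_erase Finset.univ _ (Finset.mem_univ j), if_pos rfl]
  congr 1
  exact Finset.prod_congr rfl fun k hk => by rw [if_neg (Finset.ne_of_mem_erase hk)]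

theorem numRow_eq_num (n : ℕ) : numRow n = num (zeta n) vx vy (vz n) := by
  rw [numRow, num]
  simp only [prod_ite_eq_mul_prod_erase]

theorem num_eq_vd_mul_S (n : ℕ) :
    num (zeta n) vx vy (vz n) = vd vx * vd vy * S n := by
  have hvd : (∏ i : Fin n, ∏ j ∈ Finset.Ioi i, ((vx j - vx i) * (vy j - vy i)) : SRing n)
      = vd vx * vd vy := by
    simp only [vd, Finset.prod_mul_distrib]
  have hne : (vd vx * vd vy : SRing n) ≠ 0 := by
    refine mul_ne_zero (vd_X_ne_zero _ Sum.inl_injective) (vd_X_ne_zero _ ?_)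
    exact Sum.inr_injective.comp Sum.inl_injective
  have hne' : algebraMap (SRing n) (FractionRing (SRing n)) (vd vx * vd vy) ≠ 0 := by
    rwa [Ne, FaithfulSMul.algebraMap_eq_zero_iff]
  apply IsFractionRing.injective (SRing n) (FractionRing (SRing n))
  rw [← numRow_eq_num, map_mul, S_spec, sFrac, algebraMap_numRow]
  simp only [← map_prod, hvd]
  field_simp

/-- The residue formula for `Sₙ`, at arbitrary values of the variables. -/
theorem aeval_S [Algebra ℚ[X] K] {ζ : K} (hζX : algebraMap ℚ[X] K X = ζ) (hζ : Nondeg ζ) {n : ℕ}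
    {Qi : K[X]} (hQi : cubP ζ ^ n ∣ linQ ζ * Qi - 1) (x y : Fin n → K) (z : K) :
    MvPolynomial.aeval (Sum.elim x (Sum.elim y fun _ => z)) (S n)
      = gam ζ n * Wdet ζ Qi n (nodePoly x y z) := by
  let m : SRing n →+* MvPolynomial (Vars n) K := MvPolynomial.map (algebraMap ℚ[X] K)
  have h := num_eq_generic hζ hQi
  have h1 := congrArg m (num_eq_vd_mul_S n)
  have hx : m ∘ vx = fun i => MvPolynomial.X (Sum.inl i) := by funext i; simp [m, vx]
  have hy : m ∘ vy = fun i => MvPolynomial.X (Sum.inr (Sum.inl i)) := by funext i; simp [m, vy]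
  have hz : m (vz n) = MvPolynomial.X (Sum.inr (Sum.inr ())) := by simp [m, vz]
  have hζ' : m (zeta n) = MvPolynomial.C ζ := by simp [m, zeta, hζX]
  rw [map_mul, map_mul, ← num_map, ← vd_map, ← vd_map, hx, hy, hz, hζ', h] at h1
  have hv1 : vd (fun i : Fin n => (MvPolynomial.X (Sum.inl i) : MvPolynomial (Vars n) K)) ≠ 0 :=
    vd_X_ne_zero _ Sum.inl_injective
  have hv2 : vd (fun i : Fin n => (MvPolynomial.X (Sum.inr (Sum.inl i)) :
      MvPolynomial (Vars n) K)) ≠ 0 :=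
    vd_X_ne_zero _ (Sum.inr_injective.comp Sum.inl_injective)
  have h2 : m (S n) = gam (MvPolynomial.C ζ) n * Wdet (MvPolynomial.C ζ)
      (Qi.map MvPolynomial.C) n (nodePoly (fun i => MvPolynomial.X (Sum.inl i))
        (fun i => MvPolynomial.X (Sum.inr (Sum.inl i)))
        (MvPolynomial.X (Sum.inr (Sum.inr ())))) := by
    apply mul_left_cancel₀ (mul_ne_zero hv1 hv2)
    linear_combination -h1
  let e := MvPolynomial.eval (Sum.elim x (Sum.elim y fun _ => z) : Vars n → K)
  have h' := congrArg e h2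
  have ex : e ∘ (fun i => MvPolynomial.X (Sum.inl i)) = x := by funext i; simp [e]
  have ey : e ∘ (fun i => MvPolynomial.X (Sum.inr (Sum.inl i))) = y := by funext i; simp [e]
  have ez : e (MvPolynomial.X (Sum.inr (Sum.inr ()))) = z := by simp [e]
  have eζ : e (MvPolynomial.C ζ) = ζ := by simp [e]
  have eQ : (Qi.map MvPolynomial.C).map e = Qi := by
    rw [Polynomial.map_map, show e.comp MvPolynomial.C = RingHom.id K from
      RingHom.ext fun _ => by simp [e], Polynomial.map_id]
  rw [map_mul, ← gam_map, ← Wdet_map, ← nodePoly_map, ex, ey, ez, eζ, eQ] at h'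
  rw [← h', MvPolynomial.aeval_def, MvPolynomial.eval₂_eq_eval_map]

end Specialization

/-! ### The Desnanot–Jacobi identity -/

/-- The Desnanot–Jacobi identity when `det M` can be cancelled: multiply `M` by the identity matrix
whose first two columns are replaced by those of `adjugate M`. -/
theorem desnanot_jacobi_of_det_ne_zero {R : Type*} [CommRing R] [IsDomain R] {n : ℕ}
    (M : Matrix (Fin (n + 2)) (Fin (n + 2)) R) (hM : M.det ≠ 0) :
    M.det * (M.submatrix (Fin.succ ∘ Fin.succ) (Fin.succ ∘ Fin.succ)).det
      = M.adjugate 0 0 * M.adjugate 1 1 - M.adjugate 0 1 * M.adjugate 1 0 := by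
  let N : Matrix (Fin (n + 2)) (Fin (n + 2)) R := Matrix.of fun i j =>
    if (j : ℕ) < 2 then M.adjugate i j else (1 : Matrix _ _ R) i j
  have hN : N.det = M.adjugate 0 0 * M.adjugate 1 1 - M.adjugate 0 1 * M.adjugate 1 0 := by
    rw [Matrix.det_succ_row_zero, Fin.sum_univ_succ, Fin.sum_univ_succ, Finset.sum_eq_zero]
    · have h1 : (N.submatrix Fin.succ (Fin.succAbove 0)).det = M.adjugate 1 1 := by
        rw [Matrix.det_succ_row_zero, Fin.sum_univ_succ, Finset.sum_eq_zero]
        · have : (N.submatrix Fin.succ (Fin.succAbove 0)).submatrix Fin.succ (Fin.succAbove 0)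
              = 1 := by
            ext i j; simp [N, Matrix.one_apply]
          rw [this]; simp [N]
        · intro j _
          simp [N, Matrix.one_apply, Fin.ext_iff]
      have h2 : (N.submatrix Fin.succ (Fin.succAbove (Fin.succ 0))).det = M.adjugate 1 0 := by
        rw [Matrix.det_succ_row_zero, Fin.sum_univ_succ, Finset.sum_eq_zero]
        · have : (N.submatrix Fin.succ (Fin.succAbove (Fin.succ 0))).submatrix Fin.succ
              (Fin.succAbove 0) = 1 := by
            ext i j; simp [N, Matrix.one_apply]
          rw [this]; simp [N]
        · intro j _
          simp [N, Matrix.one_apply, Fin.ext_iff]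
      rw [h1, h2]
      simp [N]
      ring
    · intro j _
      simp [N, Matrix.one_apply, Fin.ext_iff]
  have hT : (M * N).det = M.det ^ 2 *
      (M.submatrix (Fin.succ ∘ Fin.succ) (Fin.succ ∘ Fin.succ)).det := by
    have hcol : ∀ i j, (M * N) i j = if (j : ℕ) < 2 then M.det * (1 : Matrix _ _ R) i j
        else M i j := by
      intro i j
      by_cases hj : (j : ℕ) < 2
      · rw [if_pos hj, show M.det * (1 : Matrix _ _ R) i j = (M.det • (1 : Matrix _ _ R)) i j
          from rfl,
          ← Matrix.mul_adjugate, Matrix.mul_apply,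
          Matrix.mul_apply]
        exact Finset.sum_congr rfl fun k _ => by rw [show N k j = _ from if_pos hj]
      · rw [if_neg hj]
        conv_rhs => rw [← Matrix.mul_one M]
        rw [Matrix.mul_apply, Matrix.mul_apply]
        exact Finset.sum_congr rfl fun k _ => by rw [show N k j = _ from if_neg hj]
    rw [Matrix.det_succ_column_zero, Fin.sum_univ_succ, Finset.sum_eq_zero, add_zero,
      Matrix.det_succ_column_zero, Fin.sum_univ_succ, Finset.sum_eq_zero, add_zero]
    · have : ((M * N).submatrix (Fin.succAbove 0) Fin.succ).submatrix (Fin.succAbove 0) Fin.succ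
          = M.submatrix (Fin.succ ∘ Fin.succ) (Fin.succ ∘ Fin.succ) := by
        ext i j
        simp [hcol]
      rw [this]
      simp [hcol]
      ring
    · intro i _
      have : (M * N) i.succ.succ 1 = 0 := by
        rw [hcol, if_pos (by simp), Matrix.one_apply_ne (by simp [Fin.ext_iff]), mul_zero]
      simp [this]
    · intro i _
      have : (M * N) i.succ 0 = 0 := by
        rw [hcol, if_pos (by simp), Matrix.one_apply_ne (Fin.succ_ne_zero i), mul_zero]
      simp [this]
  rw [Matrix.det_mul, hN] at hT
  apply mul_left_cancel₀ hM
  rw [hT]; ring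

/-- The Desnanot–Jacobi (Dodgson condensation) identity. -/
theorem desnanot_jacobi {R : Type*} [CommRing R] {n : ℕ}
    (M : Matrix (Fin (n + 2)) (Fin (n + 2)) R) :
    M.det * (M.submatrix (Fin.succ ∘ Fin.succ) (Fin.succ ∘ Fin.succ)).det
      = (M.submatrix (Fin.succAbove 0) (Fin.succAbove 0)).det *
          (M.submatrix (Fin.succAbove 1) (Fin.succAbove 1)).det -
        (M.submatrix (Fin.succAbove 0) (Fin.succAbove 1)).det *
          (M.submatrix (Fin.succAbove 1) (Fin.succAbove 0)).det := by
  have key := desnanot_jacobi_of_det_ne_zero _ (Matrix.det_mvPolynomialX_ne_zero (Fin (n + 2)) ℤ)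
  simp only [Matrix.adjugate_fin_succ_eq_det_submatrix] at key
  let φ : MvPolynomial (Fin (n + 2) × Fin (n + 2)) ℤ →+* R :=
    MvPolynomial.eval₂Hom (Int.castRingHom R) fun p => M p.1 p.2
  have hφ : (Matrix.mvPolynomialX (Fin (n + 2)) (Fin (n + 2)) ℤ).map φ = M := by
    ext i j; simp [φ, Matrix.mvPolynomialX_apply]
  have h := congrArg φ key
  simp only [map_sub, map_mul, RingHom.map_det, RingHom.mapMatrix_apply,
    ← Matrix.submatrix_map, hφ, map_pow, map_neg, map_one] at h
  rw [h]
  simp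
  ring

section Jacobi
variable {K : Type*} [Field K]

theorem num_eq_prod_mul_det {ζ : K} {n : ℕ} (x y : Fin n → K) (z : K)
    (h : ∀ i j, G ζ (x i) (y j) ≠ 0) :
    num ζ x y z = (∏ i, ∏ j, G ζ (x i) (y j)) *
      Matrix.det (Matrix.of fun i j => F ζ (x i) (y j) z / G ζ (x i) (y j)) := by
  rw [← Matrix.det_mul_column, num]
  congr 1
  ext i j
  simp only [Matrix.of_apply]
  rw [prod_ite_eq_mul_prod_erase, ← Finset.mul_prod_erase Finset.univ _ (Finset.mem_univ j)]
  have := h i j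
  field_simp

theorem num_jacobi {ζ : K} {n : ℕ} (x y : Fin n → K) (x₁ x₂ y₁ y₂ z : K)
    (h : ∀ i j, G ζ ((Fin.cons x₁ (Fin.cons x₂ x) : Fin (n + 2) → K) i)
      ((Fin.cons y₁ (Fin.cons y₂ y) : Fin (n + 2) → K) j) ≠ 0) :
    num ζ (Fin.cons x₁ (Fin.cons x₂ x) : Fin (n + 2) → K) (Fin.cons y₁ (Fin.cons y₂ y)) z *
        num ζ x y z
      = G ζ x₁ y₂ * G ζ x₂ y₁ *
          (num ζ (Fin.cons x₂ x : Fin (n + 1) → K) (Fin.cons y₂ y) z *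
           num ζ (Fin.cons x₁ x : Fin (n + 1) → K) (Fin.cons y₁ y) z) -
        G ζ x₁ y₁ * G ζ x₂ y₂ *
          (num ζ (Fin.cons x₂ x : Fin (n + 1) → K) (Fin.cons y₁ y) z *
           num ζ (Fin.cons x₁ x : Fin (n + 1) → K) (Fin.cons y₂ y) z) := by
  have h11 : G ζ x₁ y₁ ≠ 0 := h 0 0
  have h12 : G ζ x₁ y₂ ≠ 0 := h 0 1
  have h21 : G ζ x₂ y₁ ≠ 0 := h 1 0
  have h22 : G ζ x₂ y₂ ≠ 0 := h 1 1
  have h1y : ∀ j, G ζ x₁ (y j) ≠ 0 := fun j => h 0 j.succ.succ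
  have h2y : ∀ j, G ζ x₂ (y j) ≠ 0 := fun j => h 1 j.succ.succ
  have hx1 : ∀ i, G ζ (x i) y₁ ≠ 0 := fun i => h i.succ.succ 0
  have hx2 : ∀ i, G ζ (x i) y₂ ≠ 0 := fun i => h i.succ.succ 1
  have hxy : ∀ i j, G ζ (x i) (y j) ≠ 0 := fun i j => h i.succ.succ j.succ.succ
  have hcons (a b : K) (hab : G ζ a b ≠ 0) (ha : ∀ j, G ζ a (y j) ≠ 0)
      (hb : ∀ i, G ζ (x i) b ≠ 0) : ∀ i j, G ζ ((Fin.cons a x : Fin (n + 1) → K) i)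
        ((Fin.cons b y : Fin (n + 1) → K) j) ≠ 0 := by
    intro i j
    refine Fin.cases ?_ (fun i => ?_) i <;> refine Fin.cases ?_ (fun j => ?_) j <;> simp [*]
  rw [num_eq_prod_mul_det _ _ z h, num_eq_prod_mul_det _ _ z hxy,
    num_eq_prod_mul_det _ _ z (hcons _ _ h22 h2y hx2),
    num_eq_prod_mul_det _ _ z (hcons _ _ h11 h1y hx1),
    num_eq_prod_mul_det _ _ z (hcons _ _ h21 h2y hx1),
    num_eq_prod_mul_det _ _ z (hcons _ _ h12 h1y hx2)]
  have hJ := desnanot_jacobi (Matrix.of fun i j =>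
    F ζ ((Fin.cons x₁ (Fin.cons x₂ x) : Fin (n + 2) → K) i)
      ((Fin.cons y₁ (Fin.cons y₂ y) : Fin (n + 2) → K) j) z /
    G ζ ((Fin.cons x₁ (Fin.cons x₂ x) : Fin (n + 2) → K) i)
      ((Fin.cons y₁ (Fin.cons y₂ y) : Fin (n + 2) → K) j))
  have e0 (a b : K) (w : Fin n → K) : (Fin.cons a (Fin.cons b w) : Fin (n + 2) → K) ∘
      Fin.succAbove 0 = Fin.cons b w := by
    funext i; simp
  have e1 (a b : K) (w : Fin n → K) : (Fin.cons a (Fin.cons b w) : Fin (n + 2) → K) ∘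
      Fin.succAbove 1 = Fin.cons a w := by
    funext i; refine Fin.cases ?_ (fun i => ?_) i
    · simp
    · have : Fin.succAbove (1 : Fin (n + 2)) i.succ = i.succ.succ := by
        rw [← Fin.succ_zero_eq_one, Fin.succ_succAbove_succ, Fin.succAbove_zero]
      simp [this]
  have e2 (a b : K) (w : Fin n → K) : (Fin.cons a (Fin.cons b w) : Fin (n + 2) → K) ∘
      (Fin.succ ∘ Fin.succ) = w := by
    funext i; simp
  have sub (X Y : Fin (n + 2) → K) {m : ℕ} (r c : Fin m → Fin (n + 2)) :
      (Matrix.of fun i j => F ζ (X i) (Y j) z / G ζ (X i) (Y j)).submatrix r c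
        = Matrix.of fun i j => F ζ ((X ∘ r) i) ((Y ∘ c) j) z / G ζ ((X ∘ r) i) ((Y ∘ c) j) := rfl
  simp only [sub, e0, e1, e2] at hJ
  generalize Matrix.det (Matrix.of fun i j =>
    F ζ ((Fin.cons x₁ (Fin.cons x₂ x) : Fin (n + 2) → K) i)
      ((Fin.cons y₁ (Fin.cons y₂ y) : Fin (n + 2) → K) j) z /
    G ζ ((Fin.cons x₁ (Fin.cons x₂ x) : Fin (n + 2) → K) i)
      ((Fin.cons y₁ (Fin.cons y₂ y) : Fin (n + 2) → K) j)) = d at hJ ⊢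
  simp only [Fin.prod_univ_succ, Fin.cons_zero, Fin.cons_succ, Finset.prod_mul_distrib]
  linear_combination (G ζ x₁ y₁ * G ζ x₁ y₂ * G ζ x₂ y₁ * G ζ x₂ y₂ *
    (∏ j, G ζ x₁ (y j)) * (∏ j, G ζ x₂ (y j)) * (∏ i, G ζ (x i) y₁) * (∏ i, G ζ (x i) y₂) *
    (∏ i, ∏ j, G ζ (x i) (y j)) ^ 2) * hJ

end Jacobi

/-! ### A bilinear relation between residue determinants -/

section Toda
variable {K : Type*} [Field K]

theorem gam_ne_zero {ζ : K} (hζ : Nondeg ζ) (n : ℕ) : gam ζ n ≠ 0 := by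
  rw [gam, Finset.prod_ne_zero_iff]
  intro k _
  have h1 := hζ.two_ne
  have h2 := hζ.ne_zero
  have h3 := hζ.add_one
  positivity

theorem gam_mul_gam (ζ : K) (n : ℕ) :
    gam ζ (n + 2) * gam ζ n = gam ζ (n + 1) ^ 2 * (2 * ζ ^ 2 * (ζ + 1) ^ 2) := by
  rw [gam_succ ζ (n + 1), gam_succ ζ n]; ring

theorem Wdet_jacobi_of_ne {ζ : K} (hζ : Nondeg ζ) {n : ℕ} {Qi : K[X]}
    (hQi : cubP ζ ^ (n + 2) ∣ linQ ζ * Qi - 1) (x y : Fin n → K) (x₁ x₂ y₁ y₂ z : K)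
    (h : ∀ i j, G ζ ((Fin.cons x₁ (Fin.cons x₂ x) : Fin (n + 2) → K) i)
      ((Fin.cons y₁ (Fin.cons y₂ y) : Fin (n + 2) → K) j) ≠ 0)
    (hx : vd (Fin.cons x₁ (Fin.cons x₂ x) : Fin (n + 2) → K) ≠ 0)
    (hy : vd (Fin.cons y₁ (Fin.cons y₂ y) : Fin (n + 2) → K) ≠ 0) :
    (x₂ - x₁) * (y₂ - y₁) * (2 * ζ ^ 2 * (ζ + 1) ^ 2) *
      (Wdet ζ Qi (n + 2) (nodePoly x y z * ((X - C x₂) * (X - C y₂)) * ((X - C x₁) * (X - C y₁))) *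
        Wdet ζ Qi n (nodePoly x y z))
      = G ζ x₁ y₂ * G ζ x₂ y₁ *
          (Wdet ζ Qi (n + 1) (nodePoly x y z * ((X - C x₂) * (X - C y₂))) *
           Wdet ζ Qi (n + 1) (nodePoly x y z * ((X - C x₁) * (X - C y₁)))) -
        G ζ x₁ y₁ * G ζ x₂ y₂ *
          (Wdet ζ Qi (n + 1) (nodePoly x y z * ((X - C x₂) * (X - C y₁))) *
           Wdet ζ Qi (n + 1) (nodePoly x y z * ((X - C x₁) * (X - C y₂)))) := by
  have hQ1 := (pow_dvd_pow (cubP ζ) (Nat.le_succ (n + 1))).trans hQi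
  have hQ0 := (pow_dvd_pow (cubP ζ) (Nat.le_succ n)).trans hQ1
  have hJ := num_jacobi x y x₁ x₂ y₁ y₂ z h
  rw [num_eq hζ hQi, num_eq hζ hQ0, num_eq hζ hQ1, num_eq hζ hQ1, num_eq hζ hQ1,
    num_eq hζ hQ1] at hJ
  have hg := gam_mul_gam ζ n
  have hg0 := gam_ne_zero hζ (n + 1)
  simp only [nodePoly_cons, vd_cons, Fin.prod_univ_succ, Fin.cons_zero, Fin.cons_succ] at hJ hx hy
  have hcancel : gam ζ (n + 1) ^ 2 * (vd x ^ 2 * vd y ^ 2 * (∏ i, (x i - x₁)) * (∏ i, (x i - x₂)) *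
      (∏ i, (y i - y₁)) * (∏ i, (y i - y₂))) ≠ 0 := by
    simp only [mul_ne_zero_iff] at hx hy
    obtain ⟨⟨-, h1⟩, h2, h3⟩ := hx
    obtain ⟨⟨-, h4⟩, h5, h6⟩ := hy
    refine mul_ne_zero (pow_ne_zero _ hg0) ?_
    simp only [mul_ne_zero_iff]
    exact ⟨⟨⟨⟨⟨pow_ne_zero _ h3, pow_ne_zero _ h6⟩, h1⟩, h2⟩, h4⟩, h5⟩
  apply mul_left_cancel₀ hcancel
  generalize (∏ i, (x i - x₁)) = A1 at *
  generalize (∏ i, (x i - x₂)) = A2 at *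
  generalize (∏ i, (y i - y₁)) = B1 at *
  generalize (∏ i, (y i - y₂)) = B2 at *
  generalize hW2 : Wdet ζ Qi (n + 2)
    (nodePoly x y z * ((X - C x₂) * (X - C y₂)) * ((X - C x₁) * (X - C y₁))) = W2 at *
  generalize Wdet ζ Qi n (nodePoly x y z) = W0 at *
  linear_combination hJ - vd x ^ 2 * vd y ^ 2 * A1 * A2 * B1 * B2 * (x₂ - x₁) * (y₂ - y₁) *
    W2 * W0 * hg

/-- The difference of the two sides of the bilinear relation `Wdet_jacobi`. -/
def jacobiDefect {R : Type*} [CommRing R] (ζ : R) (Qi : R[X]) {n : ℕ} (x y : Fin n → R)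
    (x₁ x₂ y₁ y₂ z : R) : R :=
  (x₂ - x₁) * (y₂ - y₁) * (2 * ζ ^ 2 * (ζ + 1) ^ 2) *
      (Wdet ζ Qi (n + 2) (nodePoly x y z * ((X - C x₂) * (X - C y₂)) * ((X - C x₁) * (X - C y₁))) *
        Wdet ζ Qi n (nodePoly x y z))
      - (G ζ x₁ y₂ * G ζ x₂ y₁ *
          (Wdet ζ Qi (n + 1) (nodePoly x y z * ((X - C x₂) * (X - C y₂))) *
           Wdet ζ Qi (n + 1) (nodePoly x y z * ((X - C x₁) * (X - C y₁)))) -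
        G ζ x₁ y₁ * G ζ x₂ y₂ *
          (Wdet ζ Qi (n + 1) (nodePoly x y z * ((X - C x₂) * (X - C y₁))) *
           Wdet ζ Qi (n + 1) (nodePoly x y z * ((X - C x₁) * (X - C y₂)))))

theorem jacobiDefect_map {R S : Type*} [CommRing R] [CommRing S] (φ : R →+* S) (ζ : R) (Qi : R[X])
    {n : ℕ} (x y : Fin n → R) (x₁ x₂ y₁ y₂ z : R) :
    jacobiDefect (φ ζ) (Qi.map φ) (φ ∘ x) (φ ∘ y) (φ x₁) (φ x₂) (φ y₁) (φ y₂) (φ z)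
      = φ (jacobiDefect ζ Qi x y x₁ x₂ y₁ y₂ z) := by
  simp only [jacobiDefect, map_sub, map_mul, map_pow, map_add, map_one, map_ofNat, ← Wdet_map,
    Polynomial.map_mul, Polynomial.map_sub, map_X, map_C, nodePoly_map, map_G]

/-- The bilinear relation holds at all nodes, since it holds at algebraically independent ones. -/
theorem Wdet_jacobi {ζ : K} (hζ : Nondeg ζ) {n : ℕ} {Qi : K[X]}
    (hQi : cubP ζ ^ (n + 2) ∣ linQ ζ * Qi - 1) (x y : Fin n → K) (x₁ x₂ y₁ y₂ z : K) :
    (x₂ - x₁) * (y₂ - y₁) * (2 * ζ ^ 2 * (ζ + 1) ^ 2) *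
      (Wdet ζ Qi (n + 2) (nodePoly x y z * ((X - C x₂) * (X - C y₂)) * ((X - C x₁) * (X - C y₁))) *
        Wdet ζ Qi n (nodePoly x y z))
      = G ζ x₁ y₂ * G ζ x₂ y₁ *
          (Wdet ζ Qi (n + 1) (nodePoly x y z * ((X - C x₂) * (X - C y₂))) *
           Wdet ζ Qi (n + 1) (nodePoly x y z * ((X - C x₁) * (X - C y₁)))) -
        G ζ x₁ y₁ * G ζ x₂ y₂ *
          (Wdet ζ Qi (n + 1) (nodePoly x y z * ((X - C x₂) * (X - C y₁))) *
           Wdet ζ Qi (n + 1) (nodePoly x y z * ((X - C x₁) * (X - C y₂)))) := by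
  let A := MvPolynomial (Vars (n + 2)) K
  let gx : Fin (n + 2) → A := fun i => MvPolynomial.X (Sum.inl i)
  let gy : Fin (n + 2) → A := fun i => MvPolynomial.X (Sum.inr (Sum.inl i))
  let gz : A := MvPolynomial.X (Sum.inr (Sum.inr ()))
  let φ : A →+* FractionRing A := algebraMap _ _
  have hφ : Function.Injective φ := IsFractionRing.injective _ _
  let e : A →+* K := MvPolynomial.eval
    (Sum.elim (Fin.cons x₁ (Fin.cons x₂ x)) (Sum.elim (Fin.cons y₁ (Fin.cons y₂ y)) fun _ => z))
  let ι : K →+* A := MvPolynomial.C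
  let ux : Fin n → A := Fin.tail (Fin.tail gx)
  let uy : Fin n → A := Fin.tail (Fin.tail gy)
  have hcons {T : Type _} (v : Fin (n + 2) → A) (ψ : A → T) : (Fin.cons (ψ (v 0))
      (Fin.cons (ψ (v 1)) (ψ ∘ Fin.tail (Fin.tail v))) : Fin (n + 2) → T) = ψ ∘ v := by
    funext i
    refine Fin.cases rfl (fun i => ?_) i
    refine Fin.cases ?_ (fun i => ?_) i
    · simp
    · simp [Fin.tail]
  have hG : ∀ i j, G (ι ζ) (gx i) (gy j) ≠ 0 := by
    intro i j h0
    let e' : A →+* K := MvPolynomial.eval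
      (Sum.elim (fun _ => 2 * ζ + 1) (Sum.elim (fun _ => 2 * ζ + 1) fun _ => 0))
    have := congrArg e' h0
    rw [map_G, map_zero, show e' (ι ζ) = ζ from MvPolynomial.eval_C _,
      show e' (gx i) = 2 * ζ + 1 from MvPolynomial.eval_X _,
      show e' (gy j) = 2 * ζ + 1 from MvPolynomial.eval_X _, G] at this
    have h2 : 2 * ((ζ + 1) ^ 2 * (2 * ζ + 1) ^ 2) = 0 := by
      linear_combination this
    simp [hζ.two_ne, hζ.add_one, hζ.two_mul] at h2
  have hL := Wdet_jacobi_of_ne (hζ.map (φ.comp ι)) (cubP_pow_dvd_map hQi (φ.comp ι))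
    (φ ∘ ux) (φ ∘ uy) (φ (gx 0)) (φ (gx 1)) (φ (gy 0)) (φ (gy 1)) (φ gz) (by
      rw [hcons gx φ, hcons gy φ]
      intro i j
      rw [RingHom.comp_apply, Function.comp_apply, Function.comp_apply, ← map_G]
      exact (map_ne_zero_iff φ hφ).2 (hG i j)) (by
      rw [hcons gx φ, vd_map]
      exact (map_ne_zero_iff φ hφ).2 (vd_X_ne_zero _ Sum.inl_injective)) (by
      rw [hcons gy φ, vd_map]
      exact (map_ne_zero_iff φ hφ).2
        (vd_X_ne_zero _ (Sum.inr_injective.comp Sum.inl_injective)))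
  rw [← sub_eq_zero] at hL ⊢
  have hA : jacobiDefect (ι ζ) (Qi.map ι) ux uy (gx 0) (gx 1) (gy 0) (gy 1) gz = 0 := by
    apply hφ
    rw [map_zero, ← jacobiDefect_map, Polynomial.map_map]
    exact hL
  replace hA := congrArg e hA
  have eζ : e (ι ζ) = ζ := MvPolynomial.eval_C ζ
  have eQ : (Qi.map ι).map e = Qi := by
    rw [Polynomial.map_map, show e.comp ι = RingHom.id K from
      RingHom.ext fun t => MvPolynomial.eval_C t, Polynomial.map_id]
  have ex : e ∘ gx = Fin.cons x₁ (Fin.cons x₂ x) := funext fun i => MvPolynomial.eval_X _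
  have ey : e ∘ gy = Fin.cons y₁ (Fin.cons y₂ y) := funext fun i => MvPolynomial.eval_X _
  have ez : e gz = z := MvPolynomial.eval_X _
  have ex0 : e (gx 0) = x₁ := congrFun ex 0
  have ex1 : e (gx 1) = x₂ := congrFun ex 1
  have ey0 : e (gy 0) = y₁ := congrFun ey 0
  have ey1 : e (gy 1) = y₂ := congrFun ey 1
  have eux : e ∘ ux = x := funext fun i => congrFun ex i.succ.succ
  have euy : e ∘ uy = y := funext fun i => congrFun ey i.succ.succ
  rwa [← jacobiDefect_map, eζ, eQ, ez, ex0, ex1, ey0, ey1, eux, euy, map_zero] at hA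

end Toda

/-! ### The specialization as a determinant of coefficients -/

section CoefDet
variable {R : Type*} [CommRing R]

/-- The determinant whose `(i, j)` entry is the coefficient of `X ^ (2 * j + 1)` in
`X ^ i * c j`. -/
def coefDet (n : ℕ) (c : ℕ → R[X]) : R :=
  Matrix.det (Matrix.of fun i j : Fin n => (X ^ (i : ℕ) * c j).coeff (2 * (j : ℕ) + 1))

theorem coefDet_map {S : Type*} [CommRing S] (φ : R →+* S) (n : ℕ) (c : ℕ → R[X]) :
    coefDet n (fun j => (c j).map φ) = φ (coefDet n c) := by
  rw [coefDet, coefDet, RingHom.map_det]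
  congr 1
  ext i j
  simp only [Matrix.of_apply, RingHom.mapMatrix_apply, Matrix.map_apply, ← coeff_map,
    Polynomial.map_mul, Polynomial.map_pow, map_X]

theorem coefDet_C_mul (n : ℕ) (s : ℕ → R) (c : ℕ → R[X]) :
    coefDet n (fun j => C (s j) * c j) = (∏ j : Fin n, s j) * coefDet n c := by
  rw [coefDet, coefDet, ← Matrix.det_mul_row]
  congr 1
  ext i j
  simp only [Matrix.of_apply, mul_left_comm (X ^ (i : ℕ)), coeff_C_mul]

/-- The determinant of the specialization with `n + 1` nodes at `2ζ + 1` and `n` nodes at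
`ζ / (ζ + 2)`. -/
def detMid (ζ : R) (n : ℕ) : R :=
  coefDet n fun j => (X - C (2 * ζ + 1)) ^ (n - j) * linQ ζ ^ j * linH ζ

/-- The determinant of the specialization with `n` nodes at `2ζ + 1` and `n + 1` nodes at
`ζ / (ζ + 2)`. -/
def detLow (ζ : R) (n : ℕ) : R :=
  coefDet n fun j => (X - C (2 * ζ + 1)) ^ (n - 1 - j) * linQ ζ ^ (j + 1) * linH ζ

/-- The determinant of the specialization with `n + 2` nodes at `2ζ + 1` and `n - 1` nodes at
`ζ / (ζ + 2)`, multiplied by `ζ` to clear the denominator of its first column. -/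
def detHigh (ζ : R) (n : ℕ) : R :=
  coefDet n fun j => if j = 0 then (X - C (2 * ζ + 1)) ^ (n + 1) * (C ζ + C (ζ + 1) * X)
    else (X - C (2 * ζ + 1)) ^ (n + 1 - j) * linQ ζ ^ (j - 1) * linH ζ

theorem detMid_map {S : Type*} [CommRing S] (φ : R →+* S) (ζ : R) (n : ℕ) :
    detMid (φ ζ) n = φ (detMid ζ n) := by
  rw [detMid, detMid, ← coefDet_map]
  simp [Polynomial.map_mul, Polynomial.map_pow, map_linQ, map_linH, map_ofNat]

theorem detLow_map {S : Type*} [CommRing S] (φ : R →+* S) (ζ : R) (n : ℕ) :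
    detLow (φ ζ) n = φ (detLow ζ n) := by
  rw [detLow, detLow, ← coefDet_map]
  simp [Polynomial.map_mul, Polynomial.map_pow, map_linQ, map_linH, map_ofNat]

theorem detHigh_map {S : Type*} [CommRing S] (φ : R →+* S) (ζ : R) (n : ℕ) :
    detHigh (φ ζ) n = φ (detHigh ζ n) := by
  rw [detHigh, detHigh, ← coefDet_map]
  congr 1
  funext j
  split_ifs <;>
  simp [Polynomial.map_mul, Polynomial.map_pow, map_linQ, map_linH, map_ofNat]

end CoefDet

section Field
variable {K : Type*} [Field K]

theorem exists_inverse_linQ {ζ : K} (hζ : Nondeg ζ) (N : ℕ) :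
    ∃ Qi : K[X], cubP ζ ^ N ∣ linQ ζ * Qi - 1 := by
  have h0 : IsCoprime (linQ ζ) X := ⟨-C ζ⁻¹, C (ζ⁻¹ * (ζ + 2)), by
    have : C ζ⁻¹ * C ζ = (1 : K[X]) := by rw [← C_mul, inv_mul_cancel₀ hζ.ne_zero, C_1]
    rw [linQ, C_mul]; linear_combination this⟩
  have h1 : IsCoprime (linQ ζ) (X - C (2 * ζ + 1)) := by
    refine ⟨C (2 * (ζ + 1) ^ 2)⁻¹, -C ((2 * (ζ + 1) ^ 2)⁻¹ * (ζ + 2)), ?_⟩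
    have : C (2 * (ζ + 1) ^ 2)⁻¹ * C (2 * (ζ + 1) ^ 2) = (1 : K[X]) := by
      rw [← C_mul, inv_mul_cancel₀ (mul_ne_zero hζ.two_ne (pow_ne_zero _ hζ.add_one)), C_1]
    rw [linQ, C_mul, ← this]
    simp only [C_mul, C_add, C_pow, C_ofNat, C_1]
    ring
  have h2 : IsCoprime (linQ ζ) (cubP ζ ^ N) := by
    rw [cubP_eq]
    exact (h0.pow_right.mul_right h1).pow_right
  obtain ⟨u, v, h⟩ := h2
  exact ⟨u, -v, by linear_combination h⟩

/-- If modulo `P ^ (j + 1)` the `j`-th column is divisible by `(t - (2ζ + 1)) ^ (j + 1)`, its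
residues are coefficients of the quotient `w`, of which only the terms of degree at most `2 j + 1`
matter. -/
theorem Wdet_eq_coefDet (ζ : K) (Qi : K[X]) (n : ℕ) (Φ : K[X]) (c : ℕ → K[X])
    (h : ∀ j < n, ∃ w, cubP ζ ^ (j + 1) ∣ Φ * linH ζ * Qi ^ (n - j) -
      (X - C (2 * ζ + 1)) ^ (j + 1) * w ∧ X ^ (2 * j + 2) ∣ w - c j) :
    Wdet ζ Qi n Φ = coefDet n c := by
  rw [Wdet, coefDet]
  congr 1
  ext i j
  obtain ⟨w, h1, h2⟩ := h j j.2
  rw [Wmat, Matrix.of_apply, Matrix.of_apply,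
    resid_congr ζ ((j : ℕ) + 1) (v := X ^ (i : ℕ) * (Φ * linH ζ) * Qi ^ (n - (j : ℕ)))
      (w := (X - C (2 * ζ + 1)) ^ ((j : ℕ) + 1) * (X ^ (i : ℕ) * w)) (by
        refine (h1.mul_left (X ^ (i : ℕ))).trans (dvd_of_eq ?_)
        ring), resid_X_sub_C_pow_mul _ (Nat.succ_pos _), ← sub_eq_zero]
  rw [show 2 * ((j : ℕ) + 1) - 1 = 2 * j + 1 by omega, ← coeff_sub, ← mul_sub]
  exact X_pow_dvd_iff.1 (h2.mul_left (X ^ (i : ℕ))) _ (by omega)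

theorem dvd_linQ_pow_mul_sub {ζ : K} {n j : ℕ} {Qi : K[X]} (hj : j < n)
    (hQi : cubP ζ ^ n ∣ linQ ζ * Qi - 1) (m k : ℕ) (w : K[X]) :
    cubP ζ ^ (j + 1) ∣ linQ ζ ^ (m + k) * Qi ^ k * w - linQ ζ ^ m * w := by
  refine (pow_dvd_pow _ (Nat.succ_le_of_lt hj)).trans (hQi.trans ?_)
  have : linQ ζ * Qi - 1 ∣ (linQ ζ * Qi) ^ k - 1 := sub_one_dvd_pow_sub_one _ _
  refine (this.mul_left (linQ ζ ^ m * w)).trans (dvd_of_eq ?_)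
  ring

theorem X_sub_C_eq_linQ {ζ : K} (hζ : Nondeg ζ) :
    X - C (ζ / (ζ + 2)) = C (ζ + 2)⁻¹ * linQ ζ := by
  rw [linQ, mul_sub, ← mul_assoc, ← C_mul, ← C_mul, inv_mul_cancel₀ hζ.add_two, div_eq_inv_mul]
  simp

theorem Wdet_mid {ζ : K} (hζ : Nondeg ζ) {n : ℕ} {Qi : K[X]}
    (hQi : cubP ζ ^ n ∣ linQ ζ * Qi - 1) :
    Wdet ζ Qi n ((X - C (2 * ζ + 1)) ^ (n + 1) * (X - C (ζ / (ζ + 2))) ^ n)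
      = ((ζ + 2)⁻¹) ^ (n * n) * detMid ζ n := by
  rw [X_sub_C_eq_linQ hζ, detMid, show ((ζ + 2)⁻¹) ^ (n * n) = ∏ j : Fin n, ((ζ + 2)⁻¹) ^ n by
    simp [pow_mul], ← coefDet_C_mul n fun _ => ((ζ + 2)⁻¹) ^ n]
  refine Wdet_eq_coefDet ζ Qi n _ _ fun j hj => ⟨_, ?_, by rw [sub_self]; exact dvd_zero _⟩
  obtain ⟨k, rfl⟩ := Nat.exists_eq_add_of_le hj.le
  refine (dvd_linQ_pow_mul_sub hj hQi j k ((X - C (2 * ζ + 1)) ^ (j + k + 1) *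
    C (ζ + 2)⁻¹ ^ (j + k) * linH ζ)).trans (dvd_of_eq ?_)
  rw [Nat.add_sub_cancel_left, C_pow]
  ring

theorem Wdet_low {ζ : K} (hζ : Nondeg ζ) {n : ℕ} {Qi : K[X]}
    (hQi : cubP ζ ^ n ∣ linQ ζ * Qi - 1) :
    Wdet ζ Qi n ((X - C (2 * ζ + 1)) ^ n * (X - C (ζ / (ζ + 2))) ^ (n + 1))
      = ((ζ + 2)⁻¹) ^ ((n + 1) * n) * detLow ζ n := by
  rw [X_sub_C_eq_linQ hζ, detLow, show ((ζ + 2)⁻¹) ^ ((n + 1) * n)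
    = ∏ j : Fin n, ((ζ + 2)⁻¹) ^ (n + 1) by simp [pow_mul],
    ← coefDet_C_mul n fun _ => ((ζ + 2)⁻¹) ^ (n + 1)]
  refine Wdet_eq_coefDet ζ Qi n _ _ fun j hj => ⟨_, ?_, by rw [sub_self]; exact dvd_zero _⟩
  obtain ⟨k, rfl⟩ := Nat.exists_eq_add_of_lt hj
  refine (dvd_linQ_pow_mul_sub hj hQi (j + 1) (k + 1) ((X - C (2 * ζ + 1)) ^ (j + k + 1) *
    C (ζ + 2)⁻¹ ^ (j + k + 2) * linH ζ)).trans (dvd_of_eq ?_)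
  rw [show j + k + 1 - j = k + 1 by omega, show j + k + 1 - 1 - j = k by omega, C_pow]
  ring

theorem X_sq_dvd_linH_mul {ζ : K} (hζ : Nondeg ζ) {Qi : K[X]} (h : X ^ 2 ∣ linQ ζ * Qi - 1) :
    X ^ 2 ∣ linH ζ * Qi - C ζ⁻¹ * (C ζ + C (ζ + 1) * X) := by
  have hc : IsCoprime (X ^ 2) (linQ ζ) := by
    obtain ⟨r, hr⟩ := h
    exact ⟨-r, Qi, by linear_combination hr⟩
  refine hc.dvd_of_dvd_mul_left ?_
  have h1 : C ζ⁻¹ * C ζ = (1 : K[X]) := by rw [← C_mul, inv_mul_cancel₀ hζ.ne_zero, C_1]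
  have h2 : linQ ζ * (linH ζ * Qi - C ζ⁻¹ * (C ζ + C (ζ + 1) * X))
      = linH ζ * (linQ ζ * Qi - 1) - X ^ 2 * (C ζ⁻¹ * C ((ζ + 1) * (ζ + 2))) := by
    rw [linQ, linH]
    simp only [C_add, C_mul, C_1, C_ofNat]
    linear_combination (-(C ζ + 2) * X + C ζ + (C ζ + 1) * X) * h1
  rw [h2]
  exact dvd_sub (h.mul_left _) (dvd_mul_right _ _)

theorem Wdet_high {ζ : K} (hζ : Nondeg ζ) {n : ℕ} {Qi : K[X]}
    (hQi : cubP ζ ^ (n + 1) ∣ linQ ζ * Qi - 1) :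
    Wdet ζ Qi (n + 1) ((X - C (2 * ζ + 1)) ^ (n + 3) * (X - C (ζ / (ζ + 2))) ^ n)
      = ((ζ + 2)⁻¹) ^ (n * (n + 1)) * ζ⁻¹ * detHigh ζ (n + 1) := by
  rw [X_sub_C_eq_linQ hζ, detHigh, show ((ζ + 2)⁻¹) ^ (n * (n + 1)) * ζ⁻¹
    = ∏ j : Fin (n + 1), ((ζ + 2)⁻¹) ^ n * if (j : ℕ) = 0 then ζ⁻¹ else 1 by
      rw [Fin.prod_univ_succ]; simp [pow_mul]; ring,
    ← coefDet_C_mul (n + 1) fun j => ((ζ + 2)⁻¹) ^ n * if j = 0 then ζ⁻¹ else 1]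
  refine Wdet_eq_coefDet ζ Qi (n + 1) _ _ fun j hj => ?_
  rcases j with _ | j
  · refine ⟨C (ζ + 2)⁻¹ ^ n * (X - C (2 * ζ + 1)) ^ (n + 2) * (linH ζ * Qi), ?_, ?_⟩
    · refine (dvd_linQ_pow_mul_sub hj hQi 0 n ((X - C (2 * ζ + 1)) ^ (n + 3) *
        C (ζ + 2)⁻¹ ^ n * (linH ζ * Qi))).trans (dvd_of_eq ?_)
      rw [Nat.sub_zero]
      ring
    · have hX : (X : K[X]) ^ 2 ∣ linQ ζ * Qi - 1 := by
        refine Dvd.dvd.trans ?_ hQi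
        rw [pow_succ, cubP_eq]
        exact ((dvd_mul_right _ _).mul_left _)
      refine ((X_sq_dvd_linH_mul hζ hX).mul_left
        (C (ζ + 2)⁻¹ ^ n * (X - C (2 * ζ + 1)) ^ (n + 2))).trans (dvd_of_eq ?_)
      rw [if_pos rfl, if_pos rfl, C_mul, C_pow]
      ring
  · refine ⟨_, ?_, by rw [sub_self]; exact dvd_zero _⟩
    rw [if_neg (Nat.succ_ne_zero j), if_neg (Nat.succ_ne_zero j)]
    obtain ⟨k, rfl⟩ := Nat.exists_eq_add_of_lt (Nat.lt_of_succ_lt_succ hj)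
    refine (dvd_linQ_pow_mul_sub hj hQi j (k + 1) ((X - C (2 * ζ + 1)) ^ (j + k + 4) *
      C (ζ + 2)⁻¹ ^ (j + k + 1) * linH ζ)).trans (dvd_of_eq ?_)
    rw [show j + k + 1 + 1 - (j + 1) = k + 1 by omega,
      show j + k + 1 + 1 + 1 - (j + 1) = k + 2 by omega, Nat.add_sub_cancel, C_mul, C_pow, C_1]
    ring

theorem det_toda_of_field {ζ : K} (hζ : Nondeg ζ) (n : ℕ) :
    2 * (ζ + 1) ^ 2 * (detMid ζ (n + 2) * detMid ζ n) =
      ζ * (detHigh ζ (n + 1) * detLow ζ (n + 1)) -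
        (2 * ζ + 1) ^ 2 * (ζ + 2) ^ 2 * detMid ζ (n + 1) ^ 2 := by
  obtain ⟨Qi, hQi⟩ := exists_inverse_linQ hζ (n + 2)
  have hQ1 := (pow_dvd_pow (cubP ζ) (Nat.le_succ (n + 1))).trans hQi
  have hQ0 := (pow_dvd_pow (cubP ζ) (Nat.le_succ n)).trans hQ1
  have hJ := Wdet_jacobi hζ hQi (fun _ => 2 * ζ + 1) (fun _ => ζ / (ζ + 2)) (2 * ζ + 1)
    (ζ / (ζ + 2)) (2 * ζ + 1) (ζ / (ζ + 2)) (2 * ζ + 1)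
  have hne := hζ.add_two
  have hne0 := hζ.ne_zero
  have h2 := Wdet_mid hζ hQi
  have h1 := Wdet_mid hζ hQ1
  have h0 := Wdet_mid hζ hQ0
  have hl := Wdet_low hζ hQ1
  have hh := Wdet_high hζ hQ1
  have hab : G ζ (2 * ζ + 1) (ζ / (ζ + 2)) = 2 * (ζ + 1) ^ 2 * ζ ^ 2 / (ζ + 2) ^ 2 := by
    rw [G]; field_simp; ring
  have hba : G ζ (ζ / (ζ + 2)) (2 * ζ + 1) = 2 * (ζ + 1) ^ 2 * ζ ^ 2 / (ζ + 2) ^ 2 := by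
    rw [G]; field_simp; ring
  have haa : G ζ (2 * ζ + 1) (2 * ζ + 1) = 2 * (ζ + 1) ^ 2 * (2 * ζ + 1) ^ 2 := by
    rw [G]; ring
  have hbb : G ζ (ζ / (ζ + 2)) (ζ / (ζ + 2)) = 2 * (ζ + 1) ^ 2 * ζ ^ 2 / (ζ + 2) ^ 2 := by
    rw [G]; field_simp; ring
  have hd : ζ / (ζ + 2) - (2 * ζ + 1) = -2 * (ζ + 1) ^ 2 / (ζ + 2) := by
    field_simp; ring
  rw [hab, hba, haa, hbb, hd] at hJ
  simp only [nodePoly, Finset.prod_const, Finset.card_univ, Fintype.card_fin] at hJ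
  generalize X - C (2 * ζ + 1) = u at *
  generalize X - C (ζ / (ζ + 2)) = v at *
  rw [show u ^ n * v ^ n * u * (v * v) * (u * u) = u ^ (n + 2 + 1) * v ^ (n + 2) by ring,
    show u ^ n * v ^ n * u * (v * v) = u ^ (n + 1) * v ^ (n + 1 + 1) by ring,
    show u ^ n * v ^ n * u * (u * u) = u ^ (n + 3) * v ^ n by ring,
    show u ^ n * v ^ n * u * (v * u) = u ^ (n + 1 + 1) * v ^ (n + 1) by ring,
    show u ^ n * v ^ n * u * (u * v) = u ^ (n + 1 + 1) * v ^ (n + 1) by ring,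
    show u ^ n * v ^ n * u = u ^ (n + 1) * v ^ n by ring, h2, h1, h0, hl, hh] at hJ
  have hs : ((ζ + 2)⁻¹) * (ζ + 2) = 1 := inv_mul_cancel₀ hne
  have hz : ζ⁻¹ * ζ = 1 := inv_mul_cancel₀ hne0
  have h4 : ζ ^ 2 * (ζ + 1) ^ 4 * 4 * (((ζ + 2)⁻¹) ^ (n * n)) ^ 2 *
      (((ζ + 2)⁻¹) ^ n) ^ 4 * ((ζ + 2)⁻¹) ^ 6 ≠ 0 := by
    have := hζ.add_one
    have := hζ.two_ne
    have h4 : (4 : K) ≠ 0 := by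
      rw [show (4 : K) = 2 * 2 by norm_num]; exact mul_ne_zero hζ.two_ne hζ.two_ne
    positivity
  apply mul_left_cancel₀ h4
  simp only [div_eq_mul_inv, inv_pow] at hJ
  simp only [← inv_pow] at hJ
  generalize (ζ + 2)⁻¹ = s at *
  linear_combination hJ + 4 * ζ ^ 3 * (ζ + 1) ^ 4 * (s ^ (n * n)) ^ 2 * (s ^ n) ^ 4 * s ^ 6 *
    (detHigh ζ (n + 1) * detLow ζ (n + 1)) * hz + 4 * ζ ^ 2 * (ζ + 1) ^ 4 * (2 * ζ + 1) ^ 2 *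
    (s ^ (n * n)) ^ 2 * (s ^ n) ^ 4 * s ^ 4 * detMid ζ (n + 1) ^ 2 * (s * (ζ + 2) + 1) * hs
end Field

theorem nondeg_ratFunc : Nondeg (RatFunc.X : RatFunc ℚ) := by
  have h (a b : ℚ) (hab : a + b ≠ 0) : RatFunc.C a * RatFunc.X + RatFunc.C b ≠ 0 := by
    rw [← RatFunc.algebraMap_X, ← RatFunc.algebraMap_C, ← RatFunc.algebraMap_C, ← map_mul,
      ← map_add, Ne, FaithfulSMul.algebraMap_eq_zero_iff]
    intro h0
    exact hab (by simpa using congrArg (eval 1) h0)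
  constructor
  · exact two_ne_zero
  · exact RatFunc.X_ne_zero
  · simpa using h 1 1 (by norm_num)
  · simpa using h 1 2 (by norm_num)
  · simpa using h 2 1 (by norm_num)

/-- The recursion from which the theorem follows, as an identity in `ℚ[ζ]`. -/
theorem det_toda (n : ℕ) :
    2 * (X + 1) ^ 2 * (detMid X (n + 2) * detMid X n) =
      X * (detHigh X (n + 1) * detLow X (n + 1)) -
        (2 * X + 1) ^ 2 * (X + 2) ^ 2 * detMid (X : ℚ[X]) (n + 1) ^ 2 := by
  apply RatFunc.algebraMap_injective ℚ
  have := det_toda_of_field nondeg_ratFunc n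
  rw [← RatFunc.algebraMap_X, detMid_map, detMid_map, detMid_map, detHigh_map, detLow_map] at this
  simpa only [map_add, map_sub, map_mul, map_pow, map_one, map_ofNat, RatFunc.algebraMap_X] using
    this

theorem specS_eq (n : ℕ) : specS n = gam RatFunc.X n * ((RatFunc.X + 2)⁻¹ ^ (n * n) *
    algebraMap ℚ[X] (RatFunc ℚ) (detMid X n)) := by
  obtain ⟨Qi, hQi⟩ := exists_inverse_linQ nondeg_ratFunc n
  rw [← detMid_map, RatFunc.algebraMap_X, ← Wdet_mid nondeg_ratFunc hQi, specS,
    aeval_S RatFunc.algebraMap_X nondeg_ratFunc hQi]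
  simp only [nodePoly, Finset.prod_const, Finset.card_univ, Fintype.card_fin]
  ring_nf

theorem gam_eq {R : Type*} [CommRing R] (ζ : R) (n : ℕ) :
    gam ζ n = 2 ^ (n + 1).choose 2 * ζ ^ n ^ 2 * (1 + ζ) ^ n ^ 2 := by
  induction n with
  | zero => simp [gam]
  | succ n ih =>
    rw [gam_succ, ih, Nat.choose_succ_succ' (n + 1) 1, Nat.choose_one_right, mul_pow, mul_pow,
      ← pow_mul, ← pow_mul]
    ring

/-- The relation between `pₙ` as defined and the determinant `detMid`. -/
theorem pFrac_mul (n : ℕ) : pFrac n * algebraMap ℚ[X] (RatFunc ℚ)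
    ((-1) ^ (n + 1).choose 2 * 2 ^ n.choose 2 * (2 * X + 1) ^ (n ^ 2 / 4) *
      (1 + C (1 / 2) * X) ^ ((n - 1) ^ 2 / 4)) = algebraMap ℚ[X] (RatFunc ℚ) (detMid X n) := by
  have h := nondeg_ratFunc
  have h1 := h.ne_zero
  have h2 := h.add_one
  have h3 := h.add_two
  have h4 := h.two_mul
  rw [pFrac, specS_eq, gam_eq]
  have hC : algebraMap ℚ[X] (RatFunc ℚ) (C (1 / 2)) = 1 / 2 := by
    rw [RatFunc.algebraMap_C]; simp
  simp only [map_mul, map_pow, map_add, map_neg, map_one, map_ofNat, RatFunc.algebraMap_X, hC]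
  have e1 : (1 : RatFunc ℚ) + RatFunc.X / 2 = (RatFunc.X + 2) / 2 := by ring
  have e2 : (1 : RatFunc ℚ) + 1 / 2 * RatFunc.X = (RatFunc.X + 2) / 2 := by ring
  have e3 : (1 : RatFunc ℚ) + 2 * RatFunc.X = 2 * RatFunc.X + 1 := by ring
  have e4 : (1 : RatFunc ℚ) + RatFunc.X = RatFunc.X + 1 := by ring
  have e5 : (2 : RatFunc ℚ) ^ (n + 1).choose 2 * 2 ^ n.choose 2 = 2 ^ (n ^ 2) := by
    rw [← pow_add, Nat.choose_succ_succ' n 1, Nat.choose_one_right]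
    congr 1
    induction n with
    | zero => rfl
    | succ n ih => rw [Nat.choose_succ_succ' n 1, Nat.choose_one_right]; linarith
  have e6 : ((-1 : RatFunc ℚ) ^ (n + 1).choose 2) ≠ 0 := by simp
  rw [e1, e2, e3, e4, inv_pow, ← sq n, div_pow (RatFunc.X + 2) 2 (n ^ 2), ← e5]
  generalize (-1 : RatFunc ℚ) ^ (n + 1).choose 2 = s at *
  have e7 : (RatFunc.X + 2 : RatFunc ℚ) / 2 ≠ 0 := div_ne_zero h3 two_ne_zero
  generalize algebraMap ℚ[X] (RatFunc ℚ) (detMid X n) = D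
  generalize (RatFunc.X + 2 : RatFunc ℚ) / 2 = t at *
  generalize (2 * RatFunc.X + 1 : RatFunc ℚ) = r at *
  field_simp

/-! ### Powers of `2ζ + 1` and `ζ + 2` in the determinants -/

section Divisibility
variable {R : Type*} [CommRing R]

/-- If `π ^ (α i + β j)` divides the `(i, j)` entry, then `π ^ (∑ α + ∑ β)` divides the determinant.
The weights may be negative. -/
theorem pow_dvd_det_of_weights {n e : ℕ} (π : R) (M : Matrix (Fin n) (Fin n) R) (α β : Fin n → ℤ)
    (h : ∀ i j, π ^ (α i + β j).toNat ∣ M i j) (he : (e : ℤ) ≤ ∑ i, α i + ∑ j, β j) :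
    π ^ e ∣ M.det := by
  rw [Matrix.det_apply']
  refine Finset.dvd_sum fun σ _ => Dvd.dvd.mul_left ?_ _
  have h1 : e ≤ ∑ j, (α (σ j) + β j).toNat := by
    zify
    refine he.trans ?_
    rw [← Equiv.sum_comp σ α, ← Finset.sum_add_distrib]
    exact Finset.sum_le_sum fun j _ => Int.self_le_toNat _
  refine (pow_dvd_pow π h1).trans ?_
  rw [← Finset.prod_pow_eq_pow_sum]
  exact Finset.prod_dvd_prod_of_dvd _ _ fun j _ => h (σ j) j

theorem sum_min_range (κ r : ℕ) :
    2 * ∑ i ∈ Finset.range (κ + r), min (i : ℤ) κ = κ * (κ - 1) + 2 * κ * r := by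
  induction r with
  | zero =>
    rw [add_zero]
    have : ∑ i ∈ Finset.range κ, min (i : ℤ) κ = ∑ i ∈ Finset.range κ, (i : ℤ) :=
      Finset.sum_congr rfl fun i hi => min_eq_left (by have := Finset.mem_range.1 hi; omega)
    rw [this]
    clear this
    induction κ with
    | zero => simp
    | succ κ ih => rw [Finset.sum_range_succ, mul_add, ih]; push_cast; ring
  | succ r ih =>
    rw [← add_assoc, Finset.sum_range_succ, mul_add, ih, min_eq_right (by push_cast; omega)]
    push_cast; ring

theorem le_sum_max_range (c κ r : ℕ) :
    (κ + 1) * (2 * c - 3 * κ) - 2 * κ * r ≤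
      2 * ∑ j ∈ Finset.range (κ + 1 + r), max ((c : ℤ) - 3 * j) (-κ) := by
  induction r with
  | zero =>
    have h1 (m : ℕ) : (m : ℤ) * (2 * c - 3 * (m - 1)) ≤
        2 * ∑ j ∈ Finset.range m, max ((c : ℤ) - 3 * j) (-κ) := by
      induction m with
      | zero => simp
      | succ m ih =>
        rw [Finset.sum_range_succ]
        have := le_max_left ((c : ℤ) - 3 * m) (-κ)
        push_cast
        linarith
    have := h1 (κ + 1)
    push_cast at this ⊢
    simpa using this
  | succ r ih =>
    rw [← add_assoc, Finset.sum_range_succ]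
    have := le_max_right ((c : ℤ) - 3 * (κ + 1 + r : ℕ)) (-κ)
    push_cast at this ih ⊢
    linarith

/-- The weights are `min i κ` on the rows and `max (c - 3 j) (-κ)` on the columns, with
`κ = ⌊c / 2⌋`. -/
theorem pow_dvd_det_of_dvd {n c : ℕ} (hc : c < 2 * n) (π : R) (M : Matrix (Fin n) (Fin n) R)
    (h : ∀ i j : Fin n, π ^ (c + i - 3 * j : ℕ) ∣ M i j) : π ^ ((c + 1) ^ 2 / 4) ∣ M.det := by
  obtain ⟨κ, hκ⟩ : ∃ κ, κ = c / 2 := ⟨_, rfl⟩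
  obtain ⟨r, rfl⟩ : ∃ r, n = κ + 1 + r := Nat.exists_eq_add_of_le (by omega)
  refine pow_dvd_det_of_weights π M (fun i => min (i : ℤ) κ)
    (fun j => max ((c : ℤ) - 3 * j) (-κ)) (fun i j => (pow_dvd_pow π ?_).trans (h i j)) ?_
  · rcases le_total ((c : ℤ) - 3 * j) (-κ) with h1 | h1
    · rw [max_eq_right h1]
      have := min_le_right (i : ℤ) κ
      omega
    · rw [max_eq_left h1]
      have := min_le_left (i : ℤ) κ
      omega
  · rw [Fin.sum_univ_eq_sum_range fun i => min (i : ℤ) κ,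
      Fin.sum_univ_eq_sum_range fun j => max ((c : ℤ) - 3 * j) (-κ)]
    have h1 := sum_min_range κ (1 + r)
    have h2 := le_sum_max_range c κ r
    rw [← add_assoc] at h1
    have h3 : 4 * (((c + 1) ^ 2 / 4 : ℕ) : ℤ) ≤ (c + 1) ^ 2 - if Even c then 1 else 0 := by
      split_ifs with hev
      · obtain ⟨k, rfl⟩ := hev
        have : (k + k + 1) ^ 2 = 4 * (k * k + k) + 1 := by ring
        push_cast
        rw [show ((k : ℤ) + k + 1) ^ 2 = 4 * (k * k + k) + 1 by ring]
        omega
      · have := Nat.mul_div_le ((c + 1) ^ 2) 4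
        zify at this ⊢
        linarith
    push_cast at h1 h2 h3 ⊢
    rcases Nat.even_or_odd' c with ⟨k, rfl | rfl⟩
    · obtain rfl : κ = k := by omega
      rw [if_pos (even_two_mul _)] at h3
      push_cast at h3 h2 ⊢
      linarith
    · obtain rfl : κ = k := by omega
      rw [if_neg (by simp)] at h3
      push_cast at h3 h2 ⊢
      linarith

theorem pow_dvd_coeff_X_sub_C_pow_mul (a : R) (k m : ℕ) (g : R[X]) :
    a ^ (k - m) ∣ ((X - C a) ^ k * g).coeff m := by
  rw [coeff_mul]
  refine Finset.dvd_sum fun x hx => Dvd.dvd.mul_right ?_ _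
  rw [sub_eq_add_neg, ← C_neg, coeff_X_add_C_pow]
  refine Dvd.dvd.mul_right ?_ _
  rw [neg_pow]
  refine Dvd.dvd.mul_left (pow_dvd_pow _ ?_) _
  have := Finset.HasAntidiagonal.mem_antidiagonal.1 hx
  omega

theorem pow_dvd_coeff_linQ_pow_mul (ζ : R) (k m d : ℕ) (g : R[X]) (hg : g.natDegree ≤ d) :
    (ζ + 2) ^ (m - d) ∣ (linQ ζ ^ k * g).coeff m := by
  rw [coeff_mul]
  refine Finset.dvd_sum fun x hx => ?_
  have hx := Finset.HasAntidiagonal.mem_antidiagonal.1 hx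
  by_cases h : d < x.2
  · rw [coeff_eq_zero_of_natDegree_lt (hg.trans_lt h), mul_zero]
    exact dvd_zero _
  refine Dvd.dvd.mul_right ?_ _
  rw [show linQ ζ ^ k = ((X - C ζ) ^ k).comp (C (ζ + 2) * X) by simp [linQ], comp_C_mul_X_coeff]
  exact (pow_dvd_pow _ (by omega)).mul_left _

theorem pow_dvd_coeff_X_pow_mul (a : R) (i k m : ℕ) (g : R[X]) :
    a ^ (k + i - m) ∣ (X ^ i * ((X - C a) ^ k * g)).coeff m := by
  rw [coeff_X_pow_mul']
  split_ifs with h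
  · rw [show k + i - m = k - (m - i) by omega]
    exact pow_dvd_coeff_X_sub_C_pow_mul a k (m - i) g
  · exact dvd_zero _

theorem pow_dvd_coefDet_of_X_sub_C {n k : ℕ} (hk : k ≤ 2 * n) (a : R) (c g : ℕ → R[X])
    (h : ∀ j < n, c j = (X - C a) ^ (k - j) * g j) : a ^ (k ^ 2 / 4) ∣ coefDet n c := by
  rcases k with _ | k
  · simp
  refine pow_dvd_det_of_dvd (by omega) a _ fun i j => ?_
  rw [Matrix.of_apply, h j j.2]
  exact (pow_dvd_pow _ (by omega)).trans (pow_dvd_coeff_X_pow_mul a i _ _ (g j))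

theorem pow_dvd_coefDet_of_linQ {n k d : ℕ} (hk : k + d = 2 * n) (ζ : R)
    (c g : ℕ → R[X]) (l : ℕ → ℕ)
    (h : ∀ j < n, d ≤ 3 * j → c j = linQ ζ ^ (l j) * g j ∧ (g j).natDegree + j ≤ d + 1) :
    (ζ + 2) ^ ((k - 1) ^ 2 / 4) ∣ coefDet n c := by
  rcases k with _ | _ | k
  · simp
  · simp
  -- reversing rows and columns brings the exponents `3 j - i - d` into the form `k + i - 3 j`
  rw [coefDet, ← Matrix.det_submatrix_equiv_self Fin.revPerm]
  refine pow_dvd_det_of_dvd (by omega) (ζ + 2) _ fun i j => ?_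
  simp only [Matrix.submatrix_apply, Matrix.of_apply, Fin.revPerm_apply]
  by_cases hd : d ≤ 3 * (Fin.rev j : ℕ)
  · obtain ⟨h1, h2⟩ := h _ (Fin.rev j).2 hd
    rw [h1, mul_left_comm]
    refine (pow_dvd_pow _ ?_).trans (pow_dvd_coeff_linQ_pow_mul ζ _ _
      ((Fin.rev i : ℕ) + (g (Fin.rev j)).natDegree) _ (natDegree_mul_le.trans
        (add_le_add_left (natDegree_X_pow_le _) _)))
    rw [Fin.val_rev] at h2 ⊢
    rw [Fin.val_rev]
    omega
  · rw [show k + (i : ℕ) - 3 * (j : ℕ) = 0 by rw [Fin.val_rev] at hd; omega, pow_zero]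
    exact one_dvd _

end Divisibility

theorem two_X_add_one_pow_dvd_detMid (n : ℕ) :
    (2 * X + 1) ^ (n ^ 2 / 4) ∣ detMid (X : ℚ[X]) n :=
  pow_dvd_coefDet_of_X_sub_C (by omega) _ _ (fun j => linQ X ^ j * linH X)
    fun j _ => mul_assoc _ _ _

theorem two_X_add_one_pow_dvd_detHigh (n : ℕ) :
    (2 * X + 1) ^ ((n + 2) ^ 2 / 4) ∣ detHigh (X : ℚ[X]) (n + 1) := by
  refine pow_dvd_coefDet_of_X_sub_C (by omega) _ _ (fun j => if j = 0 then C X + C (X + 1) * X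
    else linQ X ^ (j - 1) * linH X) fun j _ => ?_
  split_ifs with h
  · rw [h, Nat.sub_zero]
  · rw [mul_assoc]

theorem natDegree_X_sub_C_pow_mul_linH_le {R : Type*} [CommRing R] (a ζ : R) (k : ℕ) :
    ((X - C a) ^ k * linH ζ).natDegree ≤ k + 1 := by
  rw [linH]
  refine natDegree_mul_le.trans (add_le_add ?_ (natDegree_X_sub_C_le _))
  simpa using natDegree_pow_le_of_le k (natDegree_X_sub_C_le a)

theorem X_add_two_pow_dvd_detMid (n : ℕ) :
    (X + 2) ^ ((n - 1) ^ 2 / 4) ∣ detMid (X : ℚ[X]) n := by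
  refine pow_dvd_coefDet_of_linQ (two_mul n).symm _ _
    (fun j => (X - C (2 * X + 1)) ^ (n - j) * linH X) (fun j => j) fun j hj _ => ⟨by ring, ?_⟩
  have := natDegree_X_sub_C_pow_mul_linH_le (2 * X + 1 : ℚ[X]) X (n - j)
  omega

theorem X_add_two_pow_dvd_detHigh (n : ℕ) :
    (X + 2) ^ ((n - 1) ^ 2 / 4) ∣ detHigh (X : ℚ[X]) (n + 1) := by
  refine pow_dvd_coefDet_of_linQ (d := n + 2) (by omega) _ _
    (fun j => (X - C (2 * X + 1)) ^ (n + 2 - j) * linH X) (fun j => j - 1) fun j hj h => ⟨?_, ?_⟩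
  · rw [if_neg (by omega)]; ring
  · have := natDegree_X_sub_C_pow_mul_linH_le (2 * X + 1 : ℚ[X]) X (n + 2 - j)
    omega

theorem isCoprime_two_X_add_one : IsCoprime (2 * X + 1 : ℚ[X]) (X + 2) :=
  ⟨C (-1 / 3), C (2 / 3), by
    have h (a b : ℚ) : C a * (2 * X + 1 : ℚ[X]) + C b * (X + 2)
        = C (2 * a + b) * X + C (a + 2 * b) := by
      simp only [C_add, C_mul, C_ofNat]; ring
    rw [h]; norm_num⟩

theorem half_factor : (1 + C (1 / 2) * X : ℚ[X]) = C (1 / 2) * (X + 2) := by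
  have h : (C (1 / 2) * 2 : ℚ[X]) = 1 := by
    rw [show (2 : ℚ[X]) = C 2 from (map_ofNat C 2).symm, ← C_mul]; norm_num
  linear_combination -h

theorem mul_dvd_of_dvd {e f : ℕ} {D : ℚ[X]} (h1 : (2 * X + 1) ^ e ∣ D) (h2 : (X + 2) ^ f ∣ D) :
    (2 * X + 1) ^ e * (1 + C (1 / 2) * X) ^ f ∣ D := by
  have hu : IsUnit (C (1 / 2 : ℚ)) := isUnit_C.2 (by norm_num)
  rw [half_factor, mul_pow, mul_left_comm, (hu.pow f).mul_left_dvd]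
  exact isCoprime_two_X_add_one.pow.mul_dvd h1 h2

theorem exists_detMid_eq (n : ℕ) : ∃ q : ℚ[X], detMid X n = (-1) ^ (n + 1).choose 2 *
    2 ^ n.choose 2 * (2 * X + 1) ^ (n ^ 2 / 4) * (1 + C (1 / 2) * X) ^ ((n - 1) ^ 2 / 4) * q := by
  obtain ⟨q, hq⟩ := mul_dvd_of_dvd (two_X_add_one_pow_dvd_detMid n) (X_add_two_pow_dvd_detMid n)
  refine ⟨(-1) ^ (n + 1).choose 2 * C ((1 / 2) ^ n.choose 2) * q, ?_⟩
  have h1 : ((-1) ^ (n + 1).choose 2 * (-1) ^ (n + 1).choose 2 : ℚ[X]) = 1 := by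
    rw [← mul_pow]; norm_num
  have h2 : (2 ^ n.choose 2 * C ((1 / 2) ^ n.choose 2) : ℚ[X]) = 1 := by
    rw [C_pow, ← mul_pow, show (2 : ℚ[X]) = C 2 from (map_ofNat C 2).symm, ← C_mul]; norm_num
  rw [hq]
  linear_combination (-(2 * X + 1) ^ (n ^ 2 / 4) * (1 + C (1 / 2) * X) ^ ((n - 1) ^ 2 / 4) * q) *
    (2 ^ n.choose 2 * C ((1 / 2) ^ n.choose 2) * h1 + h2)

theorem algebraMap_p (n : ℕ) : algebraMap ℚ[X] (RatFunc ℚ) (p n) = pFrac n := by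
  obtain ⟨q, hq⟩ := exists_detMid_eq n
  have h := pFrac_mul n
  rw [hq, map_mul _ _ q, mul_comm] at h
  have h0 := mul_left_cancel₀ ?_ h
  · rw [p, h0, RatFunc.num_algebraMap]
  · rw [Ne, FaithfulSMul.algebraMap_eq_zero_iff]
    intro h1
    have := congrArg (eval 1) h1
    norm_num at this

theorem detMid_eq (n : ℕ) : detMid X n = (-1) ^ (n + 1).choose 2 *
    2 ^ n.choose 2 * (2 * X + 1) ^ (n ^ 2 / 4) * (1 + C (1 / 2) * X) ^ ((n - 1) ^ 2 / 4) * p n := by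
  apply RatFunc.algebraMap_injective ℚ
  rw [← pFrac_mul, map_mul _ _ (p n), algebraMap_p, mul_comm]

/-! ### Reversal `ζ ↦ 1 / ζ` -/

section Reversal
variable {R : Type*} [CommRing R]

theorem coefDet_congr {n : ℕ} {c d : ℕ → R[X]} (h : ∀ j < n, c j = d j) :
    coefDet n c = coefDet n d := by
  rw [coefDet, coefDet]
  congr 1
  ext i j
  rw [Matrix.of_apply, Matrix.of_apply, h j j.2]

/-- Reversing the columns as polynomials of degree `n + 1`, and the order of rows and columns,
leaves the determinant unchanged. -/
theorem coefDet_reflect {n : ℕ} {c : ℕ → R[X]} (h : ∀ j < n, (c j).natDegree ≤ n + 1) :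
    coefDet n c = coefDet n fun j => reflect (n + 1) (c (n - 1 - j)) := by
  rw [coefDet, coefDet]
  refine Eq.trans ?_ (Matrix.det_submatrix_equiv_self Fin.revPerm _)
  congr 1
  ext i j
  have hi := i.2
  have hj := j.2
  simp only [Matrix.submatrix_apply, Matrix.of_apply, Fin.revPerm_apply, Fin.val_rev]
  have h1 : (X : R[X]) ^ (n - (i + 1) : ℕ) = reflect (n - 1) (X ^ (i : ℕ)) := by
    rw [reflect_monomial, revAt_le (by omega)]
    congr 1
    omega
  rw [show n - 1 - (n - (j + 1)) = (j : ℕ) by omega, h1, ← reflect_mul _ _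
    ((natDegree_X_pow_le _).trans (by omega)) (h j hj), coeff_reflect, revAt_le (by omega)]
  congr 1
  omega

theorem natDegree_linear_pow_le (a b : R) (k : ℕ) :
    ((C a * X + C b) ^ k).natDegree ≤ k := by
  simpa using natDegree_pow_le_of_le k (natDegree_linear_le (a := a) (b := b))

theorem reflect_linear_pow (a b : R) (k : ℕ) :
    reflect k ((C a * X + C b) ^ k) = (C a + C b * X) ^ k := by
  induction k with
  | zero => simp [reflect_one]
  | succ k ih =>
    rw [pow_succ, pow_succ, reflect_mul _ _ (natDegree_linear_pow_le a b k) natDegree_linear_le, ih,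
      reflect_add, reflect_C_mul, reflect_C, reflect_one_X, mul_one, pow_one]

end Reversal

/-- The substitution `ζ ↦ 1 / ζ`, together with reversal in the auxiliary variable, exchanges the
factors `t - (2ζ + 1)` and `(ζ + 2) t - ζ`. -/
theorem detMid_inv {K : Type*} [Field K] {ζ : K} (hζ : ζ ≠ 0) (n : ℕ) :
    detMid ζ⁻¹ n * ζ ^ ((n + 1) * n) = detLow ζ n := by
  have h1 : C ζ * C ζ⁻¹ = (1 : K[X]) := by rw [← C_mul, mul_inv_cancel₀ hζ, C_1]
  have h2 : detMid ζ⁻¹ n * ζ ^ ((n + 1) * n) = coefDet n fun j =>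
      (C ζ * X + C (-(ζ + 2))) ^ (n - j) * (C (2 * ζ + 1) * X + C (-1)) ^ j *
        (C ζ * X + C (-1)) ^ 1 := by
    rw [show ζ ^ ((n + 1) * n) = ∏ j : Fin n, ζ ^ (n + 1) by simp [pow_mul], mul_comm, detMid,
      ← coefDet_C_mul n fun _ => ζ ^ (n + 1)]
    refine coefDet_congr fun j hj => ?_
    have e1 : C ζ * X + C (-(ζ + 2)) = C ζ * (X - C (2 * ζ⁻¹ + 1)) := by
      simp only [C_add, C_mul, C_neg, C_1, C_ofNat]
      linear_combination 2 * h1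
    have e2 : C (2 * ζ + 1) * X + C (-1) = C ζ * linQ ζ⁻¹ := by
      rw [linQ]
      simp only [C_add, C_mul, C_neg, C_1, C_ofNat]
      linear_combination (1 - X) * h1
    have e3 : C ζ * X + C (-1) = C ζ * linH ζ⁻¹ := by
      rw [linH]
      simp only [C_neg, C_1]
      linear_combination h1
    rw [e1, e2, e3]
    obtain ⟨k, rfl⟩ := Nat.exists_eq_add_of_le hj.le
    rw [Nat.add_sub_cancel_left, C_pow, mul_pow, mul_pow]
    ring
  rw [h2, coefDet_reflect, detLow]
  · have h3 : ∏ j : Fin n, (-1 : K) ^ (n + 1) = 1 := by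
      rw [Finset.prod_const, Finset.card_univ, Fintype.card_fin, ← pow_mul, mul_comm,
        (Nat.even_mul_succ_self n).neg_one_pow]
    refine Eq.trans ?_ ((coefDet_C_mul n (fun _ => (-1 : K) ^ (n + 1)) _).trans
      (by rw [h3, one_mul]))
    refine coefDet_congr fun j hj => ?_
    have hd1 := natDegree_linear_pow_le ζ (-(ζ + 2)) (n - (n - 1 - j))
    have hd2 := natDegree_linear_pow_le (2 * ζ + 1) (-1) (n - 1 - j)
    have e := reflect_mul _ _ (natDegree_mul_le_of_le hd1 hd2) (natDegree_linear_pow_le ζ (-1) 1)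
    rw [reflect_mul _ _ hd1 hd2, reflect_linear_pow, reflect_linear_pow, reflect_linear_pow] at e
    obtain ⟨k, rfl⟩ := Nat.exists_eq_add_of_lt hj
    rw [show j + k + 1 - (j + k + 1 - 1 - j) = j + 1 by omega,
      show j + k + 1 - 1 - j = k by omega, show j + 1 + k + 1 = j + k + 1 + 1 by ring] at e
    rw [show j + k + 1 - (j + k + 1 - 1 - j) = j + 1 by omega,
      show j + k + 1 - 1 - j = k by omega, e, linQ, linH]
    have e1 : C ζ + C (-(ζ + 2)) * X = -(C (ζ + 2) * X - C ζ) := by rw [C_neg]; ring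
    have e2 : C (2 * ζ + 1) + C (-1) * X = -(X - C (2 * ζ + 1)) := by rw [C_neg, C_1]; ring
    have e3 : C ζ + C (-1) * X = -(X - C ζ) := by rw [C_neg, C_1]; ring
    rw [e1, e2, e3, C_pow, C_neg, C_1, neg_pow, neg_pow (X - _) k, neg_pow _ 1]
    ring
  · intro j hj
    refine (natDegree_mul_le_of_le (natDegree_mul_le_of_le (natDegree_linear_pow_le _ _ _)
      (natDegree_linear_pow_le _ _ _)) (natDegree_linear_pow_le _ _ _)).trans ?_
    omega

/-- The determinant `detLow` with its factor `ζ ^ n` removed, by rescaling the variable. -/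
def detRev {R : Type*} [CommRing R] (ζ : R) (n : ℕ) : R :=
  coefDet n fun j => (C ζ * X - C (2 * ζ + 1)) ^ (n - 1 - j) * (C (ζ + 2) * X - 1) ^ (j + 1) *
    (X - 1)

theorem detRev_map {R S : Type*} [CommRing R] [CommRing S] (φ : R →+* S) (ζ : R) (n : ℕ) :
    detRev (φ ζ) n = φ (detRev ζ n) := by
  rw [detRev, detRev, ← coefDet_map]
  simp [Polynomial.map_mul, Polynomial.map_pow, map_ofNat]

theorem sum_range_two_mul_add_one (n : ℕ) : ∑ j ∈ Finset.range n, (2 * j + 1) = n ^ 2 := by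
  induction n with
  | zero => simp
  | succ n ih => rw [Finset.sum_range_succ, ih]; ring

theorem sq_eq_choose (n : ℕ) : n ^ 2 = 2 * n.choose 2 + n := by
  induction n with
  | zero => rfl
  | succ n ih => rw [Nat.choose_succ_succ' n 1, Nat.choose_one_right]; linarith

theorem coefDet_scale {R : Type*} [CommRing R] (r : R) (n : ℕ) (c : ℕ → R[X]) :
    r ^ (n ^ 2) * coefDet n c = r ^ (n.choose 2) * coefDet n fun j => (c j).comp (C r * X) := by
  have h1 : r ^ (n ^ 2) = ∏ j : Fin n, r ^ (2 * (j : ℕ) + 1) := by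
    rw [Finset.prod_pow_eq_pow_sum, Fin.sum_univ_eq_sum_range fun j => 2 * j + 1,
      sum_range_two_mul_add_one]
  have h2 : r ^ (n.choose 2) = ∏ j : Fin n, r ^ (j : ℕ) := by
    rw [Finset.prod_pow_eq_pow_sum, Fin.sum_univ_eq_sum_range fun j => j, Finset.sum_range_id,
      Nat.choose_two_right]
  rw [h1, h2, coefDet, coefDet, ← Matrix.det_mul_row, ← Matrix.det_mul_column]
  congr 1
  ext i j
  simp only [Matrix.of_apply]
  rw [mul_comm, ← comp_C_mul_X_coeff, mul_comp, X_pow_comp, mul_pow, ← C_pow, mul_assoc,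
    coeff_C_mul]

theorem detLow_eq {R : Type*} [CommRing R] [IsDomain R] {ζ : R} (hζ : ζ ≠ 0) (n : ℕ) :
    detLow ζ n = ζ ^ n * detRev ζ n := by
  apply mul_left_cancel₀ (pow_ne_zero (n ^ 2) hζ)
  have h : ∏ j : Fin n, ζ ^ ((j : ℕ) + 2) = ζ ^ (n.choose 2 + 2 * n) := by
    rw [Finset.prod_pow_eq_pow_sum, Fin.sum_univ_eq_sum_range fun j => j + 2,
      Finset.sum_add_distrib, Finset.sum_range_id, Nat.choose_two_right]
    simp [mul_comm]
  have h2 : n ^ 2 + n = n.choose 2 + (n.choose 2 + 2 * n) := by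
    have := sq_eq_choose n
    linarith
  rw [← mul_assoc, ← pow_add, h2, pow_add, ← h, mul_assoc, detRev,
    ← coefDet_C_mul n fun j => ζ ^ (j + 2), detLow, coefDet_scale]
  congr 1
  refine coefDet_congr fun j _ => ?_
  simp only [mul_comp, pow_comp, sub_comp, X_comp, C_comp, linQ, linH, C_pow]
  rw [show C (ζ + 2) * (C ζ * X) - C ζ = C ζ * (C (ζ + 2) * X - 1) by ring,
    show C ζ * X - C ζ = C ζ * (X - 1) by ring, mul_pow]
  ring

/-! ### A determinant given by a central binomial coefficient -/

section CentralBinomial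

/-- The coefficient `binom(2k, k) / 2 ^ k` of `u ^ k` in `(1 - 2u) ^ (-1/2)`. -/
def cbCoeff (k : ℕ) : ℚ := k.centralBinom / 2 ^ k

theorem cbCoeff_succ (k : ℕ) : ((k : ℚ) + 1) * cbCoeff (k + 1) = (2 * k + 1) * cbCoeff k := by
  have h := Nat.succ_mul_centralBinom_succ k
  have h' : ((k : ℚ) + 1) * (k + 1).centralBinom = 2 * (2 * k + 1) * k.centralBinom := by
    exact_mod_cast h
  rw [cbCoeff, cbCoeff, pow_succ]
  field_simp
  linear_combination h'

/-- `X - X ^ 2 / 2`, for which `1 - 2 ψ = (1 - X) ^ 2`. -/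
def psi : ℚ[X] := X * (1 - C (1 / 2) * X)

theorem C_half_mul_two : (C (1 / 2) * 2 : ℚ[X]) = 1 := by
  rw [show (2 : ℚ[X]) = C 2 from (map_ofNat C 2).symm, ← C_mul]; norm_num

theorem derivative_psi : derivative psi = 1 - X := by
  rw [psi]
  simp only [derivative_mul, derivative_X, derivative_sub, derivative_one, derivative_C]
  linear_combination (-X) * C_half_mul_two

/-- The partial sum of `∑ binom(2k, k) (ψ / 2) ^ k`. -/
def cbSum (N : ℕ) : ℚ[X] := ∑ k ∈ Finset.range (N + 1), C (cbCoeff k) * psi ^ k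

theorem one_sub_X_mul_derivative_cbSum (N : ℕ) : (1 - X) * derivative (cbSum N)
    = cbSum N - C ((2 * N + 1) * cbCoeff N) * psi ^ N := by
  have hψ : (1 - X : ℚ[X]) ^ 2 = 1 - 2 * psi := by
    rw [psi]; linear_combination (-X ^ 2) * C_half_mul_two
  induction N with
  | zero => simp [cbSum]
  | succ N ih =>
    have h1 : cbSum (N + 1) = cbSum N + C (cbCoeff (N + 1)) * psi ^ (N + 1) := by
      rw [cbSum, Finset.sum_range_succ, cbSum]
    have h2 : derivative (C (cbCoeff (N + 1)) * psi ^ (N + 1))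
        = C (((N : ℚ) + 1) * cbCoeff (N + 1)) * psi ^ N * (1 - X) := by
      rw [derivative_C_mul, derivative_pow, derivative_psi, C_mul]
      push_cast
      simp only [C_add, C_1, map_natCast]
      ring
    have h3 := congrArg C (cbCoeff_succ N)
    rw [h1, derivative_add, mul_add, ih, h2, show (1 - X : ℚ[X]) * (C (((N : ℚ) + 1) *
      cbCoeff (N + 1)) * psi ^ N * (1 - X)) = C (((N : ℚ) + 1) *
      cbCoeff (N + 1)) * psi ^ N * (1 - X) ^ 2 by ring, hψ]
    push_cast
    simp only [C_mul, C_add, C_1, C_ofNat, map_natCast] at h3 ⊢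
    linear_combination psi ^ N * h3

theorem X_pow_dvd_of_derivative {N : ℕ} {f : ℚ[X]} (h0 : f.coeff 0 = 0)
    (h : X ^ N ∣ derivative f) : X ^ (N + 1) ∣ f := by
  rw [X_pow_dvd_iff] at h ⊢
  rintro (_ | d) hd
  · exact h0
  · have := h d (by omega)
    rw [coeff_derivative] at this
    exact (mul_eq_zero.1 this).resolve_right (by positivity)

/-- The central binomial series `∑ binom(2k, k) (ψ / 2) ^ k = (1 - 2 ψ) ^ (-1/2)`. -/
theorem X_pow_dvd_one_sub_X_mul_cbSum (N : ℕ) : X ^ (N + 1) ∣ (1 - X) * cbSum N - 1 := by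
  apply X_pow_dvd_of_derivative
  · have : (cbSum N).coeff 0 = 1 := by
      rw [coeff_zero_eq_eval_zero, cbSum, eval_finsetSum, Finset.sum_range_succ']
      simp [psi, cbCoeff]
    rw [coeff_sub, mul_coeff_zero, this]
    simp
  · have h := one_sub_X_mul_derivative_cbSum N
    have h2 : derivative ((1 - X) * cbSum N - 1) = -C ((2 * N + 1) * cbCoeff N) * psi ^ N := by
      rw [derivative_sub, derivative_mul, derivative_sub, derivative_X, derivative_one]
      linear_combination h
    rw [h2, psi, mul_pow]
    exact (dvd_mul_right _ _).mul_left _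

theorem X_pow_dvd_sum_sub_one (N : ℕ) : X ^ (N + 1) ∣ (∑ k ∈ Finset.range (N + 1),
    C (cbCoeff (k + 1)) * (X ^ k * ((1 - C (1 / 2) * X) ^ (k + 1) * (1 - X)))) - 1 := by
  have h := X_pow_dvd_one_sub_X_mul_cbSum (N + 1)
  rw [cbSum, Finset.sum_range_succ', pow_succ' X] at h
  refine (mul_dvd_mul_iff_left (X_ne_zero (R := ℚ))).1 (h.trans (dvd_of_eq ?_))
  rw [mul_sub, Finset.mul_sum, mul_add, Finset.mul_sum]
  have : ∀ k, (1 - X) * (C (cbCoeff (k + 1)) * psi ^ (k + 1)) = X * (C (cbCoeff (k + 1)) *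
      (X ^ k * ((1 - C (1 / 2) * X) ^ (k + 1) * (1 - X)))) := by
    intro k; rw [psi, mul_pow]; ring
  simp only [this]
  simp [cbCoeff]
  ring

/-- A minor of a unitriangular matrix, evaluated by Cramer's rule. -/
theorem det_minor_eq (n : ℕ) : Matrix.det (Matrix.of fun i j : Fin n =>
    (X ^ (j : ℕ) * ((1 - C (1 / 2) * X) ^ ((j : ℕ) + 1) * (1 - X)) : ℚ[X]).coeff (i + 1))
    = (-1) ^ n * cbCoeff (n + 1) := by
  obtain ⟨M, hM'⟩ : ∃ M : Matrix (Fin (n + 1)) (Fin (n + 1)) ℚ, ∀ i j, M i j =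
      (X ^ (j : ℕ) * ((1 - C (1 / 2) * X) ^ ((j : ℕ) + 1) * (1 - X)) : ℚ[X]).coeff i :=
    ⟨Matrix.of fun _ _ => _, fun _ _ => rfl⟩
  have hM : M.det = 1 := by
    rw [Matrix.det_of_isLowerTriangular M]
    · refine Finset.prod_eq_one fun i _ => ?_
      rw [hM', coeff_X_pow_mul', if_pos le_rfl, Nat.sub_self, coeff_zero_eq_eval_zero]
      simp
    · intro i j hij
      have hij : i < j := hij
      rw [hM', coeff_X_pow_mul', if_neg (by simpa using hij)]
  have h1 := Matrix.det_updateCol_sum M (Fin.last n) fun k => cbCoeff (k + 1)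
  have h2 : (fun k => ∑ i : Fin (n + 1), cbCoeff (i + 1) • M k i) = Pi.single 0 1 := by
    funext k
    have h3 := X_pow_dvd_iff.1 (X_pow_dvd_sum_sub_one n) k k.2
    rw [coeff_sub, finsetSum_coeff, sub_eq_zero] at h3
    simp only [hM']
    rw [Fin.sum_univ_eq_sum_range (fun i => cbCoeff (i + 1) • (X ^ (i : ℕ) *
      ((1 - C (1 / 2) * X) ^ ((i : ℕ) + 1) * (1 - X)) : ℚ[X]).coeff k)]
    simp only [coeff_C_mul] at h3
    simp only [smul_eq_mul, h3, coeff_one, Pi.single_apply, Fin.ext_iff, Fin.val_zero]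
  rw [h2, hM, Matrix.det_succ_column _ (Fin.last n), Finset.sum_eq_single 0] at h1
  · rw [Matrix.updateCol_self, Pi.single_eq_same, Matrix.submatrix_updateCol_succAbove] at h1
    simp only [Fin.val_zero, Fin.val_last, zero_add, mul_one, smul_eq_mul] at h1
    rw [← h1, ← mul_assoc, ← mul_pow]
    norm_num
    congr 1
    ext i j
    simp [hM']
  · intro i _ hi
    rw [Matrix.updateCol_self, Pi.single_eq_of_ne hi]
    simp
  · simp

theorem coefDet_X_sub_half (n : ℕ) :
    coefDet n (fun j => (X - C (1 / 2 : ℚ)) ^ (j + 1) * (X - 1)) = (-1) ^ n * cbCoeff (n + 1) := by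
  rw [← det_minor_eq, coefDet]
  congr 1
  ext i j
  rw [Matrix.of_apply, Matrix.of_apply]
  have e1 : (X - C (1 / 2 : ℚ)) = C 1 * X + C (-(1 / 2)) := by rw [C_1, C_neg]; ring
  have e2 : (X - 1 : ℚ[X]) = (C 1 * X + C (-1)) ^ 1 := by simp; ring
  have hd := natDegree_mul_le_of_le (natDegree_linear_pow_le (1 : ℚ) (-(1 / 2)) ((j : ℕ) + 1))
    (natDegree_linear_pow_le (1 : ℚ) (-1) 1)
  -- reversing `X ^ i` in degree `i + j` supplies the factor `X ^ j` of the minor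
  have h := reflect_mul _ _ ((natDegree_X_pow_le (R := ℚ) (i : ℕ)).trans
    (Nat.le_add_right (i : ℕ) j)) hd
  rw [reflect_monomial, revAt_le (Nat.le_add_right _ _), Nat.add_sub_cancel_left,
    reflect_mul _ _ (natDegree_linear_pow_le _ _ _) (natDegree_linear_pow_le _ _ _),
    reflect_linear_pow, reflect_linear_pow] at h
  have h' := congrArg (fun q => coeff q ((i : ℕ) + 1)) h
  simp only [coeff_reflect] at h'
  rw [revAt_le (by omega), show (i : ℕ) + j + (j + 1 + 1) - (i + 1) = 2 * j + 1 by omega] at h'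
  rw [e1, e2, h']
  congr 3
  · congr 1; rw [C_1, C_neg]; ring
  · rw [C_1, C_neg, C_1]; ring

theorem detRev_zero (n : ℕ) : detRev (0 : ℚ) n =
    (-1) ^ n.choose 2 * 2 ^ (n + 1).choose 2 * ((-1) ^ n * cbCoeff (n + 1)) := by
  have h : (-1 : ℚ) ^ n.choose 2 * 2 ^ (n + 1).choose 2
      = ∏ j : Fin n, ((-1) ^ (n - 1 - j : ℕ) * 2 ^ ((j : ℕ) + 1)) := by
    rw [Finset.prod_mul_distrib, Finset.prod_pow_eq_pow_sum, Finset.prod_pow_eq_pow_sum,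
      Fin.sum_univ_eq_sum_range (fun j => n - 1 - j), Fin.sum_univ_eq_sum_range (fun j => j + 1),
      Finset.sum_range_reflect (fun j => j), Finset.sum_range_id, Nat.choose_two_right,
      Finset.sum_add_distrib, Finset.sum_range_id, Nat.choose_succ_succ' n 1, Nat.choose_one_right,
      Nat.choose_two_right]
    simp [add_comm]
  rw [h, ← coefDet_X_sub_half, ← coefDet_C_mul n fun j => (-1) ^ (n - 1 - j : ℕ) * 2 ^ (j + 1),
    detRev]
  refine coefDet_congr fun j _ => ?_
  have e : (C (0 + 2 : ℚ) * X - 1) = C 2 * (X - C (1 / 2)) := by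
    rw [mul_sub, ← C_mul]; norm_num
  rw [e]
  simp [mul_pow]
  ring

end CentralBinomial

/-! ### Degree and leading coefficient of `pₙ` -/

theorem detMid_zero_ne (n : ℕ) : detMid (0 : ℚ) n ≠ 0 := by
  have h (i j : ℕ) : (X : ℚ[X]) ^ i * ((X - C (2 * 0 + 1)) ^ (n - j) * linQ 0 ^ j * linH 0)
      = X ^ (i + j + 1) * (C (2 ^ j) * (X - 1) ^ (n - j)) := by
    simp only [linQ, linH, C_0, sub_zero, zero_add, mul_zero, C_1, mul_pow, C_pow]
    ring
  rw [detMid, coefDet, Matrix.det_of_isUpperTriangular]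
  · refine Finset.prod_ne_zero_iff.2 fun i _ => ?_
    rw [Matrix.of_apply, h, coeff_X_pow_mul', if_pos (by omega),
      show 2 * (i : ℕ) + 1 - (i + i + 1) = 0 by omega, coeff_zero_eq_eval_zero]
    simp
  · intro i j hij
    have hij : j < i := hij
    rw [Matrix.of_apply, h, coeff_X_pow_mul', if_neg]
    have : (j : ℕ) < i := hij
    omega

theorem eval_zero_detMid (n : ℕ) : (detMid (X : ℚ[X]) n).eval 0 = detMid 0 n := by
  have := detMid_map (evalRingHom (0 : ℚ)) X n
  simpa using this.symm

theorem cbCoeff_ne_zero (k : ℕ) : cbCoeff k ≠ 0 := by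
  have := Nat.centralBinom_ne_zero k
  rw [cbCoeff]
  positivity

theorem coeff_zero_detRev (n : ℕ) : (detRev (X : ℚ[X]) n).coeff 0 = detRev 0 n := by
  have := detRev_map (evalRingHom (0 : ℚ)) X n
  rw [coeff_zero_eq_eval_zero]
  simpa using this.symm

theorem detRev_zero_ne (n : ℕ) : detRev (0 : ℚ) n ≠ 0 := by
  have := cbCoeff_ne_zero (n + 1)
  rw [detRev_zero]
  positivity

/-- The reversal of `detMid X n` in any degree `n ^ 2 + d` that bounds its own. This is how the
bound `n ^ 2` on its degree is found. -/
theorem reflect_detMid (n d : ℕ) (h : (detMid (X : ℚ[X]) n).natDegree ≤ n ^ 2 + d) :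
    reflect (n ^ 2 + d) (detMid (X : ℚ[X]) n) = X ^ d * detRev X n := by
  have hX : (RatFunc.X : RatFunc ℚ) ≠ 0 := RatFunc.X_ne_zero
  have h1 : aeval (RatFunc.X⁻¹ : RatFunc ℚ) (detMid (X : ℚ[X]) n) * RatFunc.X ^ n ^ 2
      = algebraMap ℚ[X] (RatFunc ℚ) (detRev (X : ℚ[X]) n) := by
    have e := detMid_inv hX n
    have e2 := detMid_map (aeval (RatFunc.X⁻¹ : RatFunc ℚ) : ℚ[X] →ₐ[ℚ] RatFunc ℚ).toRingHom X n
    simp only [AlgHom.toRingHom_eq_coe, RingHom.coe_coe, aeval_X] at e2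
    rw [e2, detLow_eq hX] at e
    apply mul_left_cancel₀ (pow_ne_zero n hX)
    rw [← detRev_map, RatFunc.algebraMap_X, ← e]
    ring
  have : Invertible (RatFunc.X : RatFunc ℚ) := invertibleOfNonzero hX
  have h2 := eval₂_reflect_mul_pow (algebraMap ℚ (RatFunc ℚ)) RatFunc.X (n ^ 2 + d)
    (reflect (n ^ 2 + d) (detMid X n)) (natDegree_reflect_le.trans (max_le le_rfl h))
  rw [reflect_reflect, invOf_eq_inv, ← aeval_def, ← aeval_def, ← RatFunc.algebraMap_X,
    aeval_algebraMap_apply, aeval_X_left_apply, RatFunc.algebraMap_X, pow_add, ← mul_assoc,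
    h1] at h2
  apply RatFunc.algebraMap_injective ℚ
  rw [← h2, map_mul, map_pow, RatFunc.algebraMap_X, mul_comm]

theorem detMid_ne_zero (n : ℕ) : detMid (X : ℚ[X]) n ≠ 0 := by
  intro h
  have := eval_zero_detMid n
  rw [h, eval_zero] at this
  exact detMid_zero_ne n this.symm

theorem natDegree_detMid (n : ℕ) : (detMid (X : ℚ[X]) n).natDegree = n ^ 2 := by
  have hle : (detMid (X : ℚ[X]) n).natDegree ≤ n ^ 2 := by
    by_contra! hlt
    obtain ⟨d, hd⟩ := Nat.exists_eq_add_of_lt hlt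
    have h := congrArg (fun q => coeff q 0) (reflect_detMid n (d + 1) hd.le)
    simp only [coeff_reflect, revAt_zero, mul_coeff_zero] at h
    rw [← add_assoc, ← hd, coeff_natDegree] at h
    simp [detMid_ne_zero] at h
  have h := congrArg (fun q => coeff q 0) (reflect_detMid n 0 hle)
  simp only [coeff_reflect, revAt_zero, add_zero, pow_zero, one_mul,
    coeff_zero_detRev] at h
  exact le_antisymm hle (le_natDegree_of_ne_zero (h ▸ detRev_zero_ne n))

theorem reverse_detMid (n : ℕ) : (detMid (X : ℚ[X]) n).reverse = detRev X n := by
  have h := reflect_detMid n 0 (natDegree_detMid n).le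
  rwa [add_zero, pow_zero, one_mul, ← natDegree_detMid] at h

/-- The constant relating `detMid X n` to `p n`. -/
def kap (n : ℕ) : ℚ := (-1) ^ (n + 1).choose 2 * 2 ^ n.choose 2

theorem kap_ne_zero (n : ℕ) : kap n ≠ 0 := by rw [kap]; positivity

theorem detMid_eq_kap (n : ℕ) : detMid X n = C (kap n) * (2 * X + 1) ^ (n ^ 2 / 4) *
    (1 + C (1 / 2) * X) ^ ((n - 1) ^ 2 / 4) * p n := by
  rw [detMid_eq, kap]
  simp only [C_mul, C_pow, C_neg, C_1, map_ofNat]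

theorem p_ne_zero (n : ℕ) : p n ≠ 0 := by
  intro h
  have := detMid_eq_kap n
  rw [h, mul_zero] at this
  exact detMid_ne_zero n this

theorem coeff_zero_p_ne_zero (n : ℕ) : (p n).coeff 0 ≠ 0 := by
  intro h
  rw [coeff_zero_eq_eval_zero] at h
  have := eval_zero_detMid n
  rw [detMid_eq_kap, eval_mul, h, mul_zero] at this
  exact detMid_zero_ne n this.symm

theorem sq_two_mul_div_four (k : ℕ) : (2 * k) ^ 2 / 4 = k ^ 2 := by
  rw [show (2 * k) ^ 2 = 4 * k ^ 2 by ring]; omega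

theorem sq_two_mul_add_one_div_four (k : ℕ) : (2 * k + 1) ^ 2 / 4 = k ^ 2 + k := by
  rw [show (2 * k + 1) ^ 2 = 4 * (k ^ 2 + k) + 1 by ring]; omega

theorem sq_div_four_succ (n : ℕ) : (n + 1) ^ 2 / 4 = n ^ 2 / 4 + (n + 1) / 2 := by
  obtain ⟨k, rfl | rfl⟩ := Nat.even_or_odd' n
  · rw [sq_two_mul_add_one_div_four, sq_two_mul_div_four]; omega
  · rw [show 2 * k + 1 + 1 = 2 * (k + 1) by ring, sq_two_mul_add_one_div_four, sq_two_mul_div_four,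
      show 2 * (k + 1) / 2 = k + 1 by omega]
    ring

theorem sq_div_four_add (n : ℕ) : n ^ 2 / 4 + (n - 1) ^ 2 / 4 = n.choose 2 := by
  induction n with
  | zero => rfl
  | succ n ih =>
    rw [Nat.choose_succ_succ' n 1, Nat.choose_one_right, ← ih, Nat.add_sub_cancel, sq_div_four_succ]
    rcases n with _ | n
    · rfl
    · rw [Nat.add_sub_cancel, sq_div_four_succ]; omega

theorem sq_div_four_eq (n : ℕ) : n ^ 2 / 4 = (n - 1) ^ 2 / 4 + n / 2 := by
  rcases n with _ | n
  · rfl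
  · rw [sq_div_four_succ, Nat.add_sub_cancel]

theorem natDegree_two_X_add_one : (2 * X + 1 : ℚ[X]).natDegree = 1 := by
  compute_degree!

theorem natDegree_half_factor : (1 + C (1 / 2) * X : ℚ[X]).natDegree = 1 := by
  compute_degree!

theorem leadingCoeff_two_X_add_one : (2 * X + 1 : ℚ[X]).leadingCoeff = 2 := by
  rw [leadingCoeff, natDegree_two_X_add_one]; simp [coeff_one]

theorem leadingCoeff_half_factor : (1 + C (1 / 2) * X : ℚ[X]).leadingCoeff = 1 / 2 := by
  rw [leadingCoeff, natDegree_half_factor]; simp [coeff_one]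

theorem two_X_add_one_ne_zero : (2 * X + 1 : ℚ[X]) ≠ 0 :=
  ne_zero_of_natDegree_gt (n := 0) (by rw [natDegree_two_X_add_one]; exact one_pos)

theorem half_factor_ne_zero : (1 + C (1 / 2) * X : ℚ[X]) ≠ 0 :=
  ne_zero_of_natDegree_gt (n := 0) (by rw [natDegree_half_factor]; exact one_pos)

theorem choose_succ_two (n : ℕ) : (n + 1).choose 2 = n.choose 2 + n := by
  rw [Nat.choose_succ_succ' n 1, Nat.choose_one_right, add_comm]

theorem natDegree_p (n : ℕ) : (p n).natDegree = (n + 1).choose 2 := by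
  have h := natDegree_detMid n
  have h1 := two_X_add_one_ne_zero
  have h2 := half_factor_ne_zero
  have h3 := p_ne_zero n
  have h4 : C (kap n) ≠ 0 := C_ne_zero.2 (kap_ne_zero n)
  rw [detMid_eq_kap, natDegree_mul (by positivity) h3,
    natDegree_mul (by positivity) (by positivity), natDegree_mul h4 (by positivity), natDegree_C,
    natDegree_pow, natDegree_pow, natDegree_two_X_add_one, natDegree_half_factor,
    mul_one, mul_one, zero_add, sq_div_four_add,
    sq_eq_choose] at h
  rw [choose_succ_two]
  omega

theorem leadingCoeff_p (n : ℕ) :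
    (p n).leadingCoeff = (n + 1).centralBinom / 2 ^ ((n + 2) / 2) := by
  have h : (detMid (X : ℚ[X]) n).leadingCoeff = detRev 0 n := by
    rw [← coeff_zero_detRev, ← reverse_detMid, coeff_zero_reverse]
  rw [detMid_eq_kap, leadingCoeff_mul, leadingCoeff_mul, leadingCoeff_mul, leadingCoeff_C,
    leadingCoeff_pow, leadingCoeff_pow, leadingCoeff_two_X_add_one, leadingCoeff_half_factor,
    detRev_zero, kap, sq_div_four_eq, choose_succ_two, pow_add, pow_add, pow_add, cbCoeff] at h
  have h0 : (-1 : ℚ) ^ n.choose 2 ≠ 0 := by positivity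
  have h1 : (-1 : ℚ) ^ n ≠ 0 := by positivity
  rw [show (n + 2) / 2 = n / 2 + 1 by omega]
  generalize (-1 : ℚ) ^ n.choose 2 = s at *
  generalize (-1 : ℚ) ^ n = t at *
  rw [one_div, inv_pow, pow_succ] at h
  rw [pow_succ]
  field_simp at h ⊢
  apply mul_left_cancel₀ (pow_ne_zero n (two_ne_zero (α := ℚ)))
  linear_combination h

/-! ### The Bézout-type recursion -/

theorem kap_mul_kap (n : ℕ) : kap (n + 2) * kap n = -2 * kap (n + 1) ^ 2 := by
  rw [kap, kap, kap, choose_succ_two (n + 2), choose_succ_two (n + 1), choose_succ_two n]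
  simp only [pow_add]
  ring

theorem reverse_linear {a : ℚ} (b : ℚ) (ha : a ≠ 0) :
    (C a * X + C b).reverse = C a + C b * X := by
  have := reflect_linear_pow a b 1
  rwa [pow_one, pow_one, ← natDegree_linear (b := b) ha] at this

theorem reverse_pow' (f : ℚ[X]) (k : ℕ) : (f ^ k).reverse = f.reverse ^ k := by
  induction k with
  | zero => simpa using reverse_C (1 : ℚ)
  | succ k ih => rw [pow_succ, reverse_mul_of_domain, ih, pow_succ]

theorem reverse_two_X_add_one : (2 * X + 1 : ℚ[X]).reverse = 2 * (1 + C (1 / 2) * X) := by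
  have := reverse_linear 1 (two_ne_zero (α := ℚ))
  simp only [map_ofNat, C_1] at this
  rw [this]
  linear_combination (-X) * C_half_mul_two

theorem reverse_half_factor :
    (1 + C (1 / 2) * X : ℚ[X]).reverse = C (1 / 2) * (2 * X + 1) := by
  have := reverse_linear (a := 1 / 2) 1 (by norm_num)
  rw [add_comm 1, ← C_1, this, C_1]
  linear_combination (-X) * C_half_mul_two

theorem X_mul_detLow (n : ℕ) : X * detLow (X : ℚ[X]) n = C (kap n) *
    (2 * (1 + C (1 / 2) * X)) ^ (n ^ 2 / 4) *
      (C (1 / 2) * (2 * X + 1)) ^ ((n - 1) ^ 2 / 4) * coefB n := by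
  rw [detLow_eq X_ne_zero, ← reverse_detMid, detMid_eq_kap, reverse_mul_of_domain,
    reverse_mul_of_domain, reverse_mul_of_domain, reverse_C, reverse_pow', reverse_pow',
    reverse_two_X_add_one, reverse_half_factor, coefB]
  ring

theorem two_add_two_mul_sq_div_four (n : ℕ) : 2 + 2 * ((n + 1) ^ 2 / 4) =
    (n + 2) ^ 2 / 4 + n ^ 2 / 4 + (1 + if Even (n + 1) then 1 else 0) := by
  rw [sq_div_four_succ (n + 1), sq_div_four_succ n]
  split_ifs with h <;> [rw [Nat.even_iff] at h; rw [Nat.not_even_iff] at h] <;> omega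

theorem two_add_two_mul_sq_div_four' (n : ℕ) : 2 + 2 * (n ^ 2 / 4) =
    (n + 1) ^ 2 / 4 + (n - 1) ^ 2 / 4 + (1 + if Odd (n + 1) then 1 else 0) := by
  rw [sq_div_four_succ n, sq_div_four_eq n]
  split_ifs with h <;> [rw [Nat.odd_iff] at h; rw [Nat.not_odd_iff] at h] <;> omega

/-- The recursion `det_toda` with all common powers of `2ζ + 1` and `1 + ζ / 2` cancelled; `Y` is
a multiple of the cofactor of `detHigh`. -/
theorem exists_bezout_succ (n : ℕ) :
    ∃ Y : ℚ[X], coefA (n + 1) * p (n + 2) - coefB (n + 1) * Y = coefC (n + 1) := by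
  obtain ⟨r, hr⟩ := mul_dvd_of_dvd (two_X_add_one_pow_dvd_detHigh n)
    (X_add_two_pow_dvd_detHigh n)
  have hJ := det_toda n
  have hk := congrArg C (kap_mul_kap n)
  have hk1 : C (kap (n + 1)) * C (kap (n + 1))⁻¹ = 1 := by
    rw [← C_mul, mul_inv_cancel₀ (kap_ne_zero _), C_1]
  have hX2 : (X + 2 : ℚ[X]) = 2 * (1 + C (1 / 2) * X) := by
    linear_combination (-X) * C_half_mul_two
  have hu := two_X_add_one_ne_zero
  have hh := half_factor_ne_zero
  rw [show X * (detHigh X (n + 1) * detLow X (n + 1)) =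
    detHigh X (n + 1) * (X * detLow (X : ℚ[X]) (n + 1)) by ring, X_mul_detLow, hr,
    detMid_eq_kap, detMid_eq_kap, detMid_eq_kap, hX2, Nat.add_sub_cancel,
    show n + 2 - 1 = n + 1 by omega] at hJ
  refine ⟨-C (1 / 4) * C (kap (n + 1))⁻¹ * 2 ^ ((n + 1) ^ 2 / 4) * C (1 / 2) ^ (n ^ 2 / 4) * r, ?_⟩
  have h4 : (C (1 / 4) * 4 : ℚ[X]) = 1 := by
    rw [show (4 : ℚ[X]) = C 4 from (map_ofNat C 4).symm, ← C_mul]; norm_num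
  have hc : -4 * C (kap (n + 1)) ^ 2 * ((2 * X + 1) ^ ((n + 2) ^ 2 / 4) *
      (2 * X + 1) ^ (n ^ 2 / 4) * (1 + C (1 / 2) * X) ^ ((n + 1) ^ 2 / 4) *
      (1 + C (1 / 2) * X) ^ ((n - 1) ^ 2 / 4)) ≠ 0 := by
    have : C (kap (n + 1)) ≠ 0 := C_ne_zero.2 (kap_ne_zero _)
    have : (-4 : ℚ[X]) ≠ 0 := by norm_num
    positivity
  apply mul_left_cancel₀ hc
  have e1 := congrArg ((2 * X + 1 : ℚ[X]) ^ ·) (two_add_two_mul_sq_div_four n)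
  have e2 := congrArg ((1 + C (1 / 2) * X : ℚ[X]) ^ ·) (two_add_two_mul_sq_div_four' n)
  simp only [pow_add _ (_ + _), pow_add _ (_ / _), pow_add _ 2, mul_comm 2 (_ / _), pow_mul]
    at e1 e2
  rw [coefA, coefC, pPrev]
  simp only [mul_pow, C_mul, C_pow, C_neg, map_ofNat] at hJ hk
  rw [add_comm 1 (2 * X)]
  generalize (2 * X + 1 : ℚ[X]) ^ (1 + if Even (n + 1) then 1 else 0) = v1 at *
  generalize (1 + C (1 / 2) * X : ℚ[X]) ^ (1 + if Odd (n + 1) then 1 else 0) = v2 at *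
  generalize (2 * X + 1 : ℚ[X]) ^ ((n + 2) ^ 2 / 4) = u2 at *
  generalize (2 * X + 1 : ℚ[X]) ^ ((n + 1) ^ 2 / 4) = u1 at *
  generalize (2 * X + 1 : ℚ[X]) ^ (n ^ 2 / 4) = u0 at *
  generalize (1 + C (1 / 2) * X : ℚ[X]) ^ ((n + 1) ^ 2 / 4) = w2 at *
  generalize (1 + C (1 / 2) * X : ℚ[X]) ^ (n ^ 2 / 4) = w1 at *
  generalize (1 + C (1 / 2) * X : ℚ[X]) ^ ((n - 1) ^ 2 / 4) = w0 at *
  generalize (1 + C (1 / 2) * X : ℚ[X]) = w at *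
  generalize (2 * X + 1 : ℚ[X]) = u at *
  generalize (2 : ℚ[X]) ^ ((n + 1) ^ 2 / 4) = t1 at *
  generalize C (1 / 2 : ℚ) ^ (n ^ 2 / 4) = t2 at *
  generalize C (kap (n + 1))⁻¹ = k1' at *
  generalize C (kap (n + 1)) = k1 at *
  linear_combination hJ - 2 * (X + 1) ^ 2 * (u2 * u0 * w2 * w0) * (p n * p (n + 2)) * hk -
    k1 * (u2 * u0 * w2 * w0) * coefB (n + 1) * t1 * t2 * r * (k1 * k1' * h4 + hk1) -
    4 * k1 ^ 2 * p (n + 1) ^ 2 * (w ^ 2 * w1 ^ 2 * e1 + u2 * u0 * v1 * e2)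

theorem p_zero : p 0 = 1 := by
  have h := detMid_eq_kap 0
  rw [detMid, coefDet, Matrix.det_isEmpty] at h
  simpa [kap] using h.symm

theorem p_one : p 1 = 3 * X + 1 := by
  have h := detMid_eq_kap 1
  rw [detMid, coefDet, Matrix.det_unique] at h
  have e : (X : ℚ[X][X]) ^ 0 * ((X - C (2 * X + 1)) ^ (1 - 0) * linQ X ^ 0 * linH X)
      = X * X + C (-(3 * X + 1)) * X + C ((2 * X + 1) * X) := by
    rw [linH]
    simp only [C_add, C_mul, C_neg, C_1, map_ofNat]
    ring
  have h1 : (-(3 * X + 1) : ℚ[X]) = C (kap 1) * p 1 := by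
    have h0 := e ▸ h.symm.trans (Matrix.of_apply _ _ _)
    simpa [coeff_C, coeff_one, -map_neg, -neg_add_rev] using h0.symm
  rw [kap] at h1
  norm_num at h1
  linear_combination h1

theorem exists_bezout (n : ℕ) :
    ∃ Y : ℚ[X], coefA n * p (n + 1) - coefB n * Y = coefC n := by
  rcases n with _ | n
  · refine ⟨X ^ 2 + X + C (1 / 2), ?_⟩
    have h1 : (1 : ℚ[X]).reverse = 1 := by simpa using reverse_C (1 : ℚ)
    rw [coefA, coefB, coefC, pPrev, p_one, p_zero, h1, if_pos Even.zero, if_neg (by simp)]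
    linear_combination (-X - 2 * X ^ 2 - 2 * X ^ 3) * C_half_mul_two
  · exact exists_bezout_succ n

theorem natDegree_pPrev (n : ℕ) : (pPrev n).natDegree = n.choose 2 := by
  rcases n with _ | n
  · simp [pPrev]
  · exact natDegree_p n

theorem leadingCoeff_pPrev (n : ℕ) :
    (pPrev n).leadingCoeff = n.centralBinom / 2 ^ ((n + 1) / 2) := by
  rcases n with _ | n
  · simp [pPrev]
  · exact leadingCoeff_p n

theorem pPrev_ne_zero (n : ℕ) : pPrev n ≠ 0 := by
  rcases n with _ | n
  · exact one_ne_zero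
  · exact p_ne_zero n

theorem monic_X_add_one_sq : ((X + 1 : ℚ[X]) ^ 2).Monic := (monic_X_add_C (1 : ℚ)).pow 2

theorem coefA_ne_zero (n : ℕ) : coefA n ≠ 0 :=
  mul_ne_zero monic_X_add_one_sq.ne_zero (pPrev_ne_zero n)

theorem natDegree_coefA (n : ℕ) : (coefA n).natDegree = n.choose 2 + 2 := by
  have : (X + 1 : ℚ[X]).natDegree = 1 := natDegree_X_add_C (1 : ℚ)
  rw [coefA, monic_X_add_one_sq.natDegree_mul' (pPrev_ne_zero n), natDegree_pPrev, natDegree_pow,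
    this]
  ring

theorem leadingCoeff_coefA (n : ℕ) :
    (coefA n).leadingCoeff = n.centralBinom / 2 ^ ((n + 1) / 2) := by
  rw [coefA, leadingCoeff_mul, monic_X_add_one_sq.leadingCoeff, one_mul, leadingCoeff_pPrev]

theorem coefB_ne_zero (n : ℕ) : coefB n ≠ 0 :=
  mul_ne_zero (pow_ne_zero _ X_ne_zero) (by simpa using p_ne_zero n)

theorem natDegree_coefB (n : ℕ) : (coefB n).natDegree = (n + 2).choose 2 := by
  rw [coefB, natDegree_mul (pow_ne_zero _ X_ne_zero) (by simpa using p_ne_zero n), natDegree_X_pow,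
    reverse_natDegree, natTrailingDegree_eq_zero.2 (Or.inr (coeff_zero_p_ne_zero n)),
    natDegree_p, choose_succ_two (n + 1)]
  omega

theorem natDegree_coefC (n : ℕ) : (coefC n).natDegree = 3 + 2 * (n + 1).choose 2 := by
  have h1 := two_X_add_one_ne_zero
  have h2 := half_factor_ne_zero
  have h3 := p_ne_zero n
  rw [coefC, add_comm 1 (2 * X), natDegree_mul (by positivity) (by positivity),
    natDegree_mul (by positivity) (by positivity), natDegree_pow, natDegree_pow, natDegree_pow,
    natDegree_two_X_add_one, natDegree_half_factor, natDegree_p]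
  rcases Nat.even_or_odd n with h | h
  · rw [if_pos h, if_neg (Nat.not_odd_iff_even.2 h)]
  · rw [if_pos h, if_neg (Nat.not_even_iff_odd.2 h)]

theorem leadingCoeff_coefC (n : ℕ) : (coefC n).leadingCoeff =
    (n + 1).centralBinom ^ 2 / (2 ^ ((n + 1) / 2) * 2 ^ ((n + 3) / 2)) := by
  rw [coefC, add_comm 1 (2 * X), leadingCoeff_mul, leadingCoeff_mul, leadingCoeff_pow,
    leadingCoeff_pow, leadingCoeff_pow, leadingCoeff_two_X_add_one, leadingCoeff_half_factor,
    leadingCoeff_p]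
  obtain ⟨k, rfl | rfl⟩ := Nat.even_or_odd' n
  · rw [if_pos (even_two_mul k), if_neg (by simp), show (2 * k + 2) / 2 = k + 1 by omega,
      show (2 * k + 1) / 2 = k by omega, show (2 * k + 3) / 2 = k + 1 by omega]
    field_simp
    ring
  · rw [if_neg (by simp), if_pos (odd_two_mul_add_one k),
      show (2 * k + 1 + 2) / 2 = k + 1 by omega, show (2 * k + 1 + 1) / 2 = k + 1 by omega,
      show (2 * k + 1 + 3) / 2 = k + 2 by omega]
    field_simp
    ring

/-- Equality would give `(2 n + 3) (n + 1) = (2 n + 1) (n + 2)`. -/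
theorem centralBinom_mul_ne (n : ℕ) :
    (n.centralBinom : ℚ) * (n + 2).centralBinom ≠ (n + 1).centralBinom ^ 2 := by
  intro h
  have h1 : ((n : ℚ) + 1) * (n + 1).centralBinom = 2 * (2 * n + 1) * n.centralBinom := by
    exact_mod_cast Nat.succ_mul_centralBinom_succ n
  have h2 : ((n : ℚ) + 2) * (n + 2).centralBinom = 2 * (2 * n + 3) * (n + 1).centralBinom := by
    have := Nat.succ_mul_centralBinom_succ (n + 1)
    have h3 : ((n : ℚ) + 1 + 1) * (n + 2).centralBinom
        = 2 * (2 * (n + 1) + 1) * (n + 1).centralBinom := by exact_mod_cast this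
    linear_combination h3
  have h3 : (n.centralBinom : ℚ) ≠ 0 := by exact_mod_cast Nat.centralBinom_ne_zero n
  have h4 : ((n + 1).centralBinom : ℚ) ≠ 0 := by exact_mod_cast Nat.centralBinom_ne_zero (n + 1)
  have h5 : 2 * (n.centralBinom : ℚ) * (n + 1).centralBinom = 0 := by
    linear_combination (n + 1) * (n + 2) * h - (n + 1) * n.centralBinom * h2 +
      (n + 2) * (n + 1).centralBinom * h1
  simp_all

/-- Both `A pₙ₊₁` and `C` have degree `n ^ 2 + n + 3`, and their leading coefficients differ, so
`B Y` has this degree too. -/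
theorem degree_of_bezout {n : ℕ} {Y : ℚ[X]}
    (h : coefA n * p (n + 1) - coefB n * Y = coefC n) : Y.degree = (coefA n).degree := by
  have hd : (coefA n * p (n + 1)).natDegree = 3 + 2 * (n + 1).choose 2 := by
    rw [natDegree_mul (coefA_ne_zero n) (p_ne_zero _), natDegree_coefA, natDegree_p,
      choose_succ_two (n + 1), choose_succ_two n]
    omega
  have hB : coefB n * Y = coefA n * p (n + 1) - coefC n := by linear_combination -h
  have hc : (coefB n * Y).coeff (3 + 2 * (n + 1).choose 2) ≠ 0 := by
    rw [hB, coeff_sub, sub_ne_zero]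
    have h1 := coeff_natDegree (p := coefA n * p (n + 1))
    have h2 := coeff_natDegree (p := coefC n)
    rw [hd, leadingCoeff_mul, leadingCoeff_coefA, leadingCoeff_p] at h1
    rw [natDegree_coefC, leadingCoeff_coefC] at h2
    rw [h1, h2, div_mul_div_comm, show n + 1 + 2 = n + 3 by rfl, Ne,
      div_left_inj' (by positivity)]
    exact centralBinom_mul_ne n
  have hBY : (coefB n * Y).natDegree = 3 + 2 * (n + 1).choose 2 := by
    refine le_antisymm ?_ (le_natDegree_of_ne_zero hc)
    rw [hB]
    exact (natDegree_sub_le _ _).trans (max_le hd.le (natDegree_coefC n).le)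
  have hY : Y ≠ 0 := by
    rintro rfl
    simp at hc
  rw [natDegree_mul (coefB_ne_zero n) hY, natDegree_coefB, choose_succ_two (n + 1),
    choose_succ_two n] at hBY
  rw [degree_eq_natDegree hY, degree_eq_natDegree (coefA_ne_zero n), natDegree_coefA]
  congr 1
  omega

/-- Two solutions differ by a constant multiple of `(B, A)`, and `B` has degree
`(n + 1) (n + 2) / 2`. -/
theorem eq_of_bezout {n : ℕ} {W₁ W₂ Y₁ Y₂ : ℚ[X]} (hc : IsCoprime (coefA n) (coefB n))
    (h₁ : coefA n * W₁ - coefB n * Y₁ = coefC n) (h₂ : coefA n * W₂ - coefB n * Y₂ = coefC n)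
    (hd₁ : Y₁.degree ≤ (coefA n).degree) (hd₂ : Y₂.degree ≤ (coefA n).degree)
    (hW : W₁.coeff ((n + 2).choose 2) = W₂.coeff ((n + 2).choose 2)) : W₁ = W₂ := by
  have h : coefA n * (W₁ - W₂) = coefB n * (Y₁ - Y₂) := by linear_combination h₁ - h₂
  obtain ⟨c, hY⟩ : coefA n ∣ Y₁ - Y₂ := hc.dvd_of_dvd_mul_left ⟨_, h.symm⟩
  have hWc : W₁ - W₂ = coefB n * c := by
    apply mul_left_cancel₀ (coefA_ne_zero n)
    rw [h, hY]
    ring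
  by_cases hc0 : c = 0
  · rwa [hc0, mul_zero, sub_eq_zero] at hWc
  have hdeg : c.natDegree = 0 := by
    have h1 : (Y₁ - Y₂).natDegree ≤ (coefA n).natDegree :=
      natDegree_le_natDegree ((degree_sub_le _ _).trans (max_le hd₁ hd₂))
    rw [hY, natDegree_mul (coefA_ne_zero n) hc0] at h1
    omega
  obtain ⟨r, rfl⟩ := natDegree_eq_zero.1 hdeg
  have h1 := congrArg (fun q => coeff q ((n + 2).choose 2)) hWc
  simp only [coeff_sub, hW, sub_self, coeff_mul_C] at h1
  rw [← natDegree_coefB n, coeff_natDegree] at h1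
  have hr : r ≠ 0 := fun hr => hc0 (by rw [hr, C_0])
  exact absurd h1.symm (mul_ne_zero (leadingCoeff_ne_zero.2 (coefB_ne_zero n)) hr)

end

end ThreeColour

theorem theorem3p7 :
    (∀ n : ℕ, algebraMap ℚ[X] (RatFunc ℚ) (ThreeColour.p n) = ThreeColour.pFrac n) ∧
    ThreeColour.p 0 = 1 ∧
    ∀ n : ℕ,
      (∃ Y : ℚ[X],
        ThreeColour.coefA n * ThreeColour.p (n + 1) - ThreeColour.coefB n * Y
            = ThreeColour.coefC n ∧
          Y.degree = (ThreeColour.coefA n).degree) ∧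
      (IsCoprime (ThreeColour.coefA n) (ThreeColour.coefB n) →
        ∀ W : ℚ[X], W = ThreeColour.p (n + 1) ↔
          (∃ Y : ℚ[X],
            ThreeColour.coefA n * W - ThreeColour.coefB n * Y = ThreeColour.coefC n ∧
              Y.degree ≤ (ThreeColour.coefA n).degree) ∧
          W.coeff ((n + 1) * (n + 2) / 2)
            = (Nat.choose (2 * n + 4) (n + 2) : ℚ) / 2 ^ ((n + 3) / 2)) := by
  refine ⟨ThreeColour.algebraMap_p, ThreeColour.p_zero, fun n => ?_⟩
  obtain ⟨Y, hY⟩ := ThreeColour.exists_bezout n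
  have hdeg := ThreeColour.degree_of_bezout hY
  have hcoeff : (ThreeColour.p (n + 1)).coeff ((n + 2).choose 2)
      = (Nat.choose (2 * n + 4) (n + 2) : ℚ) / 2 ^ ((n + 3) / 2) := by
    rw [← ThreeColour.natDegree_p (n + 1), coeff_natDegree, ThreeColour.leadingCoeff_p,
      Nat.centralBinom_eq_two_mul_choose, show 2 * (n + 1 + 1) = 2 * n + 4 by ring]
  have hidx : (n + 1) * (n + 2) / 2 = (n + 2).choose 2 := by
    rw [Nat.choose_two_right, mul_comm, Nat.add_succ_sub_one]
  rw [hidx]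
  refine ⟨⟨Y, hY, hdeg⟩, fun hc W => ⟨?_, ?_⟩⟩
  · rintro rfl
    exact ⟨⟨Y, hY, hdeg.le⟩, hcoeff⟩
  · rintro ⟨⟨Y', hY', hdeg'⟩, hW⟩
    exact ThreeColour.eq_of_bezout hc hY' hY hdeg' hdeg.le (hW.trans hcoeff.symm)
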